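/- Let $J_1,J_2\subset\mathbb R$ be open and let $\eta_1=\eta_1(x)$, $x\in J_1$, and $\eta_2=\eta_2(y)$, $y\in J_2$, be smooth functions. Let $\mathcal E$ be the infinite prolongation of the system $$u_{yy}=\frac{\frac12\eta_1'v^2v_x+\frac12\eta_2'uvu_y+(\eta_1-\eta_2)uu_yv_y+u^2v^3}{uv(\eta_1-\eta_2)},\qquad v_{xx}=\frac{\frac12\eta_1'uvv_x+\frac12\eta_2'u^2u_y+(\eta_2-\eta_1)vv_xu_x+u^3v^2}{uv(\eta_2-\eta_1)}$$ on the domain where $x\in J_1$, $y\in J_2$, $\eta_1(x)\ne\eta_2(y)$, $u\neq0$, $v\ne0$. A differential covering with fibre coordinates $w$ is given by smooth functions $w_x$, $w_y$ on the covering space such that the lifted total derivatives $D_x+\sum w_x\,\partial_w$ and $D_y+\sum w_y\,\partial_w$ commute there. The tangent covering $V\mathcal E$ is the system for $(u,v,U,V)$ that consists of the system above and its linearization (in the direction $(U,V)$). A symmetry shadow in a covering is a pair of smooth functions $(U,V)$ on the covering space satisfying the linearized system with respect to the lifted total derivatives. (1) The formulas $$(s_0)_x=\frac{u_y}v,\quad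 (s_0)_y=-\frac{v_x}u,\qquad (s_1)_x=\cos(s_0)\,u,\quad (s_1)_y=v\sin(s_0),\qquad (s_2)_x=-\sin(s_0)\,u,\quad (s_2)_y=v\cos(s_0)$$ define a covering $\mathcal S$ of $\mathcal E$. These formulas together with their linearizations (which define $S_0,S_1,S_2$, the variations of $s_0,s_1,s_2$) define a covering $V\mathcal S$ of $V\mathcal E$, with fibre coordinates $s_i,S_i$. (2) Put $$\tilde U=\eta_1U+\Bigl(\tfrac12\eta_1'\cos s_0+\frac{\sin(s_0)(\eta_2-\eta_1)}{v}u_y\Bigr)S_1+\Bigl(-\tfrac12\eta_1'\sin s_0+\frac{\cos(s_0)(\eta_2-\eta_1)}{v}u_y\Bigr)S_2,$$ $$\tilde V=\eta_2V+\Bigl(\tfrac12\eta_2'\sin s_0-\frac{\cos(s_0)(\eta_2-\eta_1)}{u}v_x\Bigr)S_1+\Bigl(\tfrac12\eta_2'\cos s_0+\frac{\sin(s_0)(\eta_2-\eta_1)}{u}v_x\Bigr)S_2.$$ Then $(u,v,U,V,s_i,S_i)\mapsto(u,v,\tilde U,\tilde V)$ defines a morphism $V\mathcal S\to V\mathcal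 E$: $(\tilde U,\tilde V)$ satisfies the linearized system with all its differential consequences on $V\mathcal S$, and the total derivatives of $V\mathcal S$ project to those of $V\mathcal E$. If moreover $\eta_1$ and $\eta_2$ have no zeros, then this is a Bäcklund auto-transformation of $V\mathcal E$: both the natural projection $V\mathcal S\to V\mathcal E$ and the map above are coverings, each with six-dimensional fibres (in suitable fibre coordinates, $V\mathcal S$ is diffeomorphic to $V\mathcal E\times\mathbb R^6$ over $V\mathcal E$). (3) (Recursion operator.) Let $\mathcal C$ be any covering over $\mathcal S$, and let $(U,V)$ be a symmetry shadow of the system in $\mathcal C$. Adjoin to $\mathcal C$ the nonlocal variables $S_0,S_1,S_2$ defined by the linearized equations for $s_0,s_1,s_2$, into which $(U,V)$ is substituted. This gives a covering $\mathcal C'$ over $\mathcal C$, and the pair $(\tilde U,\tilde V)$ given by the formulas in (2) is a symmetry shadow of the system in $\mathcal C'$. -/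

import Mathlib

open scoped ContDiff Topology

noncomputable section

namespace SDeform

/-! ### Smooth functions of finitely many of possibly infinitely many coordinates -/

section Calculus

variable {I : Type*}

/-- `f` is, near `p`, a smooth function of finitely many of the coordinates
(the space of coordinates carries the product topology). -/
def SmoothAt (f : (I → ℝ) → ℝ) (p : I → ℝ) : Prop :=
  ∃ (s : Finset I) (g : (s → ℝ) → ℝ),
    (∀ᶠ z in 𝓝 (s.restrict p), ContDiffAt ℝ ∞ g z) ∧ ∀ᶠ q in 𝓝 p, f q = g (s.restrict q)

open Classical in
/-- The partial derivative of `f` in the `i`-th coordinate. -/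
def pd (i : I) (f : (I → ℝ) → ℝ) (p : I → ℝ) : ℝ :=
  deriv (fun t => f (Function.update p i t)) (p i)

/-- `∑ i, ξ i * ∂f/∂i` at `p`; only finitely many terms are nonzero where `f` is smooth. -/
def dirDeriv (ξ : I → ℝ) (f : (I → ℝ) → ℝ) (p : I → ℝ) : ℝ :=
  ∑ᶠ i, ξ i * pd i f p

/-- The action of the vector field `∑ i, X i * ∂/∂i` on functions. -/
def along (X : I → (I → ℝ) → ℝ) (f : (I → ℝ) → ℝ) : (I → ℝ) → ℝ :=
  fun p => dirDeriv (fun i => X i p) f p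

end Calculus

/-! ### Infinite jets and infinitely prolonged equations -/

/-- Coordinates on the infinite jets of functions of `x`, `y` with components indexed by `A`:
`jet a i j` stands for the derivative of the component `a`, taken `i` times in `x` and
`j` times in `y`. -/
inductive JetCoord (A : Type*) where
  | x : JetCoord A
  | y : JetCoord A
  | jet (a : A) (i j : ℕ) : JetCoord A

open JetCoord

/-- Coefficients of the total derivative `D_x` on the infinite jet space. -/
def jetX {A : Type*} : JetCoord A → (JetCoord A → ℝ) → ℝ
  | x, _ => 1
  | y, _ => 0
  | jet a i j, q => q (jet a (i + 1) j)

/-- Coefficients of the total derivative `D_y` on the infinite jet space. -/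
def jetY {A : Type*} : JetCoord A → (JetCoord A → ℝ) → ℝ
  | x, _ => 0
  | y, _ => 1
  | jet a i j, q => q (jet a i (j + 1))

/-- The vertical tangent vector with components `φ a i j`. -/
def jetVert {A : Type*} (φ : A → ℕ → ℕ → ℝ) : JetCoord A → ℝ
  | x => 0
  | y => 0
  | jet a i j => φ a i j

/-- Renaming the dependent variables. -/
def JetCoord.map {A B : Type*} (f : A → B) : JetCoord A → JetCoord B
  | x => x
  | y => y
  | jet a i j => jet (f a) i j

/-- A system of differential equations `F k = 0`, `k : K`, considered on the domain `dom`
of the infinite jet space. -/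
structure PDESystem (A K : Type*) where
  dom : Set (JetCoord A → ℝ)
  F : K → (JetCoord A → ℝ) → ℝ

variable {A K A' K' W W' N : Type*}

/-- The infinite prolongation: the points of the jet space that satisfy all differential
consequences of the system. -/
def PDESystem.inf (E : PDESystem A K) : Set (JetCoord A → ℝ) :=
  {q | q ∈ E.dom ∧ ∀ k i j, ((along jetX)^[i] ((along jetY)^[j] (E.F k))) q = 0}

/-- The point of the jet space of `A` below a point of the jet space of `A ⊕ A`. -/
def jetBase (q : JetCoord (A ⊕ A) → ℝ) : JetCoord A → ℝ := fun c => q (c.map Sum.inl)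

/-- The vertical vector encoded by a point of the jet space of `A ⊕ A`. -/
def jetFibre (q : JetCoord (A ⊕ A) → ℝ) : JetCoord A → ℝ :=
  jetVert fun a i j => q (jet (Sum.inr a) i j)

/-- The tangent covering of a system, as a system: the system itself (dependent variables
`Sum.inl a`) together with its linearization (dependent variables `Sum.inr a`). -/
def PDESystem.tangent (E : PDESystem A K) : PDESystem (A ⊕ A) (K ⊕ K) where
  dom := {q | jetBase q ∈ E.dom}
  F := Sum.elim (fun k q => E.F k (jetBase q))
    (fun k q => dirDeriv (jetFibre q) (E.F k) (jetBase q))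

/-! ### Differential coverings in coordinates -/

/-- Data of a differential covering of `E` with fibre coordinates (nonlocal variables) indexed
by `W`: the total derivatives are lifted to `D_x + ∑ w, X w * ∂/∂w` and
`D_y + ∑ w, Y w * ∂/∂w`.  Functions on the covering are given by functions of all jet
coordinates and of the fibre coordinates; `dom` is a region to which the covering is
restricted. -/
structure Cov (E : PDESystem A K) (W : Type*) where
  dom : Set (JetCoord A ⊕ W → ℝ)
  X : W → (JetCoord A ⊕ W → ℝ) → ℝ
  Y : W → (JetCoord A ⊕ W → ℝ) → ℝ

namespace Cov

variable {E : PDESystem A K}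

/-- The covering space: the points lying over the infinitely prolonged equation. -/
def pts (C : Cov E W) : Set (JetCoord A ⊕ W → ℝ) :=
  {p | p ∘ Sum.inl ∈ E.inf ∧ p ∈ C.dom}

/-- The lifted total derivative in `x`. -/
def Dx (C : Cov E W) : ((JetCoord A ⊕ W → ℝ) → ℝ) → (JetCoord A ⊕ W → ℝ) → ℝ :=
  along (Sum.elim (fun c p => jetX c (p ∘ Sum.inl)) C.X)

/-- The lifted total derivative in `y`. -/
def Dy (C : Cov E W) : ((JetCoord A ⊕ W → ℝ) → ℝ) → (JetCoord A ⊕ W → ℝ) → ℝ :=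
  along (Sum.elim (fun c p => jetY c (p ∘ Sum.inl)) C.Y)

/-- The data define a covering: they are smooth, and the lifted total derivatives commute
on the covering space. -/
structure IsCovering (C : Cov E W) : Prop where
  isOpen_dom : IsOpen C.dom
  smooth_X : ∀ w, ∀ p ∈ C.pts, SmoothAt (C.X w) p
  smooth_Y : ∀ w, ∀ p ∈ C.pts, SmoothAt (C.Y w) p
  comm : ∀ w, ∀ p ∈ C.pts, C.Dx (C.Y w) p = C.Dy (C.X w) p

/-- A symmetry shadow of `E` in the covering `C`: a tuple `φ` of smooth functions on the
covering that satisfies the linearized equation on the covering space. -/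
structure IsShadow (C : Cov E W) (φ : A → (JetCoord A ⊕ W → ℝ) → ℝ) : Prop where
  smooth : ∀ a, ∀ p ∈ C.pts, SmoothAt (φ a) p
  lin : ∀ k, ∀ p ∈ C.pts,
    dirDeriv (jetVert fun a i j => (C.Dx^[i] (C.Dy^[j] (φ a))) p) (E.F k) (p ∘ Sum.inl) = 0

/-- Forgetting the fibre coordinates `W'`. -/
def toBase (p : JetCoord A ⊕ (W ⊕ W') → ℝ) : JetCoord A ⊕ W → ℝ :=
  Sum.elim (p ∘ Sum.inl) (fun w => p (Sum.inr (Sum.inl w)))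

/-- A covering over the covering `B`, with additional fibre coordinates `W'`. -/
def extend (B : Cov E W) (dom : Set (JetCoord A ⊕ (W ⊕ W') → ℝ))
    (X Y : W' → (JetCoord A ⊕ (W ⊕ W') → ℝ) → ℝ) : Cov E (W ⊕ W') where
  dom := {p | toBase p ∈ B.dom ∧ p ∈ dom}
  X := Sum.elim (fun w p => B.X w (toBase p)) X
  Y := Sum.elim (fun w p => B.Y w (toBase p)) Y

/-- The point of `JetCoord A ⊕ W` below a point of `JetCoord (A ⊕ A) ⊕ (W ⊕ W)`. -/
def tangentBase (p : JetCoord (A ⊕ A) ⊕ (W ⊕ W) → ℝ) : JetCoord A ⊕ W → ℝ :=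
  Sum.elim (jetBase (p ∘ Sum.inl)) (fun w => p (Sum.inr (Sum.inl w)))

/-- The vertical vector encoded by a point of `JetCoord (A ⊕ A) ⊕ (W ⊕ W)`. -/
def tangentFibre (p : JetCoord (A ⊕ A) ⊕ (W ⊕ W) → ℝ) : JetCoord A ⊕ W → ℝ :=
  Sum.elim (jetFibre (p ∘ Sum.inl)) (fun w => p (Sum.inr (Sum.inr w)))

/-- The tangent covering of a covering `C`, as a covering over the tangent covering of `E`.
Its fibre coordinates are those of `C` (`Sum.inl w`) and their variations (`Sum.inr w`),
the latter being subject to the linearization of the equations that define `C`. -/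
def tangent (C : Cov E W) : Cov E.tangent (W ⊕ W) where
  dom := {p | tangentBase p ∈ C.dom}
  X := Sum.elim (fun w p => C.X w (tangentBase p))
    (fun w p => dirDeriv (tangentFibre p) (C.X w) (tangentBase p))
  Y := Sum.elim (fun w p => C.Y w (tangentBase p))
    (fun w p => dirDeriv (tangentFibre p) (C.Y w) (tangentBase p))

/-- Given a covering `C` over the covering `B` and a tuple `φ` of functions on `C`, adjoin to
`C` the variations `S w` of the fibre coordinates `w` of `B` as new fibre coordinates.  They
are subject to the linearized defining equations of `B`, into which `φ` is substituted for the
variation of the dependent variables. -/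
def adjoinVariations (B : Cov E W) (C : Cov E (W ⊕ W'))
    (φ : A → (JetCoord A ⊕ (W ⊕ W') → ℝ) → ℝ) : Cov E ((W ⊕ W') ⊕ W) :=
  let ξ : (JetCoord A ⊕ ((W ⊕ W') ⊕ W) → ℝ) → JetCoord A ⊕ W → ℝ := fun p =>
    Sum.elim (jetVert fun a i j => (C.Dx^[i] (C.Dy^[j] (φ a))) (toBase p))
      (fun w => p (Sum.inr (Sum.inr w)))
  C.extend Set.univ
    (fun w p => dirDeriv (ξ p) (B.X w) (toBase (toBase p)))
    (fun w p => dirDeriv (ξ p) (B.Y w) (toBase (toBase p)))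

/-! ### Morphisms and Bäcklund transformations -/

/-- The infinite prolongation of a tuple `φ` of functions on the covering `C`. -/
def prol (C : Cov E W) (φ : A' → (JetCoord A ⊕ W → ℝ) → ℝ) (p : JetCoord A ⊕ W → ℝ) :
    JetCoord A' → ℝ
  | x => p (Sum.inl x)
  | y => p (Sum.inl y)
  | jet a i j => (C.Dx^[i] (C.Dy^[j] (φ a))) p

/-- The tuple `φ` of smooth functions on the covering space of `C` defines a morphism to the
infinitely prolonged system `E'`: it satisfies `E'` with all its differential consequences,
and the total derivatives of `C` project to those of `E'`. -/
structure IsMorphism (C : Cov E W) (E' : PDESystem A' K')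
    (φ : A' → (JetCoord A ⊕ W → ℝ) → ℝ) : Prop where
  smooth : ∀ a, ∀ p ∈ C.pts, SmoothAt (φ a) p
  mem_inf : ∀ p ∈ C.pts, C.prol φ p ∈ E'.inf
  Dx_prol : ∀ c, ∀ p ∈ C.pts, C.Dx (fun q => C.prol φ q c) p = jetX c (C.prol φ p)
  Dy_prol : ∀ c, ∀ p ∈ C.pts, C.Dy (fun q => C.prol φ q c) p = jetY c (C.prol φ p)

/-- The morphism given by `φ` makes the covering space of `C` a covering over `E'`, with fibre
coordinates indexed by `N`: there are functions `w` such that `(prol φ, w)` is a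
diffeomorphism of the covering space onto the product of `E'.inf` with the fibre `N → ℝ`;
`ψ` is the inverse diffeomorphism. -/
def IsCoveringOver (C : Cov E W) (E' : PDESystem A' K')
    (φ : A' → (JetCoord A ⊕ W → ℝ) → ℝ) (N : Type*) : Prop :=
  C.IsMorphism E' φ ∧
  ∃ (w : N → (JetCoord A ⊕ W → ℝ) → ℝ)
    (ψ : JetCoord A ⊕ W → (JetCoord A' ⊕ N → ℝ) → ℝ),
    (∀ n, ∀ p ∈ C.pts, SmoothAt (w n) p) ∧
    (∀ c r, r ∘ Sum.inl ∈ E'.inf → SmoothAt (ψ c) r) ∧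
    (∀ p ∈ C.pts, (fun c => ψ c (Sum.elim (C.prol φ p) (fun n => w n p))) = p) ∧
    ∀ r, r ∘ Sum.inl ∈ E'.inf →
      (fun c => ψ c r) ∈ C.pts ∧
      Sum.elim (C.prol φ (fun c => ψ c r)) (fun n => w n (fun c => ψ c r)) = r

/-- The dependent variables of `E`, as functions on a covering of `E`. -/
def depVar (a : A) (p : JetCoord A ⊕ W → ℝ) : ℝ := p (Sum.inl (jet a 0 0))

/-- `C`, a covering of `E`, together with `φ` is a Bäcklund auto-transformation of `E` with
`N`-dimensional fibres: the covering space of `C` covers `E` both by its natural projection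
and by the map that is given by `φ`. -/
def IsBacklundAuto (C : Cov E W) (φ : A → (JetCoord A ⊕ W → ℝ) → ℝ) (N : Type*) : Prop :=
  C.IsCovering ∧ C.IsCoveringOver E depVar N ∧ C.IsCoveringOver E φ N

end Cov

/-! ### The system, its Abelian covering and the recursion operator -/

/-- The two unknown functions. -/
inductive Dep where
  | u : Dep
  | v : Dep

open Dep

/-- The system for `u`, `v`, with `η₁` a function of `x ∈ J₁` and `η₂` a function of `y ∈ J₂`;
each equation is written as left-hand side minus right-hand side. -/
def sysEta (J₁ J₂ : Set ℝ) (η₁ η₂ : ℝ → ℝ) : PDESystem Dep Dep where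
  dom := {q | q x ∈ J₁ ∧ q y ∈ J₂ ∧ η₁ (q x) ≠ η₂ (q y) ∧
    q (jet u 0 0) ≠ 0 ∧ q (jet v 0 0) ≠ 0}
  F
    | Dep.u, q =>
      let e₁ := η₁ (q x)
      let e₂ := η₂ (q y)
      let e₁' := deriv η₁ (q x)
      let e₂' := deriv η₂ (q y)
      let u₀ := q (jet u 0 0)
      let v₀ := q (jet v 0 0)
      let uy := q (jet u 0 1)
      let vx := q (jet v 1 0)
      let vy := q (jet v 0 1)
      q (jet u 0 2) -
        (1 / 2 * e₁' * v₀ ^ 2 * vx + 1 / 2 * e₂' * u₀ * v₀ * uy + (e₁ - e₂) * u₀ * uy * vy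
          + u₀ ^ 2 * v₀ ^ 3) / (u₀ * v₀ * (e₁ - e₂))
    | Dep.v, q =>
      let e₁ := η₁ (q x)
      let e₂ := η₂ (q y)
      let e₁' := deriv η₁ (q x)
      let e₂' := deriv η₂ (q y)
      let u₀ := q (jet u 0 0)
      let v₀ := q (jet v 0 0)
      let ux := q (jet u 1 0)
      let uy := q (jet u 0 1)
      let vx := q (jet v 1 0)
      q (jet v 2 0) -
        (1 / 2 * e₁' * u₀ * v₀ * vx + 1 / 2 * e₂' * u₀ ^ 2 * uy + (e₂ - e₁) * v₀ * vx * ux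
          + u₀ ^ 3 * v₀ ^ 2) / (u₀ * v₀ * (e₂ - e₁))

/-- The covering with nonlocal variables `s₀`, `s₁`, `s₂`. -/
def covS (J₁ J₂ : Set ℝ) (η₁ η₂ : ℝ → ℝ) : Cov (sysEta J₁ J₂ η₁ η₂) (Fin 3) where
  dom := Set.univ
  X := ![fun p => p (Sum.inl (jet u 0 1)) / p (Sum.inl (jet v 0 0)),
    fun p => Real.cos (p (Sum.inr 0)) * p (Sum.inl (jet u 0 0)),
    fun p => -Real.sin (p (Sum.inr 0)) * p (Sum.inl (jet u 0 0))]
  Y := ![fun p => -(p (Sum.inl (jet v 1 0)) / p (Sum.inl (jet u 0 0))),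
    fun p => p (Sum.inl (jet v 0 0)) * Real.sin (p (Sum.inr 0)),
    fun p => p (Sum.inl (jet v 0 0)) * Real.cos (p (Sum.inr 0))]

/-- The right-hand sides of the recursion operator, for a given jet `q` of `u`, `v` and given
values of `s₀`, `U`, `V`, `S₁`, `S₂`. -/
def ro (η₁ η₂ : ℝ → ℝ) (q : JetCoord Dep → ℝ) (s₀ U V S₁ S₂ : ℝ) : Dep → ℝ
  | Dep.u => η₁ (q x) * U
      + (1 / 2 * deriv η₁ (q x) * Real.cos s₀
        + Real.sin s₀ * (η₂ (q y) - η₁ (q x)) / q (jet v 0 0) * q (jet u 0 1)) * S₁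
      + (-(1 / 2) * deriv η₁ (q x) * Real.sin s₀
        + Real.cos s₀ * (η₂ (q y) - η₁ (q x)) / q (jet v 0 0) * q (jet u 0 1)) * S₂
  | Dep.v => η₂ (q y) * V
      + (1 / 2 * deriv η₂ (q y) * Real.sin s₀
        - Real.cos s₀ * (η₂ (q y) - η₁ (q x)) / q (jet u 0 0) * q (jet v 1 0)) * S₁
      + (1 / 2 * deriv η₂ (q y) * Real.cos s₀
        + Real.sin s₀ * (η₂ (q y) - η₁ (q x)) / q (jet u 0 0) * q (jet v 1 0)) * S₂

/-- The recursion operator on the tangent covering of `covS`: the tuple `(u, v, Ũ, Ṽ)`. -/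
def roTangent (η₁ η₂ : ℝ → ℝ) :
    Dep ⊕ Dep → (JetCoord (Dep ⊕ Dep) ⊕ (Fin 3 ⊕ Fin 3) → ℝ) → ℝ
  | Sum.inl a, p => p (Sum.inl (jet (Sum.inl a) 0 0))
  | Sum.inr a, p => ro η₁ η₂ (jetBase (p ∘ Sum.inl)) (p (Sum.inr (Sum.inl 0)))
      (p (Sum.inl (jet (Sum.inr u) 0 0))) (p (Sum.inl (jet (Sum.inr v) 0 0)))
      (p (Sum.inr (Sum.inr 1))) (p (Sum.inr (Sum.inr 2))) a

/-- The recursion operator applied to a pair `φ = (U, V)` of functions on a covering over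
`covS`: the pair `(Ũ, Ṽ)` of functions on the covering with adjoined `S₀`, `S₁`, `S₂`. -/
def roShadow {W : Type*} (η₁ η₂ : ℝ → ℝ) (φ : Dep → (JetCoord Dep ⊕ (Fin 3 ⊕ W) → ℝ) → ℝ) :
    Dep → (JetCoord Dep ⊕ ((Fin 3 ⊕ W) ⊕ Fin 3) → ℝ) → ℝ :=
  fun a p => ro η₁ η₂ (p ∘ Sum.inl) (p (Sum.inr (Sum.inl (Sum.inl 0))))
    (φ u (Cov.toBase p)) (φ v (Cov.toBase p)) (p (Sum.inr (Sum.inr 1))) (p (Sum.inr (Sum.inr 2))) a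

end SDeform

end

noncomputable section

namespace SDeform

/-! ### Smooth functions of finitely many coordinates on a product space -/

section Calculus

variable {I J : Type*}

/-! Put a = u_y/v and b = -v_x/u. The two equations of the system say that (η₂-η₁) D_y a and (η₂-η₁)
D_x b are both equal to ½η₁' b - ½η₂' a - uv (`deriv_a_eq`, `deriv_b_eq`). So D_y a = D_x b, which
makes s₀ compatible; s₁ and s₂ are compatible by the choice of s₀. If α, β are the variations of a,
b, the linearized system says that (η₂-η₁) D_y α and (η₂-η₁) D_x β are both equal to ½η₁' β - ½η₂' α
- uV - vU (`lin_F_u`, `lin_F_v`), which makes S₀ compatible.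

The recursion operator becomes transparent in the rotated variations T = sin s₀ S₁ + cos s₀ S₂ and Z
= cos s₀ S₁ - sin s₀ S₂. They satisfy T_x = aZ - uS₀, Z_x = U - aT, T_y = V + bZ, Z_y = vS₀ - bT,
and the operator reads Ũ = η₁U + ½η₁'Z + (η₂-η₁)aT, Ṽ = η₂V + ½η₂'T + (η₂-η₁)bZ. The corresponding
variations of a and b are α̃ = η₁α + ½η₁'S₀ - uT and β̃ = η₂β + ½η₂'S₀ + vZ (`Dy_roTangent_u`,
`Dx_roTangent_v`). With them the linearized system for (Ũ, Ṽ) is a polynomial identity modulo that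
for (U, V) (`isMorphism_roTangent`).

These identities hold only on the infinitely prolonged equation, while total derivatives act in the
ambient space. They may be differentiated because total derivatives are tangent to the covering
space: every equation is solved for one derivative of its own unknown (`IsNormal`), so the ambient
domain retracts smoothly onto the prolonged equation (`exists_retraction`). Hence a pair satisfying
the equations satisfies all their consequences (`IsCovering.isMorphism`).

If η₁ and η₂ have no zeros, the prolonged operator is triangular in the jets of U, V with diagonal
entries η₁, η₂, modulo s_i, S_i and lower jets (`depLT_prol_sub`). It is inverted coordinate by
coordinate with `exists_fixedPoint`, and s_i, S_i are the six fibre coordinates.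

For a shadow in a covering over 𝒮, adjoining S₀, S₁, S₂ is a pullback of V𝒮 along `toTangent`, so
the last part follows from the morphism already constructed (`IsMorphism.isShadow_comp`). -/

theorem SmoothAt.congr {f g : (I → ℝ) → ℝ} {p : I → ℝ} (h : SmoothAt f p)
    (hfg : ∀ᶠ q in 𝓝 p, g q = f q) : SmoothAt g p := by
  obtain ⟨s, g', hg, hf⟩ := h
  refine ⟨s, g', hg, ?_⟩
  filter_upwards [hf, hfg] with q h1 h2
  rw [h2, h1]

theorem SmoothAt.continuousAt {f : (I → ℝ) → ℝ} {p : I → ℝ} (h : SmoothAt f p) :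
    ContinuousAt f p := by
  obtain ⟨s, g, hg, hf⟩ := h
  have h1 : ContinuousAt (fun q => g (s.restrict q)) p :=
    ContinuousAt.comp (f := s.restrict) hg.self_of_nhds.continuousAt
      (Finset.continuous_restrict s).continuousAt
  exact h1.congr (hf.mono fun q hq => hq.symm)

theorem smoothAt_coord (i : I) (p : I → ℝ) : SmoothAt (fun q => q i) p := by
  refine ⟨{i}, fun z => z ⟨i, Finset.mem_singleton_self i⟩, .of_forall fun z => ?_,
    .of_forall fun q => rfl⟩
  exact (contDiff_apply ℝ ℝ _).contDiffAt

theorem smoothAt_const (c : ℝ) (p : I → ℝ) : SmoothAt (fun _ => c) p :=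
  ⟨∅, fun _ => c, .of_forall fun _ => contDiffAt_const, .of_forall fun _ => rfl⟩

/-- Near `m p` the function `f` sees finitely many components of `m`, and each of these depends
locally on finitely many coordinates. The union of these finite sets carries the composite, which
reduces the claim to finite dimension. -/
theorem SmoothAt.comp {f : (J → ℝ) → ℝ} {m : (I → ℝ) → J → ℝ} {p : I → ℝ}
    (hf : SmoothAt f (m p)) (hm : ∀ j, SmoothAt (fun q => m q j) p) :
    SmoothAt (fun q => f (m q)) p := by
  classical
  have hmc : ContinuousAt m p := continuousAt_pi.2 fun j => (hm j).continuousAt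
  obtain ⟨s, g, hg, hfg⟩ := hf
  choose S G hG hS using hm
  let t : Finset I := s.biUnion S
  have hsub : ∀ j : s, ∀ i : S j, (i : I) ∈ t := fun j i =>
    Finset.mem_biUnion.2 ⟨j, j.2, i.2⟩
  let r : ∀ j : s, (t → ℝ) → (S j → ℝ) := fun j z i => z ⟨i, hsub j i⟩
  have hr : ∀ j, ContDiff ℝ ∞ (r j) := fun j =>
    contDiff_pi.2 fun i => contDiff_apply ℝ ℝ _
  let k : (t → ℝ) → s → ℝ := fun z j => G j (r j z)
  have hk : ∀ᶠ z in 𝓝 (t.restrict p), ContDiffAt ℝ ∞ k z := by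
    have : ∀ᶠ z in 𝓝 (t.restrict p), ∀ j : s, ContDiffAt ℝ ∞ (G j) (r j z) :=
      Filter.eventually_all.2 fun j =>
        ((hr j).continuous.tendsto (t.restrict p)).eventually (hG j)
    filter_upwards [this] with z hz
    exact contDiffAt_pi.2 fun j => ContDiffAt.comp z (hz j) (hr j).contDiffAt
  have hS' : ∀ᶠ q in 𝓝 p, ∀ j : s, m q j = k (t.restrict q) j :=
    Filter.eventually_all.2 fun j => hS j
  have hkp : k (t.restrict p) = s.restrict (m p) := by
    ext j; exact (hS'.self_of_nhds j).symm
  refine ⟨t, fun z => g (k z), ?_, ?_⟩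
  · have h2 : ∀ᶠ z in 𝓝 (t.restrict p), ContDiffAt ℝ ∞ g (k z) := by
      have := hk.self_of_nhds.continuousAt
      rw [ContinuousAt, hkp] at this
      exact this.eventually hg
    filter_upwards [hk, h2] with z h3 h4
    exact ContDiffAt.comp z h4 h3
  · filter_upwards [hmc.eventually hfg, hS'] with q h1 h2
    rw [h1]
    congr 1
    ext j
    exact h2 j

theorem SmoothAt.scalar {f : (I → ℝ) → ℝ} {p : I → ℝ} {h : ℝ → ℝ}
    (hh : ∀ᶠ z in 𝓝 (f p), ContDiffAt ℝ ∞ h z) (hf : SmoothAt f p) :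
    SmoothAt (fun q => h (f q)) p := by
  have : SmoothAt (I := Unit) (fun z => h (z ())) (fun _ => f p) := by
    refine ⟨Finset.univ, fun z => h (z ⟨(), Finset.mem_univ _⟩), ?_, .of_forall fun _ => rfl⟩
    have hc := (continuous_apply (⟨(), Finset.mem_univ _⟩ : (Finset.univ : Finset Unit))
      (A := fun _ => ℝ)).tendsto ((Finset.univ : Finset Unit).restrict fun _ => f p)
    filter_upwards [hc.eventually hh] with z hz
    exact ContDiffAt.comp z hz (contDiff_apply ℝ ℝ _).contDiffAt
  exact SmoothAt.comp (m := fun q _ => f q) this fun _ => hf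

theorem SmoothAt.binary {f g : (I → ℝ) → ℝ} {p : I → ℝ} {h : ℝ → ℝ → ℝ}
    (hh : ContDiff ℝ ∞ fun z : ℝ × ℝ => h z.1 z.2) (hf : SmoothAt f p) (hg : SmoothAt g p) :
    SmoothAt (fun q => h (f q) (g q)) p := by
  have : SmoothAt (I := Bool) (fun z => h (z true) (z false)) (fun b => cond b (f p) (g p)) := by
    refine ⟨Finset.univ, fun z => h (z ⟨true, Finset.mem_univ _⟩) (z ⟨false, Finset.mem_univ _⟩),
      .of_forall fun z => ?_, .of_forall fun _ => rfl⟩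
    exact (hh.comp ((contDiff_apply ℝ ℝ _).prodMk (contDiff_apply ℝ ℝ _))).contDiffAt
  exact SmoothAt.comp (m := fun q b => cond b (f q) (g q)) this fun b => by
    cases b
    · exact hg
    · exact hf

theorem SmoothAt.add {f g : (I → ℝ) → ℝ} {p : I → ℝ} (hf : SmoothAt f p) (hg : SmoothAt g p) :
    SmoothAt (fun q => f q + g q) p :=
  SmoothAt.binary (contDiff_fst.add contDiff_snd) hf hg

theorem SmoothAt.sub {f g : (I → ℝ) → ℝ} {p : I → ℝ} (hf : SmoothAt f p) (hg : SmoothAt g p) :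
    SmoothAt (fun q => f q - g q) p :=
  SmoothAt.binary (contDiff_fst.sub contDiff_snd) hf hg

theorem SmoothAt.mul {f g : (I → ℝ) → ℝ} {p : I → ℝ} (hf : SmoothAt f p) (hg : SmoothAt g p) :
    SmoothAt (fun q => f q * g q) p :=
  SmoothAt.binary (contDiff_fst.mul contDiff_snd) hf hg

theorem SmoothAt.div {f g : (I → ℝ) → ℝ} {p : I → ℝ} (hf : SmoothAt f p) (hg : SmoothAt g p)
    (h0 : g p ≠ 0) : SmoothAt (fun q => f q / g q) p := by
  simp only [div_eq_mul_inv]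
  refine hf.mul (hg.scalar (h := fun z => z⁻¹) ?_)
  filter_upwards [isOpen_ne.mem_nhds h0] with z hz
  exact contDiffAt_inv ℝ hz

theorem SmoothAt.sum {f : J → (I → ℝ) → ℝ} {p : I → ℝ} (s : Finset J)
    (h : ∀ j ∈ s, SmoothAt (f j) p) : SmoothAt (fun q => ∑ j ∈ s, f j q) p := by
  classical
  induction s using Finset.induction_on with
  | empty => simpa using smoothAt_const 0 p
  | insert a s ha ih =>
    simp only [Finset.sum_insert ha]
    exact (h a (by simp)).add (ih fun j hj => h j (by simp [hj]))

open Classical in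
theorem pd_of_rep {f : (I → ℝ) → ℝ} {p : I → ℝ} {s : Finset I} {g : (s → ℝ) → ℝ}
    (hg : DifferentiableAt ℝ g (s.restrict p)) (hf : ∀ᶠ q in 𝓝 p, f q = g (s.restrict q)) (i : I) :
    pd i f p = if h : i ∈ s then fderiv ℝ g (s.restrict p) (Pi.single ⟨i, h⟩ 1) else 0 := by
  have hu : Filter.Tendsto (fun t => Function.update p i t) (𝓝 (p i)) (𝓝 p) := by
    have : Continuous fun t => Function.update p i t := continuous_const.update i continuous_id
    simpa only [Function.update_eq_self] using this.tendsto (p i)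
  have h1 : (fun t => f (Function.update p i t)) =ᶠ[𝓝 (p i)]
      fun t => g (s.restrict (Function.update p i t)) := hu.eventually hf
  rw [pd, h1.deriv_eq]
  split_ifs with h
  · have h2 : ∀ t, s.restrict (Function.update p i t)
        = Function.update (s.restrict p) ⟨i, h⟩ t := by
      intro t
      ext j
      by_cases hj : j = ⟨i, h⟩
      · subst hj; simp
      · have : (j : I) ≠ i := fun e => hj (Subtype.ext e)
        simp [hj, this]
    simp only [h2]
    have h3 : HasDerivAt (fun t => Function.update (s.restrict p) ⟨i, h⟩ t)
        (Pi.single ⟨i, h⟩ 1) (p i) := hasDerivAt_update _ _ _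
    have h4 : Function.update (s.restrict p) ⟨i, h⟩ (p i) = s.restrict p := 
      Function.update_eq_self (⟨i, h⟩ : s) (s.restrict p)
    exact (HasFDerivAt.comp_hasDerivAt (p i) (by rw [h4]; exact hg.hasFDerivAt) h3).deriv
  · have h2 : ∀ t, s.restrict (Function.update p i t) = s.restrict p := by
      intro t
      ext j
      have : (j : I) ≠ i := fun e => h (e ▸ j.2)
      simp [this]
    simp only [h2, deriv_const]

theorem dirDeriv_eq_sum_of_rep {f : (I → ℝ) → ℝ} {p : I → ℝ} {s : Finset I} {g : (s → ℝ) → ℝ}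
    (hg : DifferentiableAt ℝ g (s.restrict p)) (hf : ∀ᶠ q in 𝓝 p, f q = g (s.restrict q))
    (ξ : I → ℝ) : dirDeriv ξ f p = ∑ i ∈ s, ξ i * pd i f p := by
  refine finsum_eq_sum_of_support_subset _ fun i hi => ?_
  by_contra h
  refine hi ?_
  have h' : i ∉ s := h
  simp [pd_of_rep hg hf i, h']

/-- Turns the formally infinite sum into a Fréchet derivative on a finite-dimensional space. -/
theorem dirDeriv_of_rep {f : (I → ℝ) → ℝ} {p : I → ℝ} {s : Finset I} {g : (s → ℝ) → ℝ}
    (hg : DifferentiableAt ℝ g (s.restrict p)) (hf : ∀ᶠ q in 𝓝 p, f q = g (s.restrict q))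
    (ξ : I → ℝ) : dirDeriv ξ f p = fderiv ℝ g (s.restrict p) (s.restrict ξ) := by
  classical
  rw [dirDeriv_eq_sum_of_rep hg hf, ← Finset.sum_coe_sort s]
  conv_rhs => rw [← ContinuousLinearMap.coe_coe, LinearMap.pi_apply_eq_sum_univ]
  refine Finset.sum_congr rfl fun i _ => ?_
  rw [pd_of_rep hg hf i, dif_pos i.2]
  refine congrArg (fun z => ξ i * fderiv ℝ g (s.restrict p) z) ?_
  ext j
  simp [Pi.single_apply, eq_comm]

/-- Expresses `dirDeriv` as a one-variable derivative along any curve with velocity `ξ`. Uniqueness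
of derivatives then yields the chain rule, locality and the calculus rules below. -/
theorem SmoothAt.hasDerivAt {f : (I → ℝ) → ℝ} {p : I → ℝ} (h : SmoothAt f p)
    {γ : ℝ → I → ℝ} {ξ : I → ℝ} {t : ℝ} (hγ : ∀ i, HasDerivAt (fun τ => γ τ i) (ξ i) t)
    (hp : γ t = p) : HasDerivAt (fun τ => f (γ τ)) (dirDeriv ξ f p) t := by
  subst hp
  obtain ⟨s, g, hg, hf⟩ := h
  have hd := hg.self_of_nhds.differentiableAt (by simp)
  rw [dirDeriv_of_rep hd hf]
  have h1 : HasDerivAt (fun τ => s.restrict (γ τ)) (s.restrict ξ) t :=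
    hasDerivAt_pi.2 fun i => hγ i
  have hc : ContinuousAt γ t := continuousAt_pi.2 fun i => (hγ i).continuousAt
  exact (HasFDerivAt.comp_hasDerivAt t hd.hasFDerivAt h1).congr_of_eventuallyEq
    (hc.eventually hf)

theorem SmoothAt.hasDerivAt_line {f : (I → ℝ) → ℝ} {p : I → ℝ} (h : SmoothAt f p) (ξ : I → ℝ) :
    HasDerivAt (fun t : ℝ => f (p + t • ξ)) (dirDeriv ξ f p) 0 := by
  refine h.hasDerivAt (γ := fun t : ℝ => p + t • ξ) (fun i => ?_) (by simp)
  simpa using ((hasDerivAt_id (0 : ℝ)).mul_const (ξ i)).const_add (p i)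

theorem SmoothAt.dirDeriv_comp {f : (J → ℝ) → ℝ} {m : (I → ℝ) → J → ℝ} {p : I → ℝ}
    (hf : SmoothAt f (m p)) (hm : ∀ j, SmoothAt (fun q => m q j) p) (ξ : I → ℝ) :
    dirDeriv ξ (fun q => f (m q)) p
      = dirDeriv (fun j => dirDeriv ξ (fun q => m q j) p) f (m p) :=
  ((hf.comp hm).hasDerivAt_line ξ).unique
    (hf.hasDerivAt (γ := fun t : ℝ => m (p + t • ξ)) (fun j => (hm j).hasDerivAt_line ξ) (by simp))

theorem dirDeriv_congr_of_eventuallyEq {f g : (I → ℝ) → ℝ} {p : I → ℝ} (hf : SmoothAt f p)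
    (h : ∀ᶠ q in 𝓝 p, g q = f q) (ξ : I → ℝ) : dirDeriv ξ g p = dirDeriv ξ f p := by
  have hc : ContinuousAt (fun t : ℝ => p + t • ξ) 0 :=
    (continuous_const.add (continuous_id.smul continuous_const)).continuousAt
  have hc' : Filter.Tendsto (fun t : ℝ => p + t • ξ) (𝓝 0) (𝓝 p) := by
    simpa [ContinuousAt] using hc
  exact ((hf.congr h).hasDerivAt_line ξ).unique
    ((hf.hasDerivAt_line ξ).congr_of_eventuallyEq (hc'.eventually h))

/-- The finite set `s` stays the same for all partial derivatives, so a sum over `s` can be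
differentiated again term by term. -/
theorem smoothAt_pd {f : (I → ℝ) → ℝ} {p : I → ℝ} {s : Finset I} {g : (s → ℝ) → ℝ}
    (hg : ∀ᶠ z in 𝓝 (s.restrict p), ContDiffAt ℝ ∞ g z)
    (hf : ∀ᶠ q in 𝓝 p, f q = g (s.restrict q)) (i : I) :
    ∃ g' : (s → ℝ) → ℝ, (∀ᶠ z in 𝓝 (s.restrict p), ContDiffAt ℝ ∞ g' z) ∧
      ∀ᶠ q in 𝓝 p, pd i f q = g' (s.restrict q) := by
  classical
  refine ⟨fun z => if h : i ∈ s then fderiv ℝ g z (Pi.single ⟨i, h⟩ 1) else 0, ?_, ?_⟩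
  · filter_upwards [hg] with z hz
    split_ifs with h
    · exact (hz.fderiv_right (m := ∞) (by simp)).clm_apply contDiffAt_const
    · exact contDiffAt_const
  · filter_upwards [((Finset.continuous_restrict s).tendsto p).eventually hg,
      hf.eventually_nhds] with q h1 h2
    convert pd_of_rep (h1.differentiableAt (by simp)) h2 i

theorem pd_comm {f : (I → ℝ) → ℝ} {p : I → ℝ} (h : SmoothAt f p) (i j : I) :
    pd i (pd j f) p = pd j (pd i f) p := by
  classical
  obtain ⟨s, g, hg, hf⟩ := h
  have key : ∀ k, ∀ᶠ q in 𝓝 p, pd k f q =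
      (fun z => if h : k ∈ s then fderiv ℝ g z (Pi.single ⟨k, h⟩ 1) else 0) (s.restrict q) := by
    intro k
    filter_upwards [((Finset.continuous_restrict s).tendsto p).eventually hg,
      hf.eventually_nhds] with q h1 h2
    convert pd_of_rep (h1.differentiableAt (by simp)) h2 k
  have hz := hg.self_of_nhds
  have hd := (hz.fderiv_right (m := ∞) (by simp)).differentiableAt (by simp)
  have hdk : ∀ k, DifferentiableAt ℝ
      (fun z => if h : k ∈ s then fderiv ℝ g z (Pi.single ⟨k, h⟩ 1) else 0) (s.restrict p) := by
    intro k
    split_ifs with h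
    · exact hd.clm_apply (differentiableAt_const _)
    · exact differentiableAt_const _
  rw [pd_of_rep (hdk j) (key j) i, pd_of_rep (hdk i) (key i) j]
  have hsymm : IsSymmSndFDerivAt ℝ g (s.restrict p) :=
    hz.isSymmSndFDerivAt (by simpa using ENat.LEInfty.out)
  by_cases hi : i ∈ s <;> by_cases hj : j ∈ s <;> simp only [hi, hj, dite_true, dite_false]
  · rw [fderiv_clm_apply hd (differentiableAt_const _), fderiv_clm_apply hd (differentiableAt_const _)]
    simpa using hsymm _ _
  · simp
  · simp

theorem SmoothAt.dirDeriv {f : (J → ℝ) → ℝ} {m ξ : (I → ℝ) → J → ℝ} {p : I → ℝ}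
    (hf : SmoothAt f (m p)) (hm : ∀ j, SmoothAt (fun q => m q j) p)
    (hξ : ∀ j, SmoothAt (fun q => ξ q j) p) :
    SmoothAt (fun q => SDeform.dirDeriv (ξ q) f (m q)) p := by
  have hmc : ContinuousAt m p := continuousAt_pi.2 fun j => (hm j).continuousAt
  obtain ⟨s, g, hg, hfg⟩ := hf
  have h1 : SmoothAt (fun q => ∑ j ∈ s, ξ q j * pd j f (m q)) p := by
    refine SmoothAt.sum s fun j _ => (hξ j).mul ?_
    obtain ⟨g', h1, h2⟩ := smoothAt_pd hg hfg j
    exact SmoothAt.comp (f := pd j f) ⟨s, g', h1, h2⟩ hm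
  refine h1.congr ?_
  have h2 := ((Finset.continuous_restrict s).tendsto (m p)).eventually hg
  filter_upwards [hmc.eventually h2, hmc.eventually hfg.eventually_nhds] with q h3 h4
  exact dirDeriv_eq_sum_of_rep (h3.differentiableAt (by simp)) h4 _

theorem SmoothAt.along {X : I → (I → ℝ) → ℝ} {f : (I → ℝ) → ℝ} {p : I → ℝ}
    (hX : ∀ i, SmoothAt (X i) p) (hf : SmoothAt f p) : SmoothAt (SDeform.along X f) p :=
  SmoothAt.dirDeriv (m := fun q => q) hf (fun i => smoothAt_coord i p) hX

/-- `f` is smooth at `p`, with derivative `d` in the direction `ξ`. -/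
structure HasDD (ξ : I → ℝ) (p : I → ℝ) (f : (I → ℝ) → ℝ) (d : ℝ) : Prop where
  smooth : SmoothAt f p
  eq : dirDeriv ξ f p = d

namespace HasDD

variable {ξ p : I → ℝ} {f g : (I → ℝ) → ℝ} {d e : ℝ}

theorem of_smooth (h : SmoothAt f p) (ξ : I → ℝ) : HasDD ξ p f (dirDeriv ξ f p) := ⟨h, rfl⟩

theorem hasDerivAt (h : HasDD ξ p f d) : HasDerivAt (fun t : ℝ => f (p + t • ξ)) d 0 :=
  h.eq ▸ h.smooth.hasDerivAt_line ξ

theorem of_hasDerivAt (h : SmoothAt f p) (h' : HasDerivAt (fun t : ℝ => f (p + t • ξ)) d 0) :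
    HasDD ξ p f d :=
  ⟨h, (h.hasDerivAt_line ξ).unique h'⟩

theorem coord (i : I) : HasDD ξ p (fun q => q i) (ξ i) :=
  of_hasDerivAt (smoothAt_coord i p) <| by
    simpa using ((hasDerivAt_id (0 : ℝ)).mul_const (ξ i)).const_add (p i)

theorem const (c : ℝ) : HasDD ξ p (fun _ => c) 0 :=
  of_hasDerivAt (smoothAt_const c p) (hasDerivAt_const _ _)

theorem add (hf : HasDD ξ p f d) (hg : HasDD ξ p g e) : HasDD ξ p (fun q => f q + g q) (d + e) :=
  of_hasDerivAt (hf.smooth.add hg.smooth) (hf.hasDerivAt.add hg.hasDerivAt)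

theorem sub (hf : HasDD ξ p f d) (hg : HasDD ξ p g e) : HasDD ξ p (fun q => f q - g q) (d - e) :=
  of_hasDerivAt (hf.smooth.sub hg.smooth) (hf.hasDerivAt.sub hg.hasDerivAt)

theorem mul (hf : HasDD ξ p f d) (hg : HasDD ξ p g e) :
    HasDD ξ p (fun q => f q * g q) (d * g p + f p * e) :=
  of_hasDerivAt (hf.smooth.mul hg.smooth) (by simpa using hf.hasDerivAt.fun_mul hg.hasDerivAt)

theorem div (hf : HasDD ξ p f d) (hg : HasDD ξ p g e) (h0 : g p ≠ 0) :
    HasDD ξ p (fun q => f q / g q) ((d * g p - f p * e) / g p ^ 2) :=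
  of_hasDerivAt (hf.smooth.div hg.smooth h0)
    (by simpa using hf.hasDerivAt.fun_div hg.hasDerivAt (by simpa using h0))

theorem scalar {h : ℝ → ℝ} (hh : ∀ᶠ z in 𝓝 (f p), ContDiffAt ℝ ∞ h z) (hf : HasDD ξ p f d) :
    HasDD ξ p (fun q => h (f q)) (deriv h (f p) * d) := by
  have hd : HasDerivAt h (deriv h (f p)) (f p) :=
    (hh.self_of_nhds.differentiableAt (by simp)).hasDerivAt
  refine of_hasDerivAt (hf.smooth.scalar hh) (HasDerivAt.comp (h₂ := h) 0 ?_ hf.hasDerivAt)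
  simpa using hd

theorem neg (hf : HasDD ξ p f d) : HasDD ξ p (fun q => -f q) (-d) := by
  simpa using (const 0).sub hf

theorem sin (hf : HasDD ξ p f d) : HasDD ξ p (fun q => Real.sin (f q)) (Real.cos (f p) * d) := by
  simpa using hf.scalar (h := Real.sin) (.of_forall fun z => Real.contDiff_sin.contDiffAt)

theorem cos (hf : HasDD ξ p f d) : HasDD ξ p (fun q => Real.cos (f q)) (-Real.sin (f p) * d) := by
  simpa using hf.scalar (h := Real.cos) (.of_forall fun z => Real.contDiff_cos.contDiffAt)

theorem congr (hf : HasDD ξ p f d) (h : ∀ᶠ q in 𝓝 p, g q = f q) : HasDD ξ p g d :=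
  ⟨hf.smooth.congr h, (dirDeriv_congr_of_eventuallyEq hf.smooth h ξ).trans hf.eq⟩

theorem congr_val (hf : HasDD ξ p f d) (h : d = e) : HasDD ξ p f e := h ▸ hf

theorem sum {s : Finset J} {f : J → (I → ℝ) → ℝ} {d : J → ℝ}
    (h : ∀ j ∈ s, HasDD ξ p (f j) (d j)) :
    HasDD ξ p (fun q => ∑ j ∈ s, f j q) (∑ j ∈ s, d j) := by
  refine of_hasDerivAt (SmoothAt.sum s fun j hj => (h j hj).smooth) ?_
  exact HasDerivAt.fun_sum fun j hj => (h j hj).hasDerivAt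

end HasDD

/-- The commutator of two vector fields is the vector field with coefficients X(Y i) - Y(X i),
because the second-order terms cancel by the symmetry of second derivatives. Only the values of the
coefficients of the commutator at `p` enter. -/
theorem along_comm {X Y : I → (I → ℝ) → ℝ} {f : (I → ℝ) → ℝ} {p : I → ℝ}
    (hX : ∀ i, SmoothAt (X i) p) (hY : ∀ i, SmoothAt (Y i) p) (hf : SmoothAt f p)
    (hc : ∀ i, along X (Y i) p = along Y (X i) p) :
    along X (along Y f) p = along Y (along X f) p := by
  have hf' := hf
  obtain ⟨s, g, hg, hfg⟩ := hf
  have hpd := smoothAt_pd hg hfg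
  have hsum : ∀ ξ : I → ℝ, ∀ i, dirDeriv ξ (pd i f) p = ∑ j ∈ s, ξ j * pd j (pd i f) p := by
    intro ξ i
    obtain ⟨g', h1, h2⟩ := hpd i
    exact dirDeriv_eq_sum_of_rep (h1.self_of_nhds.differentiableAt (by simp)) h2 ξ
  have hev : ∀ Z : I → (I → ℝ) → ℝ, ∀ᶠ q in 𝓝 p, along Z f q = ∑ i ∈ s, Z i q * pd i f q := by
    intro Z
    filter_upwards [((Finset.continuous_restrict s).tendsto p).eventually hg,
      hfg.eventually_nhds] with q h1 h2
    exact dirDeriv_eq_sum_of_rep (h1.differentiableAt (by simp)) h2 _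
  have key : ∀ Z Z' : I → (I → ℝ) → ℝ, (∀ i, SmoothAt (Z' i) p) → along Z (along Z' f) p
      = ∑ i ∈ s, (along Z (Z' i) p * pd i f p
        + Z' i p * ∑ j ∈ s, Z j p * pd j (pd i f) p) := by
    intro Z Z' hZ'
    have : HasDD (fun i => Z i p) p (fun q => ∑ i ∈ s, Z' i q * pd i f q)
        (∑ i ∈ s, (along Z (Z' i) p * pd i f p
        + Z' i p * ∑ j ∈ s, Z j p * pd j (pd i f) p)) := by
      refine HasDD.sum fun i _ => HasDD.mul ⟨hZ' i, rfl⟩ ⟨?_, hsum _ _⟩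
      obtain ⟨g', h1, h2⟩ := hpd i
      exact ⟨s, g', h1, h2⟩
    exact (this.congr (hev Z')).eq
  rw [key X Y hY, key Y X hX, Finset.sum_add_distrib, Finset.sum_add_distrib]
  congr 1
  · exact Finset.sum_congr rfl fun i _ => by rw [hc]
  · simp only [Finset.mul_sum]
    rw [Finset.sum_comm]
    refine Finset.sum_congr rfl fun i _ => Finset.sum_congr rfl fun j _ => ?_
    rw [pd_comm hf' i j]
    ring

end Calculus

/-! ### Vector fields tangent to a subset -/

section VectorFields

variable {I J : Type*}

@[simp] theorem along_coord (X : I → (I → ℝ) → ℝ) (i : I) : along X (fun q => q i) = X i :=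
  funext fun _ => (HasDD.coord i).eq

/-- The hypothesis `hX` says that the differential of `m` takes `X` at `p` to `X'` at `m p`; this is
the chain rule for related fields. -/
theorem along_comp {X : I → (I → ℝ) → ℝ} {X' : J → (J → ℝ) → ℝ} {m : (I → ℝ) → J → ℝ}
    {f : (J → ℝ) → ℝ} {p : I → ℝ} (hm : ∀ c, SmoothAt (fun q => m q c) p)
    (hX : ∀ c, along X (fun q => m q c) p = X' c (m p)) (hf : SmoothAt f (m p)) :
    along X (fun q => f (m q)) p = along X' f (m p) :=
  (hf.dirDeriv_comp hm _).trans (congrArg (fun ξ => dirDeriv ξ f (m p)) (funext hX))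

/-- The vector field `X` has smooth coefficients on `S` and is tangent to `S`. -/
structure IsTangent (S : Set (I → ℝ)) (X : I → (I → ℝ) → ℝ) : Prop where
  smooth : ∀ i, ∀ p ∈ S, SmoothAt (X i) p
  zero : ∀ f : (I → ℝ) → ℝ, (∀ p ∈ S, SmoothAt f p) → (∀ p ∈ S, f p = 0) →
    ∀ p ∈ S, along X f p = 0

variable {S : Set (I → ℝ)} {X Y : I → (I → ℝ) → ℝ} {f g : (I → ℝ) → ℝ}

theorem isTangent_of_isOpen (hS : IsOpen S) (hX : ∀ i, ∀ p ∈ S, SmoothAt (X i) p) :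
    IsTangent S X where
  smooth := hX
  zero f _ h0 p hp := by
    refine ((HasDD.const (0 : ℝ)).congr ?_).eq
    filter_upwards [hS.mem_nhds hp] with q hq using h0 q hq

theorem smooth_iterate (hX : ∀ i, ∀ p ∈ S, SmoothAt (X i) p) (hf : ∀ p ∈ S, SmoothAt f p) (n : ℕ) :
    ∀ p ∈ S, SmoothAt ((along X)^[n] f) p := by
  induction n with
  | zero => exact hf
  | succ n ih =>
    intro p hp
    rw [Function.iterate_succ_apply']
    exact (ih p hp).along fun i => hX i p hp

/-- The tool for differentiating identities that hold only on `S`, although `along` looks at values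
off `S` too. -/
theorem IsTangent.congr (hX : IsTangent S X) (hf : ∀ p ∈ S, SmoothAt f p)
    (hg : ∀ p ∈ S, SmoothAt g p) (h : ∀ p ∈ S, f p = g p) :
    ∀ p ∈ S, along X f p = along X g p := by
  intro p hp
  have h1 := hX.zero (fun q => f q - g q) (fun q hq => (hf q hq).sub (hg q hq))
    (fun q hq => sub_eq_zero.2 (h q hq)) p hp
  have h2 := ((HasDD.of_smooth (hf p hp) (fun i => X i p)).sub (.of_smooth (hg p hp) _)).eq
  exact sub_eq_zero.1 (h2.symm.trans h1)

/-- Each step of the iteration knows the equality only on `S`; tangency lets it be differentiated,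
and relatedness of the fields moves the derivative through `m`. -/
theorem IsTangent.iterate_comp {S' : Set (J → ℝ)} {X' : J → (J → ℝ) → ℝ} {m : (I → ℝ) → J → ℝ}
    (hX : IsTangent S X) (hX' : ∀ i, ∀ p ∈ S', SmoothAt (X' i) p)
    (hS : ∀ p ∈ S, m p ∈ S') (hm : ∀ c, ∀ p ∈ S, SmoothAt (fun q => m q c) p)
    (hXm : ∀ c, ∀ p ∈ S, along X (fun q => m q c) p = X' c (m p))
    {f : (J → ℝ) → ℝ} (hf : ∀ p ∈ S', SmoothAt f p) (hg : ∀ p ∈ S, SmoothAt g p)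
    (h : ∀ p ∈ S, g p = f (m p)) (n : ℕ) :
    ∀ p ∈ S, (along X)^[n] g p = (along X')^[n] f (m p) := by
  induction n with
  | zero => exact h
  | succ n ih =>
    intro p hp
    rw [Function.iterate_succ_apply', Function.iterate_succ_apply']
    have hs := smooth_iterate hX' hf n
    rw [hX.congr (smooth_iterate hX.smooth hg n)
      (fun q hq => (hs _ (hS q hq)).comp fun c => hm c q hq) ih p hp]
    exact along_comp (fun c => hm c p hp) (fun c => hXm c p hp) (hs _ (hS p hp))

theorem IsTangent.iterate_zero (hX : IsTangent S X) (hf : ∀ p ∈ S, SmoothAt f p)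
    (h : ∀ p ∈ S, f p = 0) (n : ℕ) : ∀ p ∈ S, (along X)^[n] f p = 0 := by
  induction n with
  | zero => exact h
  | succ n ih =>
    intro p hp
    rw [Function.iterate_succ_apply']
    exact hX.zero _ (smooth_iterate hX.smooth hf n) ih p hp

/-- The fields commute on `S` only, so every exchange under further derivatives needs tangency
again. -/
theorem IsTangent.along_iterate_comm (hX : IsTangent S X) (hY : IsTangent S Y)
    (hc : ∀ i, ∀ p ∈ S, along X (Y i) p = along Y (X i) p) (hf : ∀ p ∈ S, SmoothAt f p) (n : ℕ) :
    ∀ p ∈ S, along Y ((along X)^[n] f) p = (along X)^[n] (along Y f) p := by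
  induction n with
  | zero => exact fun p _ => rfl
  | succ n ih =>
    intro p hp
    rw [Function.iterate_succ_apply', Function.iterate_succ_apply']
    have hs := smooth_iterate hX.smooth hf n
    have hYf : ∀ p ∈ S, SmoothAt (along Y f) p := fun p hp =>
      (hf p hp).along fun i => hY.smooth i p hp
    rw [← along_comm (fun i => hX.smooth i p hp) (fun i => hY.smooth i p hp) (hs p hp)
      fun i => hc i p hp]
    exact hX.congr (fun q hq => (hs q hq).along fun i => hY.smooth i q hq)
      (smooth_iterate hX.smooth hYf n) ih p hp

end VectorFields

/-! ### Triangular systems in infinitely many unknowns -/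

section Levels

variable {I J : Type*}

/-- On `U`, the values of `f` are determined by the coordinates of level less than `n`. -/
def DepLT (U : Set (I → ℝ)) (lev : I → ℕ) (n : ℕ) (f : (I → ℝ) → ℝ) : Prop :=
  ∀ p ∈ U, ∀ q ∈ U, (∀ c, lev c < n → p c = q c) → f p = f q

variable {U : Set (I → ℝ)} {lev : I → ℕ} {n : ℕ} {f : (I → ℝ) → ℝ}

/-- The lines from `p` along `ξ` and from `q` along `ζ` agree in all coordinates of level below `n`,
so `f` has the same values on both near the starting points. -/
theorem DepLT.dirDeriv_congr (h : DepLT U lev n f) (hU : IsOpen U) (hf : ∀ p ∈ U, SmoothAt f p)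
    {p q ξ ζ : I → ℝ} (hp : p ∈ U) (hq : q ∈ U) (hpq : ∀ c, lev c < n → p c = q c)
    (hξ : ∀ c, lev c < n → ξ c = ζ c) : dirDeriv ξ f p = dirDeriv ζ f q := by
  have ht : ∀ (p ξ : I → ℝ), p ∈ U → ∀ᶠ t : ℝ in 𝓝 0, p + t • ξ ∈ U := by
    intro p ξ hp
    have hc : Continuous fun t : ℝ => p + t • ξ :=
      continuous_const.add (continuous_id.smul continuous_const)
    exact hc.continuousAt.eventually (hU.mem_nhds (by simpa using hp))
  refine ((hf p hp).hasDerivAt_line ξ).unique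
    (((hf q hq).hasDerivAt_line ζ).congr_of_eventuallyEq ?_)
  filter_upwards [ht p ξ hp, ht q ζ hq] with t h1 h2
  refine h _ h1 _ h2 fun c hc => ?_
  simp [hpq c hc, hξ c hc]

theorem DepLT.along {X : I → (I → ℝ) → ℝ} (h : DepLT U lev n f) (hU : IsOpen U)
    (hf : ∀ p ∈ U, SmoothAt f p) (hX : ∀ c, lev c < n → DepLT U lev (n + 1) (X c)) :
    DepLT U lev (n + 1) (SDeform.along X f) := fun p hp q hq hpq =>
  h.dirDeriv_congr hU hf hp hq (fun c hc => hpq c (hc.trans n.lt_succ_self))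
    fun c hc => hX c hc p hp q hq hpq

/-- A triangular system of equations `T r p = p` for `p` has a unique solution, which depends
smoothly on the parameters `r`. -/
theorem exists_fixedPoint {V : Set (J → ℝ)} (n₀ : ℕ) (T : (J → ℝ) → (I → ℝ) → I → ℝ)
    (hU : ∀ p ∈ U, ∀ p' : I → ℝ, (∀ c, lev c < n₀ → p c = p' c) → p' ∈ U)
    (hT : ∀ r ∈ V, ∀ p ∈ U, T r p ∈ U)
    (hdep : ∀ r ∈ V, ∀ c, DepLT U lev (lev c) fun p => T r p c)
    (hsm : ∀ r ∈ V, ∀ m : (J → ℝ) → I → ℝ, (∀ c, SmoothAt (fun r => m r c) r) → m r ∈ U →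
      ∀ c, SmoothAt (fun r => T r (m r) c) r)
    (m₀ : (J → ℝ) → I → ℝ) (hm₀ : ∀ r ∈ V, m₀ r ∈ U)
    (hm₀s : ∀ r ∈ V, ∀ c, SmoothAt (fun r => m₀ r c) r) :
    ∃ R : (J → ℝ) → I → ℝ, ∀ r ∈ V, R r ∈ U ∧ T r (R r) = R r ∧
      (∀ c, SmoothAt (fun r => R r c) r) ∧ ∀ p ∈ U, T r p = p → p = R r := by
  -- The `n`-th iterate is already correct in all levels below `n`. Each coordinate of the solution
  -- is therefore a finite iterate, hence smooth in the parameters.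
  let P : ℕ → (J → ℝ) → I → ℝ := fun n r => (T r)^[n] (m₀ r)
  have hPs : ∀ n r, P (n + 1) r = T r (P n r) := fun n r => Function.iterate_succ_apply' _ _ _
  have hPU : ∀ n, ∀ r ∈ V, P n r ∈ U := by
    intro n r hr
    induction n with
    | zero => exact hm₀ r hr
    | succ n ih => rw [hPs]; exact hT r hr _ ih
  have hPsm : ∀ n, ∀ r ∈ V, ∀ c, SmoothAt (fun r => P n r c) r := by
    intro n r hr
    induction n with
    | zero => exact hm₀s r hr
    | succ n ih =>
      intro c
      simp only [hPs]
      exact hsm r hr _ ih (hPU n r hr) c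
  have hst : ∀ r ∈ V, ∀ n c, lev c < n → P n r c = P (n + 1) r c := by
    intro r hr n
    induction n with
    | zero => intro c hc; omega
    | succ n ih =>
      intro c hc
      rw [hPs n, hPs (n + 1)]
      exact hdep r hr c _ (hPU n r hr) _ (hPU _ r hr) fun c' hc' => ih c' (by omega)
  have hst' : ∀ r ∈ V, ∀ c n, lev c < n → P n r c = P (lev c + 1) r c := by
    intro r hr c n hn
    induction n, hn using Nat.le_induction with
    | base => rfl
    | succ n hn ih => rw [← hst r hr n c (by omega), ih]
  refine ⟨fun r c => P (lev c + 1) r c, fun r hr => ?_⟩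
  -- Membership in `U` is governed by the levels below `n₀`, where the limit agrees with the iterate
  -- number `n₀`.
  have hRU : (fun c => P (lev c + 1) r c) ∈ U :=
    hU _ (hPU n₀ r hr) _ fun c hc => hst' r hr c n₀ hc
  have hTR : T r (fun c => P (lev c + 1) r c) = fun c => P (lev c + 1) r c := by
    funext c
    rw [hPs]
    exact hdep r hr c _ hRU _ (hPU _ r hr) fun c' hc' => (hst' r hr c' _ hc').symm
  refine ⟨hRU, hTR, fun c => hPsm _ r hr c, fun p hp hTp => ?_⟩
  have : ∀ n c, lev c = n → p c = P (lev c + 1) r c := by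
    intro n
    induction n using Nat.strong_induction_on with
    | _ n ih =>
      intro c hc
      rw [← congrFun hTp c, ← congrFun hTR c]
      exact hdep r hr c _ hp _ hRU fun c' hc' => ih _ (hc ▸ hc') c' rfl
  exact funext fun c => this _ c rfl

end Levels

open JetCoord Dep

/-! ### Normal systems and the retraction onto the prolonged equation -/

section Jets

variable {A : Type*}

/-- The order of a jet coordinate. -/
def JetCoord.ord : JetCoord A → ℕ
  | x => 0
  | y => 0
  | jet _ i j => i + j

theorem smoothAt_jetX (c : JetCoord A) (q : JetCoord A → ℝ) : SmoothAt (jetX c) q := by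
  cases c
  · exact smoothAt_const 1 q
  · exact smoothAt_const 0 q
  · exact smoothAt_coord _ q

theorem smoothAt_jetY (c : JetCoord A) (q : JetCoord A → ℝ) : SmoothAt (jetY c) q := by
  cases c
  · exact smoothAt_const 0 q
  · exact smoothAt_const 1 q
  · exact smoothAt_coord _ q

theorem along_const {I : Type*} (X : I → (I → ℝ) → ℝ) (a : ℝ) :
    along X (fun _ => a) = fun _ => 0 :=
  funext fun _ => (HasDD.const a).eq

theorem jet_comm (c : JetCoord A) : along jetX (jetY c) = along jetY (jetX c) := by
  cases c with
  | x => exact (along_const _ 0).trans (along_const _ 1).symm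
  | y => exact (along_const _ 1).trans (along_const _ 0).symm
  | jet a i j => exact (along_coord jetX (jet a i (j + 1))).trans (along_coord jetY (jet a (i + 1) j)).symm

theorem depLT_jetX (U : Set (JetCoord A → ℝ)) (c : JetCoord A) (n : ℕ) (hc : c.ord < n) :
    DepLT U ord (n + 1) (jetX c) := by
  cases c with
  | x => exact fun _ _ _ _ _ => rfl
  | y => exact fun _ _ _ _ _ => rfl
  | jet a i j => exact fun p _ q _ h => h _ (by simp only [ord] at *; omega)

theorem depLT_jetY (U : Set (JetCoord A → ℝ)) (c : JetCoord A) (n : ℕ) (hc : c.ord < n) :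
    DepLT U ord (n + 1) (jetY c) := by
  cases c with
  | x => exact fun _ _ _ _ _ => rfl
  | y => exact fun _ _ _ _ _ => rfl
  | jet a i j => exact fun p _ q _ h => h _ (by simp only [ord] at *; omega)

/-- The differential consequences of a system. -/
def PDESystem.cons {K : Type*} (E : PDESystem A K) (a : K) (i j : ℕ) : (JetCoord A → ℝ) → ℝ :=
  (along jetX)^[i] ((along jetY)^[j] (E.F a))

/-- Each equation of the system expresses one derivative of its own dependent variable, of
multi-order `lead`, through coordinates of lower order. -/
structure IsNormal (E : PDESystem A A) (lead : A → ℕ × ℕ) : Prop where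
  isOpen_dom : IsOpen E.dom
  smooth : ∀ a, ∀ q ∈ E.dom, SmoothAt (E.F a) q
  lower : ∀ a, DepLT E.dom ord ((lead a).1 + (lead a).2)
    fun q => E.F a q - q (jet a (lead a).1 (lead a).2)
  dom_of_ord : ∀ q ∈ E.dom, ∀ q' : JetCoord A → ℝ, (∀ c, ord c < 1 → q c = q' c) → q' ∈ E.dom
  lead_pos : ∀ a, 0 < (lead a).1 + (lead a).2

namespace IsNormal

variable {E : PDESystem A A} {lead : A → ℕ × ℕ}

theorem smooth_cons (h : IsNormal E lead) (a : A) (i j : ℕ) :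
    ∀ q ∈ E.dom, SmoothAt (E.cons a i j) q :=
  smooth_iterate (fun c q _ => smoothAt_jetX c q)
    (smooth_iterate (fun c q _ => smoothAt_jetY c q) (h.smooth a) j) i

theorem along_jetX_cons (a : A) (i j : ℕ) :
    along jetX (E.cons a i j) = E.cons a (i + 1) j :=
  (Function.iterate_succ_apply' _ _ _).symm

theorem along_jetY_cons (h : IsNormal E lead) (a : A) (i j : ℕ) :
    ∀ q ∈ E.dom, along jetY (E.cons a i j) q = E.cons a i (j + 1) q := by
  intro q hq
  have hX := isTangent_of_isOpen h.isOpen_dom fun c q (_ : q ∈ E.dom) => smoothAt_jetX c q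
  have hY := isTangent_of_isOpen h.isOpen_dom fun c q (_ : q ∈ E.dom) => smoothAt_jetY c q
  have := hX.along_iterate_comm hY (fun c q _ => by rw [jet_comm])
    (smooth_iterate hY.smooth (h.smooth a) j) i q hq
  rw [PDESystem.cons, this, PDESystem.cons, Function.iterate_succ_apply']

/-- A total derivative raises the order of the remainder by at most one and takes the leading jet to
the next one, so the solved form survives in every differential consequence. -/
theorem lower_cons (h : IsNormal E lead) (a : A) (i j : ℕ) :
    DepLT E.dom ord (i + j + (lead a).1 + (lead a).2)
      fun q => E.cons a i j q - q (jet a (i + (lead a).1) (j + (lead a).2)) := by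
  have hs : ∀ i j, ∀ q ∈ E.dom, SmoothAt
      (fun q => E.cons a i j q - q (jet a (i + (lead a).1) (j + (lead a).2))) q :=
    fun i j q hq => (h.smooth_cons a i j q hq).sub (smoothAt_coord _ _)
  induction i with
  | zero =>
    induction j with
    | zero => simpa [PDESystem.cons] using h.lower a
    | succ j ih =>
      have h1 := ih.along h.isOpen_dom (hs 0 j) (X := jetY) fun c hc => depLT_jetY _ c _ hc
      have h2 : ∀ q ∈ E.dom, along jetY (fun q => E.cons a 0 j q
          - q (jet a (0 + (lead a).1) (j + (lead a).2))) q
          = E.cons a 0 (j + 1) q - q (jet a (0 + (lead a).1) (j + 1 + (lead a).2)) := by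
        intro q hq
        have := ((HasDD.of_smooth (h.smooth_cons a 0 j q hq) fun c => jetY c q).sub
          (.coord (jet a (0 + (lead a).1) (j + (lead a).2)))).eq
        refine this.trans ?_
        rw [← h.along_jetY_cons a 0 j q hq]
        simp only [jetY, along]
        rw [show j + (lead a).2 + 1 = j + 1 + (lead a).2 by omega]
      intro p hp q hq hpq
      have h3 := h1 p hp q hq fun c hc => hpq c (by omega)
      rwa [h2 p hp, h2 q hq] at h3
  | succ i ih =>
    have h1 := ih.along h.isOpen_dom (hs i j) (X := jetX) fun c hc => depLT_jetX _ c _ hc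
    have h2 : ∀ q ∈ E.dom, along jetX (fun q => E.cons a i j q
        - q (jet a (i + (lead a).1) (j + (lead a).2))) q
        = E.cons a (i + 1) j q - q (jet a (i + 1 + (lead a).1) (j + (lead a).2)) := by
      intro q hq
      have := ((HasDD.of_smooth (h.smooth_cons a i j q hq) fun c => jetX c q).sub
        (.coord (jet a (i + (lead a).1) (j + (lead a).2)))).eq
      refine this.trans ?_
      rw [← along_jetX_cons a i j]
      simp only [jetX, along]
      rw [show i + (lead a).1 + 1 = i + 1 + (lead a).1 by omega]
    intro p hp q hq hpq
    have h3 := h1 p hp q hq fun c hc => hpq c (by omega)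
    rwa [h2 p hp, h2 q hq] at h3

end IsNormal

/-- The coordinate `jet a i j`, expressed through coordinates of lower order by means of the
system. -/
def PDESystem.solved (E : PDESystem A A) (lead : A → ℕ × ℕ) (a : A) (i j : ℕ)
    (q : JetCoord A → ℝ) : ℝ :=
  q (jet a i j) - E.cons a (i - (lead a).1) (j - (lead a).2) q

namespace IsNormal

variable {E : PDESystem A A} {lead : A → ℕ × ℕ}

/-- The coordinate `jet a i j` cancels against the leading term of the consequence. The bounds `hi`,
`hj` make the truncated subtractions genuine. -/
theorem depLT_solved (h : IsNormal E lead) {a : A} {i j : ℕ} (hi : (lead a).1 ≤ i)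
    (hj : (lead a).2 ≤ j) : DepLT E.dom ord (i + j) (E.solved lead a i j) := by
  intro p hp q hq hpq
  have := h.lower_cons a (i - (lead a).1) (j - (lead a).2) p hp q hq
    fun c hc => hpq c (by omega)
  rw [Nat.sub_add_cancel hi, Nat.sub_add_cancel hj] at this
  simp only [PDESystem.solved]
  linarith

theorem smooth_solved (h : IsNormal E lead) (a : A) (i j : ℕ) :
    ∀ q ∈ E.dom, SmoothAt (E.solved lead a i j) q :=
  fun q hq => (smoothAt_coord _ _).sub (h.smooth_cons _ _ _ q hq)

/-- Indexing the consequences by their leading derivatives turns membership in the prolongation into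
a fixed-point condition. -/
theorem mem_inf_iff (lead : A → ℕ × ℕ) {q : JetCoord A → ℝ} : q ∈ E.inf ↔ q ∈ E.dom ∧
    ∀ a i j, (lead a).1 ≤ i → (lead a).2 ≤ j → E.solved lead a i j q = q (jet a i j) := by
  refine and_congr_right fun _ => ⟨fun h a i j _ _ => ?_, fun h a i j => ?_⟩
  · simp only [PDESystem.solved, sub_eq_self]
    exact h a _ _
  · have := h a (i + (lead a).1) (j + (lead a).2) (by omega) (by omega)
    simp only [PDESystem.solved, sub_eq_self, Nat.add_sub_cancel] at this
    exact this

/-- Points of an infinitely prolonged normal system are determined by parametric coordinates. -/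
theorem inf_ext (h : IsNormal E lead) {q r : JetCoord A → ℝ} (hq : q ∈ E.inf) (hr : r ∈ E.inf)
    (hx : q x = r x) (hy : q y = r y)
    (hqr : ∀ a i j, ¬ ((lead a).1 ≤ i ∧ (lead a).2 ≤ j) → q (jet a i j) = r (jet a i j)) :
    q = r := by
  have : ∀ n c, ord c = n → q c = r c := by
    intro n
    induction n using Nat.strong_induction_on with
    | _ n ih =>
      intro c hc
      cases c with
      | x => exact hx
      | y => exact hy
      | jet a i j =>
        by_cases hl : (lead a).1 ≤ i ∧ (lead a).2 ≤ j
        · rw [← ((mem_inf_iff lead).1 hq).2 a i j hl.1 hl.2, ← ((mem_inf_iff lead).1 hr).2 a i j hl.1 hl.2]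
          exact h.depLT_solved hl.1 hl.2 q hq.1 r hr.1 fun c' hc' => ih _ (hc ▸ hc') c' rfl
        · exact hqr a i j hl
  exact funext fun c => this _ c rfl

/-- The domain of a normal system retracts smoothly onto the infinite prolongation, and the
differential of the retraction fixes the vectors that are annihilated by the differentials of
all consequences of the system. -/
theorem exists_retraction (h : IsNormal E lead) :
    ∃ R : (JetCoord A → ℝ) → JetCoord A → ℝ,
      (∀ q ∈ E.dom, R q ∈ E.inf ∧ ∀ c, SmoothAt (fun q => R q c) q) ∧
      (∀ q ∈ E.inf, R q = q) ∧
      ∀ q ∈ E.inf, ∀ ξ : JetCoord A → ℝ, (∀ a i j, dirDeriv ξ (E.cons a i j) q = 0) →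
        ∀ c, dirDeriv ξ (fun q => R q c) q = ξ c := by
  classical
  -- Parametric coordinates are copied from `r`, and principal ones are recomputed from lower-order
  -- coordinates of `p`. The fixed point is the point of the prolongation with the parametric
  -- coordinates of `r`. Each unknown has just one equation, so no compatibility conditions arise.
  let T : (JetCoord A → ℝ) → (JetCoord A → ℝ) → JetCoord A → ℝ := fun r p c =>
    match c with
    | x => r x
    | y => r y
    | jet a i j => if (lead a).1 ≤ i ∧ (lead a).2 ≤ j then E.solved lead a i j p else r (jet a i j)
  obtain ⟨R, hR⟩ := exists_fixedPoint (U := E.dom) (lev := ord) (V := E.dom) 1 T h.dom_of_ord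
    (by
      intro r hr p hp
      refine h.dom_of_ord r hr _ fun c hc => ?_
      cases c with
      | x => rfl
      | y => rfl
      | jet a i j =>
        -- Coordinates of order zero are never principal, so `T r p` stays in the domain.
        have := h.lead_pos a
        have hc' : i + j < 1 := hc
        have : ¬ ((lead a).1 ≤ i ∧ (lead a).2 ≤ j) := by omega
        simp only [T, this, if_false])
    (by
      intro r hr c
      cases c with
      | x => exact fun _ _ _ _ _ => rfl
      | y => exact fun _ _ _ _ _ => rfl
      | jet a i j =>
        by_cases hl : (lead a).1 ≤ i ∧ (lead a).2 ≤ j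
        · simp only [T, hl, and_self, if_true]
          exact h.depLT_solved hl.1 hl.2
        · simp only [T, hl, if_false]
          exact fun _ _ _ _ _ => rfl)
    (by
      intro r hr m hm hmU c
      cases c with
      | x => exact smoothAt_coord _ _
      | y => exact smoothAt_coord _ _
      | jet a i j =>
        by_cases hl : (lead a).1 ≤ i ∧ (lead a).2 ≤ j
        · simp only [T, hl, and_self, if_true]
          exact (h.smooth_solved a i j _ hmU).comp hm
        · simp only [T, hl, if_false]
          exact smoothAt_coord _ _)
    (fun r => r) (fun r hr => hr) (fun r hr c => smoothAt_coord c r)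
  have hfix : ∀ q ∈ E.inf, R q = q := by
    intro q hq
    refine ((hR q hq.1).2.2.2 q hq.1 ?_).symm
    funext c
    cases c with
    | x => rfl
    | y => rfl
    | jet a i j =>
      by_cases hl : (lead a).1 ≤ i ∧ (lead a).2 ≤ j
      · simp only [T, hl, and_self, if_true]
        exact ((mem_inf_iff lead).1 hq).2 a i j hl.1 hl.2
      · simp only [T, hl, if_false]
  have hT : ∀ q ∈ E.dom, ∀ c, R q c = T q (R q) c := fun q hq c =>
    (congrFun (hR q hq).2.1 c).symm
  refine ⟨R, fun q hq => ⟨(mem_inf_iff lead).2 ⟨(hR q hq).1, fun a i j hi hj => ?_⟩, (hR q hq).2.2.1⟩,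
    hfix, fun q hq ξ hξ => ?_⟩
  · rw [hT q hq]
    simp only [T, hi, hj, and_self, if_true]
  -- Differentiating the fixed-point equation determines the principal components of the image of
  -- `ξ` from the lower ones, by the same linearized consequences that `ξ` satisfies; hence
  -- induction on the order.
  · have : ∀ n c, ord c = n → dirDeriv ξ (fun q => R q c) q = ξ c := by
      intro n
      induction n using Nat.strong_induction_on with
      | _ n ih =>
        intro c hc
        have hev : ∀ᶠ q' in 𝓝 q, R q' c = T q' (R q') c :=
          Filter.eventually_of_mem (h.isOpen_dom.mem_nhds hq.1) fun q' hq' => hT q' hq' c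
        cases c with
        | x => exact ((HasDD.coord x).congr hev).eq
        | y => exact ((HasDD.coord y).congr hev).eq
        | jet a i j =>
          by_cases hl : (lead a).1 ≤ i ∧ (lead a).2 ≤ j
          · simp only [T, hl, and_self, if_true] at hev
            have hsol := h.smooth_solved a i j q hq.1
            have hRs := (hR q hq.1).2.2.1
            have hsol' : SmoothAt (E.solved lead a i j) (R q) := by rwa [hfix q hq]
            rw [dirDeriv_congr_of_eventuallyEq (hsol'.comp hRs) hev, hsol'.dirDeriv_comp hRs,
              hfix q hq]
            rw [(h.depLT_solved hl.1 hl.2).dirDeriv_congr h.isOpen_dom (h.smooth_solved a i j)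
              hq.1 hq.1 (fun _ _ => rfl) (ζ := ξ) fun c' hc' => ih _ (hc ▸ hc') c' rfl]
            have := ((HasDD.coord (ξ := ξ) (jet a i j)).sub
              (.of_smooth (h.smooth_cons a (i - (lead a).1) (j - (lead a).2) q hq.1) ξ)).eq
            rw [hξ, sub_zero] at this
            exact this
          · simp only [T, hl, if_false] at hev
            exact ((HasDD.coord (jet a i j)).congr hev).eq
    exact fun c => this _ c rfl

end IsNormal

end Jets

/-! ### Coverings and tangency of the lifted total derivatives -/

section Coverings

variable {A A' K W W' : Type*}

namespace Cov

/-- The coefficients of the lifted total derivative in `x`. -/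
def fieldX {E : PDESystem A K} (C : Cov E W) : JetCoord A ⊕ W → (JetCoord A ⊕ W → ℝ) → ℝ :=
  Sum.elim (fun c p => jetX c (p ∘ Sum.inl)) C.X

/-- The coefficients of the lifted total derivative in `y`. -/
def fieldY {E : PDESystem A K} (C : Cov E W) : JetCoord A ⊕ W → (JetCoord A ⊕ W → ℝ) → ℝ :=
  Sum.elim (fun c p => jetY c (p ∘ Sum.inl)) C.Y

theorem Dx_eq {E : PDESystem A K} (C : Cov E W) : C.Dx = along C.fieldX := rfl

theorem Dy_eq {E : PDESystem A K} (C : Cov E W) : C.Dy = along C.fieldY := rfl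

theorem smoothAt_comp_inl {f : (JetCoord A → ℝ) → ℝ} {p : JetCoord A ⊕ W → ℝ}
    (h : SmoothAt f (p ∘ Sum.inl)) : SmoothAt (fun p : JetCoord A ⊕ W → ℝ => f (p ∘ Sum.inl)) p :=
  SmoothAt.comp (m := fun p : JetCoord A ⊕ W → ℝ => p ∘ Sum.inl) h
    fun c => smoothAt_coord (Sum.inl c) p

theorem dirDeriv_comp_inl {f : (JetCoord A → ℝ) → ℝ} {p : JetCoord A ⊕ W → ℝ}
    (h : SmoothAt f (p ∘ Sum.inl)) (ξ : JetCoord A ⊕ W → ℝ) :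
    dirDeriv ξ (fun p : JetCoord A ⊕ W → ℝ => f (p ∘ Sum.inl)) p
      = dirDeriv (ξ ∘ Sum.inl) f (p ∘ Sum.inl) := by
  refine (SmoothAt.dirDeriv_comp (m := fun p : JetCoord A ⊕ W → ℝ => p ∘ Sum.inl) h
    (fun c => smoothAt_coord (Sum.inl c) p) ξ).trans ?_
  congr 1
  funext c
  exact (HasDD.coord (Sum.inl c)).eq

theorem smooth_fieldX {E : PDESystem A K} {C : Cov E W}
    (hX : ∀ w, ∀ p ∈ C.pts, SmoothAt (C.X w) p) :
    ∀ c, ∀ p ∈ C.pts, SmoothAt (C.fieldX c) p := by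
  rintro (c | w) p hp
  · exact smoothAt_comp_inl (smoothAt_jetX c _)
  · exact hX w p hp

theorem smooth_fieldY {E : PDESystem A K} {C : Cov E W}
    (hY : ∀ w, ∀ p ∈ C.pts, SmoothAt (C.Y w) p) :
    ∀ c, ∀ p ∈ C.pts, SmoothAt (C.fieldY c) p := by
  rintro (c | w) p hp
  · exact smoothAt_comp_inl (smoothAt_jetY c _)
  · exact hY w p hp

theorem IsCovering.comm_fields {E : PDESystem A K} {C : Cov E W} (h : C.IsCovering) :
    ∀ c, ∀ p ∈ C.pts, along C.fieldX (C.fieldY c) p = along C.fieldY (C.fieldX c) p := by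
  rintro (c | w) p hp
  · refine (dirDeriv_comp_inl (smoothAt_jetY c _) _).trans
      (Eq.trans ?_ (dirDeriv_comp_inl (smoothAt_jetX c _) _).symm)
    exact congrFun (jet_comm c) (p ∘ Sum.inl)
  · exact h.comm w p hp

end Cov

namespace IsNormal

variable {E : PDESystem A A} {lead : A → ℕ × ℕ}

/-- Composing `f` with the retraction of the jets, the fibre coordinates being kept, gives a
function that vanishes on a whole neighbourhood of `p`. The differential of this retraction fixes
`ξ`, so `f` itself has derivative zero along `ξ`. -/
theorem dirDeriv_eq_zero (hE : IsNormal E lead) (C : Cov E W) (hC : IsOpen C.dom)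
    {f : (JetCoord A ⊕ W → ℝ) → ℝ} (hf : ∀ p ∈ C.pts, SmoothAt f p) (h0 : ∀ p ∈ C.pts, f p = 0)
    {p : JetCoord A ⊕ W → ℝ} (hp : p ∈ C.pts) (ξ : JetCoord A ⊕ W → ℝ)
    (hξ : ∀ a i j, dirDeriv (ξ ∘ Sum.inl) (E.cons a i j) (p ∘ Sum.inl) = 0) :
    dirDeriv ξ f p = 0 := by
  obtain ⟨R, hR, hfix, htan⟩ := hE.exists_retraction
  let m : (JetCoord A ⊕ W → ℝ) → JetCoord A ⊕ W → ℝ := fun q =>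
    Sum.elim (R (q ∘ Sum.inl)) (q ∘ Sum.inr)
  have hmp : m p = p := by
    funext c
    rcases c with c | w
    · exact congrFun (hfix _ hp.1) c
    · rfl
  have hm : ∀ c, SmoothAt (fun q => m q c) p := by
    rintro (c | w)
    · exact Cov.smoothAt_comp_inl ((hR _ hp.1.1).2 c)
    · exact smoothAt_coord _ _
  have hmc : ContinuousAt m p := continuousAt_pi.2 fun c => (hm c).continuousAt
  have hcl : Continuous fun q : JetCoord A ⊕ W → ℝ => q ∘ Sum.inl :=
    continuous_pi fun c => continuous_apply _
  have hev : ∀ᶠ q in 𝓝 p, f (m q) = 0 := by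
    filter_upwards [hmc.eventually (hC.mem_nhds (hmp.symm ▸ hp.2)),
      hcl.continuousAt.eventually (hE.isOpen_dom.mem_nhds hp.1.1)] with q h1 h2
    exact h0 _ ⟨(hR _ h2).1, h1⟩
  have h1 := ((HasDD.const (ξ := ξ) (p := p) (0 : ℝ)).congr hev).eq
  rw [SmoothAt.dirDeriv_comp (hmp.symm ▸ hf p hp) hm, hmp] at h1
  rw [← h1]
  congr 1
  funext c
  rcases c with c | w
  · refine Eq.trans ?_ (Cov.dirDeriv_comp_inl ((hR _ hp.1.1).2 c) ξ).symm
    exact (htan _ hp.1 _ hξ c).symm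
  · exact (HasDD.coord (Sum.inr w)).eq.symm

/-- The total derivative of a differential consequence is another consequence, so it vanishes on the
prolongation, as `dirDeriv_eq_zero` requires. -/
theorem isTangent_fieldX (hE : IsNormal E lead) (C : Cov E W) (hC : IsOpen C.dom)
    (hX : ∀ w, ∀ p ∈ C.pts, SmoothAt (C.X w) p) : IsTangent C.pts C.fieldX where
  smooth := Cov.smooth_fieldX hX
  zero _ hf h0 p hp := hE.dirDeriv_eq_zero C hC hf h0 hp _ fun a i j =>
    (congrFun (along_jetX_cons (E := E) a i j) (p ∘ Sum.inl)).trans (hp.1.2 a (i + 1) j)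

theorem isTangent_fieldY (hE : IsNormal E lead) (C : Cov E W) (hC : IsOpen C.dom)
    (hY : ∀ w, ∀ p ∈ C.pts, SmoothAt (C.Y w) p) : IsTangent C.pts C.fieldY where
  smooth := Cov.smooth_fieldY hY
  zero _ hf h0 _ hp := hE.dirDeriv_eq_zero C hC hf h0 hp _ fun a i j =>
    (hE.along_jetY_cons a i j _ hp.1.1).trans (hp.1.2 a i (j + 1))

end IsNormal

/-! ### The tangent system -/

theorem smoothAt_jetBase (c : JetCoord A) (q : JetCoord (A ⊕ A) → ℝ) :
    SmoothAt (fun q => jetBase q c) q :=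
  smoothAt_coord _ _

theorem smoothAt_jetFibre (c : JetCoord A) (q : JetCoord (A ⊕ A) → ℝ) :
    SmoothAt (fun q => jetFibre q c) q := by
  cases c
  · exact smoothAt_const 0 q
  · exact smoothAt_const 0 q
  · exact smoothAt_coord _ q

theorem ord_map {B : Type*} (f : A → B) (c : JetCoord A) : (c.map f).ord = c.ord := by
  cases c <;> rfl

namespace IsNormal

variable {E : PDESystem A A} {lead : A → ℕ × ℕ}

/-- Linearizing a solved equation leaves the same derivative of the variation as leading term. The
remainder is the derivative of a lower-order function, hence involves only lower-order jets and
their variations. -/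
theorem tangent (h : IsNormal E lead) : IsNormal E.tangent (Sum.elim lead lead) where
  isOpen_dom := h.isOpen_dom.preimage (continuous_pi fun c => continuous_apply (c.map Sum.inl))
  smooth := by
    rintro (a | a) q hq
    · exact SmoothAt.comp (f := E.F a) (m := jetBase) (h.smooth a _ hq) fun c => smoothAt_jetBase c q
    · exact SmoothAt.dirDeriv (h.smooth a _ hq) (fun c => smoothAt_jetBase c q)
        fun c => smoothAt_jetFibre c q
  lower := by
    rintro (a | a) p hp q hq hpq
    · exact h.lower a _ hp _ hq fun c hc => hpq _ (by rwa [ord_map])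
    · have hb : ∀ c : JetCoord A, c.ord < (lead a).1 + (lead a).2 → jetBase p c = jetBase q c :=
        fun c hc => hpq _ (by rwa [ord_map])
      have hf : ∀ c : JetCoord A, c.ord < (lead a).1 + (lead a).2 →
          jetFibre p c = jetFibre q c := by
        intro c hc
        cases c with
        | x => rfl
        | y => rfl
        | jet b i j => exact hpq (jet (Sum.inr b) i j) hc
      have h1 := (h.lower a).dirDeriv_congr h.isOpen_dom
        (fun q hq => (h.smooth a q hq).sub (smoothAt_coord _ _)) hp hq hb hf
      have h2 : ∀ q : JetCoord (A ⊕ A) → ℝ, q ∈ E.tangent.dom →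
          dirDeriv (jetFibre q) (fun q => E.F a q - q (jet a (lead a).1 (lead a).2)) (jetBase q)
            = dirDeriv (jetFibre q) (E.F a) (jetBase q)
              - q (jet (Sum.inr a) (lead a).1 (lead a).2) := fun q hq =>
        ((HasDD.of_smooth (h.smooth a _ hq) _).sub (.coord _)).eq
      rw [h2 p hp, h2 q hq] at h1
      exact h1
  dom_of_ord q hq q' hqq' := h.dom_of_ord _ hq _ fun c hc => hqq' _ (by rwa [ord_map])
  lead_pos := by rintro (a | a) <;> exact h.lead_pos a

theorem cons_tangent_inl (h : IsNormal E lead) (a : A) (i j : ℕ) :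
    ∀ q ∈ E.tangent.dom, E.tangent.cons (Sum.inl a) i j q = E.cons a i j (jetBase q) := by
  have hX := isTangent_of_isOpen h.tangent.isOpen_dom
    fun c q (_ : q ∈ E.tangent.dom) => smoothAt_jetX c q
  have hY := isTangent_of_isOpen h.tangent.isOpen_dom
    fun c q (_ : q ∈ E.tangent.dom) => smoothAt_jetY c q
  have hs := smooth_iterate (fun c q (_ : q ∈ E.dom) => smoothAt_jetY c q) (h.smooth a) j
  have hs' := smooth_iterate hY.smooth (h.tangent.smooth (Sum.inl a)) j
  refine hX.iterate_comp (S' := E.dom) (X' := jetX) (m := jetBase)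
    (fun c q _ => smoothAt_jetX c q) (fun q hq => hq) (fun c q _ => smoothAt_jetBase c q) ?_
    hs hs' (hY.iterate_comp (S' := E.dom) (m := jetBase) (fun c q _ => smoothAt_jetY c q)
      (fun q hq => hq)
      (fun c q _ => smoothAt_jetBase c q) ?_ (h.smooth a) (h.tangent.smooth (Sum.inl a))
      (fun _ _ => rfl) j) i
  all_goals
    intro c q _
    refine (HasDD.coord (c.map Sum.inl)).eq.trans ?_
    cases c <;> rfl

theorem jetBase_mem_inf (h : IsNormal E lead) {q : JetCoord (A ⊕ A) → ℝ} (hq : q ∈ E.tangent.inf) :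
    jetBase q ∈ E.inf :=
  ⟨hq.1, fun a i j => (h.cons_tangent_inl a i j q hq.1).symm.trans (hq.2 (Sum.inl a) i j)⟩

end IsNormal

/-! ### Prolongations -/

namespace Cov

theorem iterate_coord {E : PDESystem A K} (C : Cov E W) (a : A) (i j : ℕ) :
    C.Dx^[i] (C.Dy^[j] fun p => p (Sum.inl (jet a 0 0))) = fun p => p (Sum.inl (jet a i j)) := by
  have h : C.Dy^[j] (fun p => p (Sum.inl (jet a 0 0))) = fun p => p (Sum.inl (jet a 0 j)) := by
    induction j with
    | zero => rfl
    | succ j ih => rw [Function.iterate_succ_apply', ih]; exact along_coord C.fieldY _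
  rw [h]
  induction i with
  | zero => rfl
  | succ i ih => rw [Function.iterate_succ_apply', ih]; exact along_coord C.fieldX _

theorem prol_depVar {E : PDESystem A K} (C : Cov E W) (p : JetCoord A ⊕ W → ℝ) :
    C.prol depVar p = p ∘ Sum.inl := by
  funext c
  cases c with
  | x => rfl
  | y => rfl
  | jet a i j => exact congrFun (C.iterate_coord a i j) p

variable {E : PDESystem A A} {lead : A → ℕ × ℕ}

/-- Through `prol φ` the lifted total derivatives are related to those of the target, so a
consequence of `E'` pulls back to an iterated derivative of the pulled-back equation. The latter
vanishes on the covering space, and tangency carries this to its derivatives. Thus only the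
equations themselves have to be checked. -/
theorem IsCovering.isMorphism {C : Cov E W} (hC : C.IsCovering) (hE : IsNormal E lead)
    {E' : PDESystem A' A'} {lead' : A' → ℕ × ℕ} (hE' : IsNormal E' lead')
    {φ : A' → (JetCoord A ⊕ W → ℝ) → ℝ} (hφ : ∀ a, ∀ p ∈ C.pts, SmoothAt (φ a) p)
    (hdom : ∀ p ∈ C.pts, C.prol φ p ∈ E'.dom)
    (hF : ∀ a, ∀ p ∈ C.pts, E'.F a (C.prol φ p) = 0) : C.IsMorphism E' φ := by
  have hX := hE.isTangent_fieldX C hC.isOpen_dom hC.smooth_X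
  have hY := hE.isTangent_fieldY C hC.isOpen_dom hC.smooth_Y
  have hs : ∀ a j, ∀ p ∈ C.pts, SmoothAt (C.Dy^[j] (φ a)) p := fun a j =>
    smooth_iterate hY.smooth (hφ a) j
  have hps : ∀ c, ∀ p ∈ C.pts, SmoothAt (fun q => C.prol φ q c) p := by
    intro c p hp
    cases c with
    | x => exact smoothAt_coord _ _
    | y => exact smoothAt_coord _ _
    | jet a i j => exact smooth_iterate hX.smooth (hs a j) i p hp
  have hXp : ∀ c, ∀ p ∈ C.pts, C.Dx (fun q => C.prol φ q c) p = jetX c (C.prol φ p) := by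
    intro c p hp
    cases c with
    | x => exact congrFun (along_coord C.fieldX (Sum.inl x)) p
    | y => exact congrFun (along_coord C.fieldX (Sum.inl y)) p
    | jet a i j =>
      exact congrFun (Function.iterate_succ_apply' C.Dx i (C.Dy^[j] (φ a))).symm p
  have hYp : ∀ c, ∀ p ∈ C.pts, C.Dy (fun q => C.prol φ q c) p = jetY c (C.prol φ p) := by
    intro c p hp
    cases c with
    | x => exact congrFun (along_coord C.fieldY (Sum.inl x)) p
    | y => exact congrFun (along_coord C.fieldY (Sum.inl y)) p
    | jet a i j =>
      -- In `prol` the derivatives in `x` stand outside, so the new derivative in `y` must be moved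
      -- past them; this is where compatibility of the covering is needed.
      refine (hX.along_iterate_comm hY hC.comm_fields (hs a j) i p hp).trans ?_
      rw [← Dy_eq, ← Function.iterate_succ_apply' C.Dy j (φ a)]
      rfl
  refine ⟨hφ, fun p hp => ⟨hdom p hp, fun a i j => ?_⟩, hXp, hYp⟩
  have hFs : ∀ p ∈ C.pts, SmoothAt (fun q => E'.F a (C.prol φ q)) p := fun p hp =>
    (hE'.smooth a _ (hdom p hp)).comp fun c => hps c p hp
  rw [← hX.iterate_comp (S' := E'.dom) (fun c q _ => smoothAt_jetX c q) hdom hps hXp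
    (smooth_iterate (fun c q (_ : q ∈ E'.dom) => smoothAt_jetY c q) (hE'.smooth a) j)
    (smooth_iterate hY.smooth hFs j)
    (hY.iterate_comp (fun c q _ => smoothAt_jetY c q) hdom hps hYp (hE'.smooth a) hFs
      (fun _ _ => rfl) j) i p hp]
  exact hX.iterate_zero (smooth_iterate hY.smooth hFs j) (hY.iterate_zero hFs (hF a) j) i p hp

theorem IsCovering.isCoveringOver_depVar {C : Cov E W} (hC : C.IsCovering)
    (hE : IsNormal E lead) (hdom : C.dom = Set.univ) : C.IsCoveringOver E depVar W := by
  refine ⟨hC.isMorphism hE hE (fun a p _ => smoothAt_coord _ _)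
    (fun p hp => by rw [prol_depVar]; exact hp.1.1)
    (fun a p hp => by rw [prol_depVar]; exact hp.1.2 a 0 0), fun n p => p (Sum.inr n),
    fun c r => r c, fun n p _ => smoothAt_coord _ _, fun c r _ => smoothAt_coord _ _, ?_, ?_⟩
  · intro p _
    funext c
    rw [prol_depVar]
    cases c <;> rfl
  · intro r hr
    refine ⟨⟨hr, by rw [hdom]; trivial⟩, ?_⟩
    funext c
    rw [prol_depVar]
    cases c <;> rfl

end Cov

end Coverings

theorem eventually_contDiffAt {J : Set ℝ} (hJ : IsOpen J) {η : ℝ → ℝ} (hη : ContDiffOn ℝ ∞ η J)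
    {t : ℝ} (ht : t ∈ J) : ∀ᶠ z in 𝓝 t, ContDiffAt ℝ ∞ η z := by
  filter_upwards [hJ.mem_nhds ht] with z hz using hη.contDiffAt (hJ.mem_nhds hz)

theorem contDiffOn_deriv {J : Set ℝ} (hJ : IsOpen J) {η : ℝ → ℝ} (hη : ContDiffOn ℝ ∞ η J) :
    ContDiffOn ℝ ∞ (deriv η) J :=
  hη.deriv_of_isOpen hJ (by simp)

/-! ### The system for `u`, `v` and its linearization -/

section System

variable {J₁ J₂ : Set ℝ} (hJ₁ : IsOpen J₁) (hJ₂ : IsOpen J₂) {η₁ η₂ : ℝ → ℝ}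
  (hη₁ : ContDiffOn ℝ ∞ η₁ J₁) (hη₂ : ContDiffOn ℝ ∞ η₂ J₂)

include hJ₁ hJ₂ hη₁ hη₂

theorem hasDD_F_u {q : JetCoord Dep → ℝ} (hq : q ∈ (sysEta J₁ J₂ η₁ η₂).dom) (Φ : Dep → ℕ → ℕ → ℝ) :
    HasDD (jetVert Φ) q ((sysEta J₁ J₂ η₁ η₂).F u)
      (Φ u 0 2 - ((1 / 2 * deriv η₁ (q x) * (2 * q (jet v 0 0) * Φ v 0 0 * q (jet v 1 0)
          + q (jet v 0 0) ^ 2 * Φ v 1 0)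
        + 1 / 2 * deriv η₂ (q y) * (Φ u 0 0 * q (jet v 0 0) * q (jet u 0 1)
          + q (jet u 0 0) * Φ v 0 0 * q (jet u 0 1) + q (jet u 0 0) * q (jet v 0 0) * Φ u 0 1)
        + (η₁ (q x) - η₂ (q y)) * (Φ u 0 0 * q (jet u 0 1) * q (jet v 0 1)
          + q (jet u 0 0) * Φ u 0 1 * q (jet v 0 1) + q (jet u 0 0) * q (jet u 0 1) * Φ v 0 1)
        + 2 * q (jet u 0 0) * Φ u 0 0 * q (jet v 0 0) ^ 3
        + 3 * q (jet u 0 0) ^ 2 * q (jet v 0 0) ^ 2 * Φ v 0 0)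
          * (q (jet u 0 0) * q (jet v 0 0) * (η₁ (q x) - η₂ (q y)))
        - (1 / 2 * deriv η₁ (q x) * q (jet v 0 0) ^ 2 * q (jet v 1 0)
          + 1 / 2 * deriv η₂ (q y) * q (jet u 0 0) * q (jet v 0 0) * q (jet u 0 1)
          + (η₁ (q x) - η₂ (q y)) * q (jet u 0 0) * q (jet u 0 1) * q (jet v 0 1)
          + q (jet u 0 0) ^ 2 * q (jet v 0 0) ^ 3)
          * ((Φ u 0 0 * q (jet v 0 0) + q (jet u 0 0) * Φ v 0 0) * (η₁ (q x) - η₂ (q y))))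
        / (q (jet u 0 0) * q (jet v 0 0) * (η₁ (q x) - η₂ (q y))) ^ 2) := by
  obtain ⟨h1, h2, h3, h4, h5⟩ := hq
  have c : ∀ c, HasDD (jetVert Φ) q (fun q => q c) (jetVert Φ c) := fun c => .coord c
  have e₁ := (c x).scalar (h := η₁) (eventually_contDiffAt hJ₁ hη₁ h1)
  have e₂ := (c y).scalar (h := η₂) (eventually_contDiffAt hJ₂ hη₂ h2)
  have e₁' := (c x).scalar (h := deriv η₁) (eventually_contDiffAt hJ₁ (contDiffOn_deriv hJ₁ hη₁) h1)
  have e₂' := (c y).scalar (h := deriv η₂) (eventually_contDiffAt hJ₂ (contDiffOn_deriv hJ₂ hη₂) h2)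
  have h0 : q (jet u 0 0) * q (jet v 0 0) * (η₁ (q x) - η₂ (q y)) ≠ 0 :=
    mul_ne_zero (mul_ne_zero h4 h5) (sub_ne_zero.2 h3)
  have cu := c (jet u 0 0)
  have cv := c (jet v 0 0)
  have cuy := c (jet u 0 1)
  have cvx := c (jet v 1 0)
  have cvy := c (jet v 0 1)
  have hh : HasDD (jetVert Φ) q (fun _ => (1 / 2 : ℝ)) 0 := .const _
  have v2 := cv.mul cv
  have v3 := v2.mul cv
  have u2 := cu.mul cu
  have key := (c (jet u 0 2)).sub
    ((((((hh.mul e₁').mul v2).mul cvx).add ((((hh.mul e₂').mul cu).mul cv).mul cuy)).add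
      ((((e₁.sub e₂).mul cu).mul cuy).mul cvy) |>.add (u2.mul v3)).div
      ((cu.mul cv).mul (e₁.sub e₂)) h0)
  refine (key.congr (.of_forall fun q => ?_)).congr_val ?_
  · simp only [sysEta]
    ring
  · simp only [jetVert]
    ring

theorem hasDD_F_v {q : JetCoord Dep → ℝ} (hq : q ∈ (sysEta J₁ J₂ η₁ η₂).dom) (Φ : Dep → ℕ → ℕ → ℝ) :
    HasDD (jetVert Φ) q ((sysEta J₁ J₂ η₁ η₂).F v)
      (Φ v 2 0 - ((1 / 2 * deriv η₁ (q x) * (Φ u 0 0 * q (jet v 0 0) * q (jet v 1 0)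
          + q (jet u 0 0) * Φ v 0 0 * q (jet v 1 0) + q (jet u 0 0) * q (jet v 0 0) * Φ v 1 0)
        + 1 / 2 * deriv η₂ (q y) * (2 * q (jet u 0 0) * Φ u 0 0 * q (jet u 0 1)
          + q (jet u 0 0) ^ 2 * Φ u 0 1)
        + (η₂ (q y) - η₁ (q x)) * (Φ v 0 0 * q (jet v 1 0) * q (jet u 1 0)
          + q (jet v 0 0) * Φ v 1 0 * q (jet u 1 0) + q (jet v 0 0) * q (jet v 1 0) * Φ u 1 0)
        + 3 * q (jet u 0 0) ^ 2 * Φ u 0 0 * q (jet v 0 0) ^ 2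
        + 2 * q (jet u 0 0) ^ 3 * q (jet v 0 0) * Φ v 0 0)
          * (q (jet u 0 0) * q (jet v 0 0) * (η₂ (q y) - η₁ (q x)))
        - (1 / 2 * deriv η₁ (q x) * q (jet u 0 0) * q (jet v 0 0) * q (jet v 1 0)
          + 1 / 2 * deriv η₂ (q y) * q (jet u 0 0) ^ 2 * q (jet u 0 1)
          + (η₂ (q y) - η₁ (q x)) * q (jet v 0 0) * q (jet v 1 0) * q (jet u 1 0)
          + q (jet u 0 0) ^ 3 * q (jet v 0 0) ^ 2)
          * ((Φ u 0 0 * q (jet v 0 0) + q (jet u 0 0) * Φ v 0 0) * (η₂ (q y) - η₁ (q x))))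
        / (q (jet u 0 0) * q (jet v 0 0) * (η₂ (q y) - η₁ (q x))) ^ 2) := by
  obtain ⟨h1, h2, h3, h4, h5⟩ := hq
  have c : ∀ c, HasDD (jetVert Φ) q (fun q => q c) (jetVert Φ c) := fun c => .coord c
  have e₁ := (c x).scalar (h := η₁) (eventually_contDiffAt hJ₁ hη₁ h1)
  have e₂ := (c y).scalar (h := η₂) (eventually_contDiffAt hJ₂ hη₂ h2)
  have e₁' := (c x).scalar (h := deriv η₁) (eventually_contDiffAt hJ₁ (contDiffOn_deriv hJ₁ hη₁) h1)
  have e₂' := (c y).scalar (h := deriv η₂) (eventually_contDiffAt hJ₂ (contDiffOn_deriv hJ₂ hη₂) h2)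
  have h0 : q (jet u 0 0) * q (jet v 0 0) * (η₂ (q y) - η₁ (q x)) ≠ 0 :=
    mul_ne_zero (mul_ne_zero h4 h5) (sub_ne_zero.2 h3.symm)
  have cu := c (jet u 0 0)
  have cv := c (jet v 0 0)
  have cuy := c (jet u 0 1)
  have cvx := c (jet v 1 0)
  have cux := c (jet u 1 0)
  have hh : HasDD (jetVert Φ) q (fun _ => (1 / 2 : ℝ)) 0 := .const _
  have v2 := cv.mul cv
  have u2 := cu.mul cu
  have u3 := u2.mul cu
  have key := (c (jet v 2 0)).sub
    (((((((hh.mul e₁').mul cu).mul cv).mul cvx).add (((hh.mul e₂').mul u2).mul cuy)).add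
      ((((e₂.sub e₁).mul cv).mul cvx).mul cux) |>.add (u3.mul v2)).div
      ((cu.mul cv).mul (e₂.sub e₁)) h0)
  refine (key.congr (.of_forall fun q => ?_)).congr_val ?_
  · simp only [sysEta]
    ring
  · simp only [jetVert]
    ring

/-- The linearization of the first equation, in terms of the variations `α`, `β` of `u_y / v` and
`-v_x / u`. -/
theorem lin_F_u {q : JetCoord Dep → ℝ} (hq : q ∈ (sysEta J₁ J₂ η₁ η₂).inf) (Φ : Dep → ℕ → ℕ → ℝ)
    {α αy β : ℝ}
    (hα : Φ u 0 1 = q (jet u 0 1) / q (jet v 0 0) * Φ v 0 0 + q (jet v 0 0) * α)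
    (hβ : Φ v 1 0 = q (jet v 1 0) / q (jet u 0 0) * Φ u 0 0 - q (jet u 0 0) * β)
    (hαy : Φ u 0 2 = (q (jet u 0 2) * q (jet v 0 0) - q (jet u 0 1) * q (jet v 0 1))
        / q (jet v 0 0) ^ 2 * Φ v 0 0 + q (jet u 0 1) / q (jet v 0 0) * Φ v 0 1
        + q (jet v 0 1) * α + q (jet v 0 0) * αy) :
    dirDeriv (jetVert Φ) ((sysEta J₁ J₂ η₁ η₂).F u) q = 0 ↔
      (η₂ (q y) - η₁ (q x)) * αy = 1 / 2 * deriv η₁ (q x) * β - 1 / 2 * deriv η₂ (q y) * α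
        - q (jet u 0 0) * Φ v 0 0 - q (jet v 0 0) * Φ u 0 0 := by
  rw [(hasDD_F_u hJ₁ hJ₂ hη₁ hη₂ hq.1 Φ).eq]
  obtain ⟨-, -, h3, h4, h5⟩ := hq.1
  have hd : η₁ (q x) - η₂ (q y) ≠ 0 := sub_ne_zero.2 h3
  have hF := sub_eq_zero.1 (hq.2 u 0 0)
  rw [hF] at hαy
  rw [hαy, hα, hβ]
  -- The difference of the two functions becomes an independent nonzero variable `d`, so that the
  -- only denominators left are `u`, `v` and `d`.
  have hd' : η₁ (q x) = (η₁ (q x) - η₂ (q y)) + η₂ (q y) := by ring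
  generalize η₁ (q x) - η₂ (q y) = d at *
  rw [hd']
  generalize η₂ (q y) = e
  rw [← sub_eq_zero (a := (_ : ℝ) * αy)]
  have : ∀ s t k : ℝ, k ≠ 0 → s = k * t → (s = 0 ↔ t = 0) := by
    rintro s t k hk rfl
    simp [hk]
  -- Here `d` is η₁ - η₂. The leading term of the linearized equation is v times the derivative
  -- `αy`, which fixes the factor -v/d.
  refine this _ _ (-(q (jet v 0 0) / d)) (neg_ne_zero.2 (div_ne_zero h5 hd)) ?_
  field_simp
  ring

/-- The linearization of the second equation, in terms of the variations `α`, `β` of `u_y / v` and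
`-v_x / u`. -/
theorem lin_F_v {q : JetCoord Dep → ℝ} (hq : q ∈ (sysEta J₁ J₂ η₁ η₂).inf) (Φ : Dep → ℕ → ℕ → ℝ)
    {α β βx : ℝ}
    (hα : Φ u 0 1 = q (jet u 0 1) / q (jet v 0 0) * Φ v 0 0 + q (jet v 0 0) * α)
    (hβ : Φ v 1 0 = q (jet v 1 0) / q (jet u 0 0) * Φ u 0 0 - q (jet u 0 0) * β)
    (hβx : Φ v 2 0 = (q (jet v 2 0) * q (jet u 0 0) - q (jet v 1 0) * q (jet u 1 0))
        / q (jet u 0 0) ^ 2 * Φ u 0 0 + q (jet v 1 0) / q (jet u 0 0) * Φ u 1 0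
        - (q (jet u 1 0) * β + q (jet u 0 0) * βx)) :
    dirDeriv (jetVert Φ) ((sysEta J₁ J₂ η₁ η₂).F v) q = 0 ↔
      (η₂ (q y) - η₁ (q x)) * βx = 1 / 2 * deriv η₁ (q x) * β - 1 / 2 * deriv η₂ (q y) * α
        - q (jet u 0 0) * Φ v 0 0 - q (jet v 0 0) * Φ u 0 0 := by
  rw [(hasDD_F_v hJ₁ hJ₂ hη₁ hη₂ hq.1 Φ).eq]
  obtain ⟨-, -, h3, h4, h5⟩ := hq.1
  have hd : η₂ (q y) - η₁ (q x) ≠ 0 := sub_ne_zero.2 h3.symm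
  have hF := sub_eq_zero.1 (hq.2 v 0 0)
  rw [hF] at hβx
  rw [hβx, hα, hβ]
  generalize η₂ (q y) - η₁ (q x) = d at *
  rw [← sub_eq_zero (a := (_ : ℝ) * βx)]
  have : ∀ s t k : ℝ, k ≠ 0 → s = k * t → (s = 0 ↔ t = 0) := by
    rintro s t k hk rfl
    simp [hk]
  -- Here `d` is η₂ - η₁, and the leading term is -u times `βx`.
  refine this _ _ (-(q (jet u 0 0) / d)) (neg_ne_zero.2 (div_ne_zero h4 hd)) ?_
  field_simp
  ring

-- The first equation rewritten for the y-derivative of u_y/v. The right-hand side is the one in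
-- `deriv_b_eq`, which does the same for the x-derivative of -v_x/u; comparing them gives the
-- compatibility of s₀.
omit hJ₁ hJ₂ hη₁ hη₂ in
theorem deriv_a_eq {q : JetCoord Dep → ℝ} (hq : q ∈ (sysEta J₁ J₂ η₁ η₂).inf) :
    (η₂ (q y) - η₁ (q x)) * ((q (jet u 0 2) * q (jet v 0 0) - q (jet u 0 1) * q (jet v 0 1))
      / q (jet v 0 0) ^ 2) = -(1 / 2 * deriv η₁ (q x) * (q (jet v 1 0) / q (jet u 0 0)))
        - 1 / 2 * deriv η₂ (q y) * (q (jet u 0 1) / q (jet v 0 0))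
        - q (jet u 0 0) * q (jet v 0 0) := by
  obtain ⟨-, -, h3, h4, h5⟩ := hq.1
  have hd : η₁ (q x) - η₂ (q y) ≠ 0 := sub_ne_zero.2 h3
  have hF := sub_eq_zero.1 (hq.2 u 0 0)
  rw [hF, ← neg_sub (η₁ (q x))]
  generalize η₁ (q x) - η₂ (q y) = d at *
  field_simp
  ring

omit hJ₁ hJ₂ hη₁ hη₂ in
theorem deriv_b_eq {q : JetCoord Dep → ℝ} (hq : q ∈ (sysEta J₁ J₂ η₁ η₂).inf) :
    (η₂ (q y) - η₁ (q x)) * -((q (jet v 2 0) * q (jet u 0 0) - q (jet v 1 0) * q (jet u 1 0))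
      / q (jet u 0 0) ^ 2) = -(1 / 2 * deriv η₁ (q x) * (q (jet v 1 0) / q (jet u 0 0)))
        - 1 / 2 * deriv η₂ (q y) * (q (jet u 0 1) / q (jet v 0 0))
        - q (jet u 0 0) * q (jet v 0 0) := by
  obtain ⟨-, -, h3, h4, h5⟩ := hq.1
  have hd : η₂ (q y) - η₁ (q x) ≠ 0 := sub_ne_zero.2 h3.symm
  have hF := sub_eq_zero.1 (hq.2 v 0 0)
  rw [hF]
  generalize η₂ (q y) - η₁ (q x) = d at *
  field_simp
  ring

end System

/-! ### Normality of the system and the covering by s₀, s₁, s₂ -/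

section System

variable {J₁ J₂ : Set ℝ} (hJ₁ : IsOpen J₁) (hJ₂ : IsOpen J₂) {η₁ η₂ : ℝ → ℝ}
  (hη₁ : ContDiffOn ℝ ∞ η₁ J₁) (hη₂ : ContDiffOn ℝ ∞ η₂ J₂)

/-- The multi-orders of the derivatives `u_yy` and `v_xx`. -/
def leadEta : Dep → ℕ × ℕ
  | Dep.u => (0, 2)
  | Dep.v => (2, 0)

include hJ₁ hJ₂ hη₁ hη₂ in
theorem isNormal_sysEta : IsNormal (sysEta J₁ J₂ η₁ η₂) leadEta where
  isOpen_dom := by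
    rw [isOpen_iff_mem_nhds]
    intro q hq
    have cc : ∀ c : JetCoord Dep, ContinuousAt (fun q : JetCoord Dep → ℝ => q c) q := fun c =>
      (continuous_apply c).continuousAt
    have e₁ : ContinuousAt (fun q : JetCoord Dep → ℝ => η₁ (q x)) q :=
      ContinuousAt.comp (f := fun q : JetCoord Dep → ℝ => q x)
        (eventually_contDiffAt hJ₁ hη₁ hq.1).self_of_nhds.continuousAt (cc x)
    have e₂ : ContinuousAt (fun q : JetCoord Dep → ℝ => η₂ (q y)) q :=
      ContinuousAt.comp (f := fun q : JetCoord Dep → ℝ => q y)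
        (eventually_contDiffAt hJ₂ hη₂ hq.2.1).self_of_nhds.continuousAt (cc y)
    filter_upwards [(cc x).eventually (hJ₁.mem_nhds hq.1), (cc y).eventually (hJ₂.mem_nhds hq.2.1),
      (e₁.sub e₂).eventually_ne (sub_ne_zero.2 hq.2.2.1), (cc (jet u 0 0)).eventually_ne hq.2.2.2.1,
      (cc (jet v 0 0)).eventually_ne hq.2.2.2.2] with r h1 h2 h3 h4 h5
    exact ⟨h1, h2, sub_ne_zero.1 h3, h4, h5⟩
  smooth := by
    rintro (_ | _) q hq
    · exact (hasDD_F_u hJ₁ hJ₂ hη₁ hη₂ hq fun _ _ _ => 0).smooth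
    · exact (hasDD_F_v hJ₁ hJ₂ hη₁ hη₂ hq fun _ _ _ => 0).smooth
  lower := by
    rintro (_ | _) p - q - hpq
    · simp only [sysEta, leadEta, hpq x (by decide), hpq y (by decide), hpq (jet u 0 0) (by decide),
        hpq (jet v 0 0) (by decide), hpq (jet u 0 1) (by decide), hpq (jet v 1 0) (by decide),
        hpq (jet v 0 1) (by decide)]
      ring
    · simp only [sysEta, leadEta, hpq x (by decide), hpq y (by decide), hpq (jet u 0 0) (by decide),
        hpq (jet v 0 0) (by decide), hpq (jet u 0 1) (by decide), hpq (jet v 1 0) (by decide),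
        hpq (jet u 1 0) (by decide)]
      ring
  dom_of_ord q hq q' h := by
    have hq' := hq
    simp only [sysEta, Set.mem_ofPred_eq, h x (by decide), h y (by decide),
      h (jet u 0 0) (by decide), h (jet v 0 0) (by decide)] at hq'
    exact hq'
  lead_pos := by rintro (_ | _) <;> decide

/-- For s₀ the two cross derivatives agree after multiplication by η₂ - η₁, by the system. For s₁
and s₂ the identity needs only the formulas for the derivatives of s₀. -/
theorem covS_comm : ∀ w, ∀ p ∈ (covS J₁ J₂ η₁ η₂).pts,
    (covS J₁ J₂ η₁ η₂).Dx ((covS J₁ J₂ η₁ η₂).Y w) p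
      = (covS J₁ J₂ η₁ η₂).Dy ((covS J₁ J₂ η₁ η₂).X w) p := by
  intro w p hp
  have hX : ∀ c, HasDD (fun c => (covS J₁ J₂ η₁ η₂).fieldX c p) p (fun q => q c)
    ((covS J₁ J₂ η₁ η₂).fieldX c p) := fun c => .coord c
  have hY : ∀ c, HasDD (fun c => (covS J₁ J₂ η₁ η₂).fieldY c p) p (fun q => q c)
    ((covS J₁ J₂ η₁ η₂).fieldY c p) := fun c => .coord c
  obtain ⟨-, -, h3, h4, h5⟩ := hp.1.1
  have h4' : p (Sum.inl (jet u 0 0)) ≠ 0 := h4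
  have h5' : p (Sum.inl (jet v 0 0)) ≠ 0 := h5
  fin_cases w
  · refine (((hX (Sum.inl (jet v 1 0))).div (hX (Sum.inl (jet u 0 0))) h4).neg.eq).trans
      (Eq.trans ?_ ((hY (Sum.inl (jet u 0 1))).div (hY (Sum.inl (jet v 0 0))) h5).eq.symm)
    have h := (deriv_b_eq hp.1).trans (deriv_a_eq hp.1).symm
    exact (mul_right_injective₀ (sub_ne_zero.2 h3.symm)) h
  · refine (((hX (Sum.inl (jet v 0 0))).mul (hX (Sum.inr 0)).sin).eq).trans
      (Eq.trans ?_ ((hY (Sum.inr 0)).cos.mul (hY (Sum.inl (jet u 0 0)))).eq.symm)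
    simp [Cov.fieldX, Cov.fieldY, jetX, jetY, covS]
    field_simp
  · refine (((hX (Sum.inl (jet v 0 0))).mul (hX (Sum.inr 0)).cos).eq).trans
      (Eq.trans ?_ ((hY (Sum.inr 0)).sin.neg.mul (hY (Sum.inl (jet u 0 0)))).eq.symm)
    simp [Cov.fieldX, Cov.fieldY, jetX, jetY, covS]
    field_simp

theorem smoothAt_covS_X {p : JetCoord Dep ⊕ Fin 3 → ℝ} (h5 : p (Sum.inl (jet v 0 0)) ≠ 0)
    (w : Fin 3) : SmoothAt ((covS J₁ J₂ η₁ η₂).X w) p := by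
  -- The direction plays no role; `HasDD` only assembles smoothness.
  have c : ∀ c, HasDD 0 p (fun q => q c) ((0 : JetCoord Dep ⊕ Fin 3 → ℝ) c) := fun c => .coord c
  fin_cases w
  · exact ((c _).div (c _) h5).smooth
  · exact ((c _).cos.mul (c _)).smooth
  · exact ((c _).sin.neg.mul (c _)).smooth

theorem smoothAt_covS_Y {p : JetCoord Dep ⊕ Fin 3 → ℝ} (h4 : p (Sum.inl (jet u 0 0)) ≠ 0)
    (w : Fin 3) : SmoothAt ((covS J₁ J₂ η₁ η₂).Y w) p := by
  have c : ∀ c, HasDD 0 p (fun q => q c) ((0 : JetCoord Dep ⊕ Fin 3 → ℝ) c) := fun c => .coord c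
  fin_cases w
  · exact ((c _).div (c _) h4).neg.smooth
  · exact ((c _).mul (c _).sin).smooth
  · exact ((c _).mul (c _).cos).smooth

theorem isCovering_covS : (covS J₁ J₂ η₁ η₂).IsCovering where
  isOpen_dom := isOpen_univ
  smooth_X w _ hp := smoothAt_covS_X hp.1.1.2.2.2.2 w
  smooth_Y w _ hp := smoothAt_covS_Y hp.1.1.2.2.2.1 w
  comm := covS_comm

end System

/-! ### The tangent covering -/

namespace Cov

variable {A K W : Type*}

theorem smoothAt_tangentBase (c : JetCoord A ⊕ W) (p : JetCoord (A ⊕ A) ⊕ (W ⊕ W) → ℝ) :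
    SmoothAt (fun p => tangentBase p c) p := by
  rcases c with c | w <;> exact smoothAt_coord _ _

theorem smoothAt_tangentFibre (c : JetCoord A ⊕ W) (p : JetCoord (A ⊕ A) ⊕ (W ⊕ W) → ℝ) :
    SmoothAt (fun p => tangentFibre p c) p := by
  rcases c with c | w
  · exact smoothAt_comp_inl (smoothAt_jetFibre c _)
  · exact smoothAt_coord _ _

variable {E : PDESystem A K}

theorem smoothAt_tangent_X {C : Cov E W} {p : JetCoord (A ⊕ A) ⊕ (W ⊕ W) → ℝ}
    (h : ∀ w, SmoothAt (C.X w) (tangentBase p)) (w : W ⊕ W) : SmoothAt (C.tangent.X w) p := by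
  rcases w with w | w
  · exact SmoothAt.comp (f := C.X w) (h w) fun c => smoothAt_tangentBase c p
  · exact SmoothAt.dirDeriv (f := C.X w) (h w) (fun c => smoothAt_tangentBase c p)
      fun c => smoothAt_tangentFibre c p

theorem smoothAt_tangent_Y {C : Cov E W} {p : JetCoord (A ⊕ A) ⊕ (W ⊕ W) → ℝ}
    (h : ∀ w, SmoothAt (C.Y w) (tangentBase p)) (w : W ⊕ W) : SmoothAt (C.tangent.Y w) p := by
  rcases w with w | w
  · exact SmoothAt.comp (f := C.Y w) (h w) fun c => smoothAt_tangentBase c p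
  · exact SmoothAt.dirDeriv (f := C.Y w) (h w) (fun c => smoothAt_tangentBase c p)
      fun c => smoothAt_tangentFibre c p

theorem tangent_Dx_base (C : Cov E W) {f : (JetCoord A ⊕ W → ℝ) → ℝ}
    {p : JetCoord (A ⊕ A) ⊕ (W ⊕ W) → ℝ} (hf : SmoothAt f (tangentBase p)) :
    C.tangent.Dx (fun p => f (tangentBase p)) p = C.Dx f (tangentBase p) := by
  refine along_comp (fun c => smoothAt_tangentBase c p) (fun c => ?_) hf
  rcases c with c | w
  · refine (HasDD.coord (Sum.inl (c.map Sum.inl))).eq.trans ?_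
    cases c <;> rfl
  · exact (HasDD.coord (Sum.inr (Sum.inl w))).eq

theorem tangent_Dy_base (C : Cov E W) {f : (JetCoord A ⊕ W → ℝ) → ℝ}
    {p : JetCoord (A ⊕ A) ⊕ (W ⊕ W) → ℝ} (hf : SmoothAt f (tangentBase p)) :
    C.tangent.Dy (fun p => f (tangentBase p)) p = C.Dy f (tangentBase p) := by
  refine along_comp (fun c => smoothAt_tangentBase c p) (fun c => ?_) hf
  rcases c with c | w
  · refine (HasDD.coord (Sum.inl (c.map Sum.inl))).eq.trans ?_
    cases c <;> rfl
  · exact (HasDD.coord (Sum.inr (Sum.inl w))).eq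

theorem tangentBase_mem_pts {E : PDESystem A A} {lead : A → ℕ × ℕ} (hE : IsNormal E lead)
    {C : Cov E W} {p : JetCoord (A ⊕ A) ⊕ (W ⊕ W) → ℝ} (hp : p ∈ C.tangent.pts) :
    tangentBase p ∈ C.pts :=
  ⟨hE.jetBase_mem_inf hp.1, hp.2⟩

end Cov

section TangentCovering

/-- Coordinates on the tangent covering of `covS`. -/
abbrev TCoord : Type := JetCoord (Dep ⊕ Dep) ⊕ (Fin 3 ⊕ Fin 3)

/-- Jets of `u`, `v`. -/
abbrev bj (a : Dep) (i j : ℕ) : TCoord := Sum.inl (jet (Sum.inl a) i j)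

/-- Jets of `U`, `V`. -/
abbrev vj (a : Dep) (i j : ℕ) : TCoord := Sum.inl (jet (Sum.inr a) i j)

/-- The nonlocal variables `s₀`, `s₁`, `s₂`. -/
abbrev bs (i : Fin 3) : TCoord := Sum.inr (Sum.inl i)

/-- The variations `S₀`, `S₁`, `S₂`. -/
abbrev vs (i : Fin 3) : TCoord := Sum.inr (Sum.inr i)

/-- The variation of `u_y / v`. -/
def alpha (p : TCoord → ℝ) : ℝ :=
  (p (vj u 0 1) * p (bj v 0 0) - p (bj u 0 1) * p (vj v 0 0)) / p (bj v 0 0) ^ 2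

/-- The variation of `-v_x / u`. -/
def beta (p : TCoord → ℝ) : ℝ :=
  -((p (vj v 1 0) * p (bj u 0 0) - p (bj v 1 0) * p (vj u 0 0)) / p (bj u 0 0) ^ 2)

/-- The total derivative of `alpha` in `y`. -/
def alphaY (p : TCoord → ℝ) : ℝ :=
  ((p (vj u 0 2) * p (bj v 0 0) + p (vj u 0 1) * p (bj v 0 1)
    - (p (bj u 0 2) * p (vj v 0 0) + p (bj u 0 1) * p (vj v 0 1))) * p (bj v 0 0) ^ 2
    - (p (vj u 0 1) * p (bj v 0 0) - p (bj u 0 1) * p (vj v 0 0))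
      * (2 * p (bj v 0 0) * p (bj v 0 1))) / p (bj v 0 0) ^ 4

/-- The total derivative of `beta` in `x`. -/
def betaX (p : TCoord → ℝ) : ℝ :=
  -(((p (vj v 2 0) * p (bj u 0 0) + p (vj v 1 0) * p (bj u 1 0)
    - (p (bj v 2 0) * p (vj u 0 0) + p (bj v 1 0) * p (vj u 1 0))) * p (bj u 0 0) ^ 2
    - (p (vj v 1 0) * p (bj u 0 0) - p (bj v 1 0) * p (vj u 0 0))
      * (2 * p (bj u 0 0) * p (bj u 1 0))) / p (bj u 0 0) ^ 4)

variable {J₁ J₂ : Set ℝ} {η₁ η₂ : ℝ → ℝ} {p : TCoord → ℝ}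

theorem hasDD_alpha (h5 : p (bj v 0 0) ≠ 0) :
    HasDD (fun c => (covS J₁ J₂ η₁ η₂).tangent.fieldY c p) p alpha (alphaY p) := by
  have c : ∀ c, HasDD (fun c => (covS J₁ J₂ η₁ η₂).tangent.fieldY c p) p (fun q => q c)
    ((covS J₁ J₂ η₁ η₂).tangent.fieldY c p) := fun c => .coord c
  have c1 : HasDD _ p (fun q => q (vj u 0 1)) (p (vj u 0 2)) := c (vj u 0 1)
  have c2 : HasDD _ p (fun q => q (bj v 0 0)) (p (bj v 0 1)) := c (bj v 0 0)
  have c3 : HasDD _ p (fun q => q (bj u 0 1)) (p (bj u 0 2)) := c (bj u 0 1)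
  have c4 : HasDD _ p (fun q => q (vj v 0 0)) (p (vj v 0 1)) := c (vj v 0 0)
  refine ((((c1.mul c2).sub (c3.mul c4)).div (c2.mul c2) (mul_ne_zero h5 h5)).congr
    (.of_forall fun q => ?_)).congr_val ?_
  · simp only [alpha, sq]
  · simp only [alphaY]
    congr 1 <;> ring

theorem hasDD_beta (h4 : p (bj u 0 0) ≠ 0) :
    HasDD (fun c => (covS J₁ J₂ η₁ η₂).tangent.fieldX c p) p beta (betaX p) := by
  have c : ∀ c, HasDD (fun c => (covS J₁ J₂ η₁ η₂).tangent.fieldX c p) p (fun q => q c)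
    ((covS J₁ J₂ η₁ η₂).tangent.fieldX c p) := fun c => .coord c
  have c1 : HasDD _ p (fun q => q (vj v 1 0)) (p (vj v 2 0)) := c (vj v 1 0)
  have c2 : HasDD _ p (fun q => q (bj u 0 0)) (p (bj u 1 0)) := c (bj u 0 0)
  have c3 : HasDD _ p (fun q => q (bj v 1 0)) (p (bj v 2 0)) := c (bj v 1 0)
  have c4 : HasDD _ p (fun q => q (vj u 0 0)) (p (vj u 1 0)) := c (vj u 0 0)
  refine ((((c1.mul c2).sub (c3.mul c4)).div (c2.mul c2) (mul_ne_zero h4 h4)).neg.congr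
    (.of_forall fun q => ?_)).congr_val ?_
  · simp only [beta, sq]
  · simp only [betaX]
    congr 2 <;> ring

theorem tangent_X_zero (h5 : p (bj v 0 0) ≠ 0) :
    (covS J₁ J₂ η₁ η₂).tangent.X (Sum.inr 0) p = alpha p :=
  ((HasDD.coord (ξ := Cov.tangentFibre p) (p := Cov.tangentBase p) (Sum.inl (jet u 0 1))).div
    (HasDD.coord (Sum.inl (jet v 0 0))) h5).eq

theorem tangent_Y_zero (h4 : p (bj u 0 0) ≠ 0) :
    (covS J₁ J₂ η₁ η₂).tangent.Y (Sum.inr 0) p = beta p :=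
  ((HasDD.coord (ξ := Cov.tangentFibre p) (p := Cov.tangentBase p) (Sum.inl (jet v 1 0))).div
    (HasDD.coord (Sum.inl (jet u 0 0))) h4).neg.eq

theorem tangent_X_one : (covS J₁ J₂ η₁ η₂).tangent.X (Sum.inr 1) p
    = -Real.sin (p (bs 0)) * p (vs 0) * p (bj u 0 0) + Real.cos (p (bs 0)) * p (vj u 0 0) :=
  ((HasDD.coord (ξ := Cov.tangentFibre p) (p := Cov.tangentBase p) (Sum.inr 0)).cos.mul
    (HasDD.coord (Sum.inl (jet u 0 0)))).eq

theorem tangent_Y_one : (covS J₁ J₂ η₁ η₂).tangent.Y (Sum.inr 1) p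
    = p (vj v 0 0) * Real.sin (p (bs 0)) + p (bj v 0 0) * (Real.cos (p (bs 0)) * p (vs 0)) :=
  ((HasDD.coord (ξ := Cov.tangentFibre p) (p := Cov.tangentBase p) (Sum.inl (jet v 0 0))).mul
    (HasDD.coord (Sum.inr 0)).sin).eq

theorem tangent_X_two : (covS J₁ J₂ η₁ η₂).tangent.X (Sum.inr 2) p
    = -(Real.cos (p (bs 0)) * p (vs 0)) * p (bj u 0 0)
      + -Real.sin (p (bs 0)) * p (vj u 0 0) :=
  ((HasDD.coord (ξ := Cov.tangentFibre p) (p := Cov.tangentBase p) (Sum.inr 0)).sin.neg.mul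
    (HasDD.coord (Sum.inl (jet u 0 0)))).eq

theorem tangent_Y_two : (covS J₁ J₂ η₁ η₂).tangent.Y (Sum.inr 2) p
    = p (vj v 0 0) * Real.cos (p (bs 0)) + p (bj v 0 0) * (-Real.sin (p (bs 0)) * p (vs 0)) :=
  ((HasDD.coord (ξ := Cov.tangentFibre p) (p := Cov.tangentBase p) (Sum.inl (jet v 0 0))).mul
    (HasDD.coord (Sum.inr 0)).cos).eq

theorem eventually_ne_coord {I : Type*} {p : I → ℝ} {c : I} (h : p c ≠ 0) :
    ∀ᶠ q in 𝓝 p, q c ≠ 0 :=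
  (continuous_apply c).continuousAt.eventually_ne h

/-- The variation of the identity u_y = (u_y/v) v. Together with `vj_v_eq` it supplies the
hypotheses of `lin_F_u` and `lin_F_v`. -/
theorem vj_u_eq (h5 : p (bj v 0 0) ≠ 0) :
    p (vj u 0 1) = p (bj u 0 1) / p (bj v 0 0) * p (vj v 0 0) + p (bj v 0 0) * alpha p := by
  simp only [alpha]
  field_simp
  ring

theorem vj_v_eq (h4 : p (bj u 0 0) ≠ 0) :
    p (vj v 1 0) = p (bj v 1 0) / p (bj u 0 0) * p (vj u 0 0) - p (bj u 0 0) * beta p := by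
  simp only [beta]
  field_simp
  ring

variable (hJ₁ : IsOpen J₁) (hJ₂ : IsOpen J₂) (hη₁ : ContDiffOn ℝ ∞ η₁ J₁)
  (hη₂ : ContDiffOn ℝ ∞ η₂ J₂)

include hJ₁ hJ₂ hη₁ hη₂

theorem mem_inf_of_mem_pts (hp : p ∈ (covS J₁ J₂ η₁ η₂).tangent.pts) :
    jetBase (p ∘ Sum.inl) ∈ (sysEta J₁ J₂ η₁ η₂).inf :=
  (isNormal_sysEta hJ₁ hJ₂ hη₁ hη₂).jetBase_mem_inf hp.1

/-- The linearized first equation, written in `alpha` and `beta`. The right-hand side is shared with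
`betaX_eq`, which yields the compatibility of S₀. -/
theorem alphaY_eq (hp : p ∈ (covS J₁ J₂ η₁ η₂).tangent.pts) :
    (η₂ (p (Sum.inl y)) - η₁ (p (Sum.inl x))) * alphaY p
      = 1 / 2 * deriv η₁ (p (Sum.inl x)) * beta p - 1 / 2 * deriv η₂ (p (Sum.inl y)) * alpha p
        - p (bj u 0 0) * p (vj v 0 0) - p (bj v 0 0) * p (vj u 0 0) := by
  have hq := mem_inf_of_mem_pts hJ₁ hJ₂ hη₁ hη₂ hp
  obtain ⟨-, -, -, h4, h5⟩ := hq.1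
  have h5' : p (bj v 0 0) ≠ 0 := h5
  refine (lin_F_u hJ₁ hJ₂ hη₁ hη₂ hq (fun a i j => p (vj a i j)) (vj_u_eq h5) (vj_v_eq h4) ?_).1
    (hp.1.2 (Sum.inr u) 0 0)
  change p (vj u 0 2) = (p (bj u 0 2) * p (bj v 0 0) - p (bj u 0 1) * p (bj v 0 1))
    / p (bj v 0 0) ^ 2 * p (vj v 0 0) + p (bj u 0 1) / p (bj v 0 0) * p (vj v 0 1)
    + p (bj v 0 1) * alpha p + p (bj v 0 0) * alphaY p
  simp only [alpha, alphaY]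
  field_simp
  ring

theorem betaX_eq (hp : p ∈ (covS J₁ J₂ η₁ η₂).tangent.pts) :
    (η₂ (p (Sum.inl y)) - η₁ (p (Sum.inl x))) * betaX p
      = 1 / 2 * deriv η₁ (p (Sum.inl x)) * beta p - 1 / 2 * deriv η₂ (p (Sum.inl y)) * alpha p
        - p (bj u 0 0) * p (vj v 0 0) - p (bj v 0 0) * p (vj u 0 0) := by
  have hq := mem_inf_of_mem_pts hJ₁ hJ₂ hη₁ hη₂ hp
  obtain ⟨-, -, -, h4, h5⟩ := hq.1
  have h4' : p (bj u 0 0) ≠ 0 := h4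
  refine (lin_F_v hJ₁ hJ₂ hη₁ hη₂ hq (fun a i j => p (vj a i j)) (vj_u_eq h5) (vj_v_eq h4) ?_).1
    (hp.1.2 (Sum.inr v) 0 0)
  change p (vj v 2 0) = (p (bj v 2 0) * p (bj u 0 0) - p (bj v 1 0) * p (bj u 1 0))
    / p (bj u 0 0) ^ 2 * p (vj u 0 0) + p (bj v 1 0) / p (bj u 0 0) * p (vj u 1 0)
    - (p (bj u 1 0) * beta p + p (bj u 0 0) * betaX p)
  simp only [beta, betaX]
  field_simp
  ring

theorem isCovering_tangent_covS : (covS J₁ J₂ η₁ η₂).tangent.IsCovering where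
  isOpen_dom := isOpen_univ
  smooth_X w _ hp := Cov.smoothAt_tangent_X (fun w => smoothAt_covS_X hp.1.1.2.2.2.2 w) w
  smooth_Y w _ hp := Cov.smoothAt_tangent_Y (fun w => smoothAt_covS_Y hp.1.1.2.2.2.1 w) w
  comm := by
    rintro (w | w) p hp
    · have hq := Cov.tangentBase_mem_pts (isNormal_sysEta hJ₁ hJ₂ hη₁ hη₂) hp
      exact (Cov.tangent_Dx_base _ (isCovering_covS.smooth_Y w _ hq)).trans
        ((covS_comm w _ hq).trans
          (Cov.tangent_Dy_base _ (isCovering_covS.smooth_X w _ hq)).symm)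
    · have hq := mem_inf_of_mem_pts hJ₁ hJ₂ hη₁ hη₂ hp
      obtain ⟨-, -, h3, h4, h5⟩ := hq.1
      have h4' : p (bj u 0 0) ≠ 0 := h4
      have h5' : p (bj v 0 0) ≠ 0 := h5
      have cX : ∀ c, HasDD (fun c => (covS J₁ J₂ η₁ η₂).tangent.fieldX c p) p (fun q => q c)
        ((covS J₁ J₂ η₁ η₂).tangent.fieldX c p) := fun c => .coord c
      have cY : ∀ c, HasDD (fun c => (covS J₁ J₂ η₁ η₂).tangent.fieldY c p) p (fun q => q c)
        ((covS J₁ J₂ η₁ η₂).tangent.fieldY c p) := fun c => .coord c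
      have x1 : HasDD _ p (fun q => q (bs 0)) (p (bj u 0 1) / p (bj v 0 0)) := cX (bs 0)
      have x2 : HasDD _ p (fun q => q (vs 0)) (alpha p) :=
        (cX (vs 0)).congr_val (tangent_X_zero h5)
      have x3 : HasDD _ p (fun q => q (vj v 0 0)) (p (vj v 1 0)) := cX (vj v 0 0)
      have x4 : HasDD _ p (fun q => q (bj v 0 0)) (p (bj v 1 0)) := cX (bj v 0 0)
      have y1 : HasDD _ p (fun q => q (bs 0)) (-(p (bj v 1 0) / p (bj u 0 0))) := cY (bs 0)
      have y2 : HasDD _ p (fun q => q (vs 0)) (beta p) :=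
        (cY (vs 0)).congr_val (tangent_Y_zero h4)
      have y3 : HasDD _ p (fun q => q (vj u 0 0)) (p (vj u 0 1)) := cY (vj u 0 0)
      have y4 : HasDD _ p (fun q => q (bj u 0 0)) (p (bj u 0 1)) := cY (bj u 0 0)
      have hu := vj_u_eq (p := p) h5
      have hv := vj_v_eq (p := p) h4
      fin_cases w
      -- The closed formulas for the derivatives of S₀ require u ≠ 0 and v ≠ 0. These persist near
      -- `p`, which suffices for differentiating.
      · have h1 := (hasDD_beta (J₁ := J₁) (J₂ := J₂) (η₁ := η₁) (η₂ := η₂) h4).congr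
          ((eventually_ne_coord h4').mono fun q hq =>
            tangent_Y_zero (J₁ := J₁) (J₂ := J₂) (η₁ := η₁) (η₂ := η₂) hq)
        have h2 := (hasDD_alpha (J₁ := J₁) (J₂ := J₂) (η₁ := η₁) (η₂ := η₂) h5).congr
          ((eventually_ne_coord h5').mono fun q hq =>
            tangent_X_zero (J₁ := J₁) (J₂ := J₂) (η₁ := η₁) (η₂ := η₂) hq)
        refine h1.eq.trans (Eq.trans ?_ h2.eq.symm)
        exact mul_right_injective₀ (sub_ne_zero.2 h3.symm)
          ((betaX_eq hJ₁ hJ₂ hη₁ hη₂ hp).trans (alphaY_eq hJ₁ hJ₂ hη₁ hη₂ hp).symm)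
      · have h1 := ((x3.mul x1.sin).add (x4.mul (x1.cos.mul x2))).congr
          (.of_forall fun q => tangent_Y_one (J₁ := J₁) (J₂ := J₂) (η₁ := η₁) (η₂ := η₂))
        have h2 := (((y1.sin.neg.mul y2).mul y4).add (y1.cos.mul y3)).congr
          (.of_forall fun q => tangent_X_one (J₁ := J₁) (J₂ := J₂) (η₁ := η₁) (η₂ := η₂))
        refine h1.eq.trans (Eq.trans ?_ h2.eq.symm)
        rw [hu, hv]
        field_simp
        ring
      · have h1 := ((x3.mul x1.cos).add (x4.mul (x1.sin.neg.mul x2))).congr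
          (.of_forall fun q => tangent_Y_two (J₁ := J₁) (J₂ := J₂) (η₁ := η₁) (η₂ := η₂))
        have h2 := (((y1.cos.mul y2).neg.mul y4).add (y1.sin.neg.mul y3)).congr
          (.of_forall fun q => tangent_X_two (J₁ := J₁) (J₂ := J₂) (η₁ := η₁) (η₂ := η₂))
        refine h1.eq.trans (Eq.trans ?_ h2.eq.symm)
        rw [hu, hv]
        field_simp
        ring

end TangentCovering

/-! ### The recursion operator in the rotated variations -/

section RecursionOperator

/-- The rotated variation `sin s₀ S₁ + cos s₀ S₂`. -/
def rotT (p : TCoord → ℝ) : ℝ := Real.sin (p (bs 0)) * p (vs 1) + Real.cos (p (bs 0)) * p (vs 2)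

/-- The rotated variation `cos s₀ S₁ - sin s₀ S₂`. -/
def rotZ (p : TCoord → ℝ) : ℝ := Real.cos (p (bs 0)) * p (vs 1) - Real.sin (p (bs 0)) * p (vs 2)

/-- The variation of `u_y / v` that corresponds to `(Ũ, Ṽ)`. -/
def alphaT (η₁ : ℝ → ℝ) (p : TCoord → ℝ) : ℝ :=
  η₁ (p (Sum.inl x)) * alpha p + 1 / 2 * deriv η₁ (p (Sum.inl x)) * p (vs 0)
    - p (bj u 0 0) * rotT p

/-- The variation of `-v_x / u` that corresponds to `(Ũ, Ṽ)`. -/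
def betaT (η₂ : ℝ → ℝ) (p : TCoord → ℝ) : ℝ :=
  η₂ (p (Sum.inl y)) * beta p + 1 / 2 * deriv η₂ (p (Sum.inl y)) * p (vs 0)
    + p (bj v 0 0) * rotZ p

/-- Written through `rotT` and `rotZ`, the operator no longer contains trigonometric functions. -/
theorem roTangent_u (η₁ η₂ : ℝ → ℝ) (p : TCoord → ℝ) : roTangent η₁ η₂ (Sum.inr u) p
    = η₁ (p (Sum.inl x)) * p (vj u 0 0) + (1 / 2 * deriv η₁ (p (Sum.inl x))) * rotZ p
      + (η₂ (p (Sum.inl y)) - η₁ (p (Sum.inl x))) * (p (bj u 0 1) / p (bj v 0 0)) * rotT p := by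
  simp only [roTangent, ro, rotT, rotZ, jetBase, JetCoord.map, Function.comp]
  ring

theorem roTangent_v (η₁ η₂ : ℝ → ℝ) (p : TCoord → ℝ) : roTangent η₁ η₂ (Sum.inr v) p
    = η₂ (p (Sum.inl y)) * p (vj v 0 0) + (1 / 2 * deriv η₂ (p (Sum.inl y))) * rotT p
      - (η₂ (p (Sum.inl y)) - η₁ (p (Sum.inl x))) * (p (bj v 1 0) / p (bj u 0 0)) * rotZ p := by
  simp only [roTangent, ro, rotT, rotZ, jetBase, JetCoord.map, Function.comp]
  ring

variable {J₁ J₂ : Set ℝ} {η₁ η₂ : ℝ → ℝ} {p : TCoord → ℝ}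

/-- The rotation by s₀ undoes the one in the equations of s₁ and s₂, and sin² + cos² = 1 removes
what remains. With the next three lemmas, the derivatives of `rotT` and `rotZ` are thus free of
trigonometric functions as well. -/
theorem hasDD_rotT_X : HasDD (fun c => (covS J₁ J₂ η₁ η₂).tangent.fieldX c p) p rotT
    (p (bj u 0 1) / p (bj v 0 0) * rotZ p - p (bj u 0 0) * p (vs 0)) := by
  have c : ∀ c, HasDD (fun c => (covS J₁ J₂ η₁ η₂).tangent.fieldX c p) p (fun q => q c)
    ((covS J₁ J₂ η₁ η₂).tangent.fieldX c p) := fun c => .coord c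
  have c0 : HasDD _ p (fun q => q (bs 0)) (p (bj u 0 1) / p (bj v 0 0)) := c (bs 0)
  have c1 := (c (vs 1)).congr_val tangent_X_one
  have c2 := (c (vs 2)).congr_val tangent_X_two
  refine ((c0.sin.mul c1).add (c0.cos.mul c2)).congr_val ?_
  simp only [rotZ]
  linear_combination (-p (bj u 0 0) * p (vs 0)) * Real.sin_sq_add_cos_sq (p (bs 0))

theorem hasDD_rotZ_X : HasDD (fun c => (covS J₁ J₂ η₁ η₂).tangent.fieldX c p) p rotZ
    (p (vj u 0 0) - p (bj u 0 1) / p (bj v 0 0) * rotT p) := by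
  have c : ∀ c, HasDD (fun c => (covS J₁ J₂ η₁ η₂).tangent.fieldX c p) p (fun q => q c)
    ((covS J₁ J₂ η₁ η₂).tangent.fieldX c p) := fun c => .coord c
  have c0 : HasDD _ p (fun q => q (bs 0)) (p (bj u 0 1) / p (bj v 0 0)) := c (bs 0)
  have c1 := (c (vs 1)).congr_val tangent_X_one
  have c2 := (c (vs 2)).congr_val tangent_X_two
  refine ((c0.cos.mul c1).sub (c0.sin.mul c2)).congr_val ?_
  simp only [rotT]
  linear_combination (p (vj u 0 0)) * Real.sin_sq_add_cos_sq (p (bs 0))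

theorem hasDD_rotT_Y : HasDD (fun c => (covS J₁ J₂ η₁ η₂).tangent.fieldY c p) p rotT
    (p (vj v 0 0) - p (bj v 1 0) / p (bj u 0 0) * rotZ p) := by
  have c : ∀ c, HasDD (fun c => (covS J₁ J₂ η₁ η₂).tangent.fieldY c p) p (fun q => q c)
    ((covS J₁ J₂ η₁ η₂).tangent.fieldY c p) := fun c => .coord c
  have c0 : HasDD _ p (fun q => q (bs 0)) (-(p (bj v 1 0) / p (bj u 0 0))) := c (bs 0)
  have c1 := (c (vs 1)).congr_val tangent_Y_one
  have c2 := (c (vs 2)).congr_val tangent_Y_two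
  refine ((c0.sin.mul c1).add (c0.cos.mul c2)).congr_val ?_
  simp only [rotZ]
  linear_combination (p (vj v 0 0)) * Real.sin_sq_add_cos_sq (p (bs 0))

theorem hasDD_rotZ_Y : HasDD (fun c => (covS J₁ J₂ η₁ η₂).tangent.fieldY c p) p rotZ
    (p (bj v 0 0) * p (vs 0) + p (bj v 1 0) / p (bj u 0 0) * rotT p) := by
  have c : ∀ c, HasDD (fun c => (covS J₁ J₂ η₁ η₂).tangent.fieldY c p) p (fun q => q c)
    ((covS J₁ J₂ η₁ η₂).tangent.fieldY c p) := fun c => .coord c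
  have c0 : HasDD _ p (fun q => q (bs 0)) (-(p (bj v 1 0) / p (bj u 0 0))) := c (bs 0)
  have c1 := (c (vs 1)).congr_val tangent_Y_one
  have c2 := (c (vs 2)).congr_val tangent_Y_two
  refine ((c0.cos.mul c1).sub (c0.sin.mul c2)).congr_val ?_
  simp only [rotT]
  linear_combination (p (bj v 0 0) * p (vs 0)) * Real.sin_sq_add_cos_sq (p (bs 0))

variable (hJ₁ : IsOpen J₁) (hJ₂ : IsOpen J₂) (hη₁ : ContDiffOn ℝ ∞ η₁ J₁)
  (hη₂ : ContDiffOn ℝ ∞ η₂ J₂)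

include hJ₁ hη₁ in
theorem hasDD_eta₁ {ξ : TCoord → ℝ} {d : ℝ} (h : p (Sum.inl x) ∈ J₁) (hd : ξ (Sum.inl x) = d) :
    HasDD ξ p (fun q => η₁ (q (Sum.inl x))) (deriv η₁ (p (Sum.inl x)) * d) :=
  hd ▸ (HasDD.coord (Sum.inl x)).scalar (eventually_contDiffAt hJ₁ hη₁ h)

include hJ₂ hη₂ in
theorem hasDD_eta₂ {ξ : TCoord → ℝ} {d : ℝ} (h : p (Sum.inl y) ∈ J₂) (hd : ξ (Sum.inl y) = d) :
    HasDD ξ p (fun q => η₂ (q (Sum.inl y))) (deriv η₂ (p (Sum.inl y)) * d) :=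
  hd ▸ (HasDD.coord (Sum.inl y)).scalar (eventually_contDiffAt hJ₂ hη₂ h)

include hJ₁ hJ₂ hη₁ hη₂

theorem smoothAt_roTangent (hp : jetBase (p ∘ Sum.inl) ∈ (sysEta J₁ J₂ η₁ η₂).dom)
    (a : Dep ⊕ Dep) : SmoothAt (roTangent η₁ η₂ a) p := by
  obtain ⟨h1, h2, -, h4, h5⟩ := hp
  have c : ∀ c, HasDD 0 p (fun q => q c) 0 := fun c => .coord c
  have e₁ := hasDD_eta₁ hJ₁ hη₁ (p := p) (ξ := 0) h1 rfl
  have e₂ := hasDD_eta₂ hJ₂ hη₂ (p := p) (ξ := 0) h2 rfl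
  have e₁' := hasDD_eta₁ hJ₁ (contDiffOn_deriv hJ₁ hη₁) (p := p) (ξ := 0) h1 rfl
  have e₂' := hasDD_eta₂ hJ₂ (contDiffOn_deriv hJ₂ hη₂) (p := p) (ξ := 0) h2 rfl
  have hh : HasDD 0 p (fun _ => (1 / 2 : ℝ)) 0 := .const _
  have hT : SmoothAt rotT p := (((c _).sin.mul (c _)).add ((c _).cos.mul (c _))).smooth
  have hZ : SmoothAt rotZ p := (((c _).cos.mul (c _)).sub ((c _).sin.mul (c _))).smooth
  rcases a with a | _ | _
  · exact smoothAt_coord _ _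
  · exact ((((e₁.mul (c _)).add ((hh.mul e₁').mul (.of_smooth hZ _))).add
      (((e₂.sub e₁).mul ((c _).div (c _) h5)).mul (.of_smooth hT _))).congr
      (.of_forall fun q => roTangent_u η₁ η₂ q)).smooth
  · exact ((((e₂.mul (c _)).add ((hh.mul e₂').mul (.of_smooth hT _))).sub
      (((e₂.sub e₁).mul ((c _).div (c _) h4)).mul (.of_smooth hZ _))).congr
      (.of_forall fun q => roTangent_v η₁ η₂ q)).smooth

/-- The variation of u_y = (u_y/v) v for the new pair, which shows that `alphaT` is its variation of
u_y/v. The coefficient of `rotT` contains the y-derivative of u_y/v, which the system eliminates. -/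
theorem Dy_roTangent_u (hp : p ∈ (covS J₁ J₂ η₁ η₂).tangent.pts) :
    (covS J₁ J₂ η₁ η₂).tangent.Dy (roTangent η₁ η₂ (Sum.inr u)) p
      = p (bj u 0 1) / p (bj v 0 0) * roTangent η₁ η₂ (Sum.inr v) p
        + p (bj v 0 0) * alphaT η₁ p := by
  have hq := mem_inf_of_mem_pts hJ₁ hJ₂ hη₁ hη₂ hp
  obtain ⟨h1, h2, h3, h4, h5⟩ := hq.1
  have c : ∀ c, HasDD (fun c => (covS J₁ J₂ η₁ η₂).tangent.fieldY c p) p (fun q => q c)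
    ((covS J₁ J₂ η₁ η₂).tangent.fieldY c p) := fun c => .coord c
  have c1 : HasDD _ p (fun q => q (vj u 0 0)) (p (vj u 0 1)) := c (vj u 0 0)
  have c2 : HasDD _ p (fun q => q (bj u 0 1)) (p (bj u 0 2)) := c (bj u 0 1)
  have c3 : HasDD _ p (fun q => q (bj v 0 0)) (p (bj v 0 1)) := c (bj v 0 0)
  have e₁ := hasDD_eta₁ hJ₁ hη₁ (p := p) (d := 0)
    (ξ := fun c => (covS J₁ J₂ η₁ η₂).tangent.fieldY c p) h1 rfl
  have e₂ := hasDD_eta₂ hJ₂ hη₂ (p := p) (d := 1)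
    (ξ := fun c => (covS J₁ J₂ η₁ η₂).tangent.fieldY c p) h2 rfl
  have e₁' := hasDD_eta₁ hJ₁ (contDiffOn_deriv hJ₁ hη₁) (p := p) (d := 0)
    (ξ := fun c => (covS J₁ J₂ η₁ η₂).tangent.fieldY c p) h1 rfl
  have hh : HasDD (fun c => (covS J₁ J₂ η₁ η₂).tangent.fieldY c p) p (fun _ => (1 / 2 : ℝ)) 0 :=
    .const _
  have key := (((e₁.mul c1).add ((hh.mul e₁').mul hasDD_rotZ_Y)).add
    (((e₂.sub e₁).mul (c2.div c3 h5)).mul hasDD_rotT_Y)).congr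
      (.of_forall fun q => roTangent_u η₁ η₂ q)
  refine key.eq.trans ?_
  have ha : (η₂ (p (Sum.inl y)) - η₁ (p (Sum.inl x)))
      * ((p (bj u 0 2) * p (bj v 0 0) - p (bj u 0 1) * p (bj v 0 1)) / p (bj v 0 0) ^ 2)
      = -(1 / 2 * deriv η₁ (p (Sum.inl x)) * (p (bj v 1 0) / p (bj u 0 0)))
        - 1 / 2 * deriv η₂ (p (Sum.inl y)) * (p (bj u 0 1) / p (bj v 0 0))
        - p (bj u 0 0) * p (bj v 0 0) := deriv_a_eq hq
  have hu := vj_u_eq (p := p) h5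
  rw [roTangent_v, alphaT]
  linear_combination (rotT p) * ha + η₁ (p (Sum.inl x)) * hu

theorem Dx_roTangent_v (hp : p ∈ (covS J₁ J₂ η₁ η₂).tangent.pts) :
    (covS J₁ J₂ η₁ η₂).tangent.Dx (roTangent η₁ η₂ (Sum.inr v)) p
      = p (bj v 1 0) / p (bj u 0 0) * roTangent η₁ η₂ (Sum.inr u) p
        - p (bj u 0 0) * betaT η₂ p := by
  have hq := mem_inf_of_mem_pts hJ₁ hJ₂ hη₁ hη₂ hp
  obtain ⟨h1, h2, h3, h4, h5⟩ := hq.1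
  have c : ∀ c, HasDD (fun c => (covS J₁ J₂ η₁ η₂).tangent.fieldX c p) p (fun q => q c)
    ((covS J₁ J₂ η₁ η₂).tangent.fieldX c p) := fun c => .coord c
  have c1 : HasDD _ p (fun q => q (vj v 0 0)) (p (vj v 1 0)) := c (vj v 0 0)
  have c2 : HasDD _ p (fun q => q (bj v 1 0)) (p (bj v 2 0)) := c (bj v 1 0)
  have c3 : HasDD _ p (fun q => q (bj u 0 0)) (p (bj u 1 0)) := c (bj u 0 0)
  have e₁ := hasDD_eta₁ hJ₁ hη₁ (p := p) (d := 1)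
    (ξ := fun c => (covS J₁ J₂ η₁ η₂).tangent.fieldX c p) h1 rfl
  have e₂ := hasDD_eta₂ hJ₂ hη₂ (p := p) (d := 0)
    (ξ := fun c => (covS J₁ J₂ η₁ η₂).tangent.fieldX c p) h2 rfl
  have e₂' := hasDD_eta₂ hJ₂ (contDiffOn_deriv hJ₂ hη₂) (p := p) (d := 0)
    (ξ := fun c => (covS J₁ J₂ η₁ η₂).tangent.fieldX c p) h2 rfl
  have hh : HasDD (fun c => (covS J₁ J₂ η₁ η₂).tangent.fieldX c p) p (fun _ => (1 / 2 : ℝ)) 0 :=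
    .const _
  have key := (((e₂.mul c1).add ((hh.mul e₂').mul hasDD_rotT_X)).sub
    (((e₂.sub e₁).mul (c2.div c3 h4)).mul hasDD_rotZ_X)).congr
      (.of_forall fun q => roTangent_v η₁ η₂ q)
  refine key.eq.trans ?_
  have hb : (η₂ (p (Sum.inl y)) - η₁ (p (Sum.inl x)))
      * -((p (bj v 2 0) * p (bj u 0 0) - p (bj v 1 0) * p (bj u 1 0)) / p (bj u 0 0) ^ 2)
      = -(1 / 2 * deriv η₁ (p (Sum.inl x)) * (p (bj v 1 0) / p (bj u 0 0)))
        - 1 / 2 * deriv η₂ (p (Sum.inl y)) * (p (bj u 0 1) / p (bj v 0 0))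
        - p (bj u 0 0) * p (bj v 0 0) := deriv_b_eq hq
  have hv := vj_v_eq (p := p) h4
  rw [roTangent_u, betaT]
  linear_combination (rotZ p) * hb + η₂ (p (Sum.inl y)) * hv

omit hJ₂ hη₂ in
theorem hasDD_alphaT (hp : jetBase (p ∘ Sum.inl) ∈ (sysEta J₁ J₂ η₁ η₂).dom) :
    HasDD (fun c => (covS J₁ J₂ η₁ η₂).tangent.fieldY c p) p (alphaT η₁)
      (η₁ (p (Sum.inl x)) * alphaY p + 1 / 2 * deriv η₁ (p (Sum.inl x)) * beta p
        - (p (bj u 0 1) * rotT p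
          + p (bj u 0 0) * (p (vj v 0 0) - p (bj v 1 0) / p (bj u 0 0) * rotZ p))) := by
  obtain ⟨h1, h2, h3, h4, h5⟩ := hp
  have c : ∀ c, HasDD (fun c => (covS J₁ J₂ η₁ η₂).tangent.fieldY c p) p (fun q => q c)
    ((covS J₁ J₂ η₁ η₂).tangent.fieldY c p) := fun c => .coord c
  have c1 : HasDD _ p (fun q => q (bj u 0 0)) (p (bj u 0 1)) := c (bj u 0 0)
  have c2 := (c (vs 0)).congr_val (tangent_Y_zero h4)
  have e₁ := hasDD_eta₁ hJ₁ hη₁ (p := p) (d := 0)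
    (ξ := fun c => (covS J₁ J₂ η₁ η₂).tangent.fieldY c p) h1 rfl
  have e₁' := hasDD_eta₁ hJ₁ (contDiffOn_deriv hJ₁ hη₁) (p := p) (d := 0)
    (ξ := fun c => (covS J₁ J₂ η₁ η₂).tangent.fieldY c p) h1 rfl
  have hh : HasDD (fun c => (covS J₁ J₂ η₁ η₂).tangent.fieldY c p) p (fun _ => (1 / 2 : ℝ)) 0 :=
    .const _
  refine (((e₁.mul (hasDD_alpha h5)).add ((hh.mul e₁').mul c2)).sub
    (c1.mul hasDD_rotT_Y)).congr_val ?_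
  ring

omit hJ₁ hη₁ in
theorem hasDD_betaT (hp : jetBase (p ∘ Sum.inl) ∈ (sysEta J₁ J₂ η₁ η₂).dom) :
    HasDD (fun c => (covS J₁ J₂ η₁ η₂).tangent.fieldX c p) p (betaT η₂)
      (η₂ (p (Sum.inl y)) * betaX p + 1 / 2 * deriv η₂ (p (Sum.inl y)) * alpha p
        + (p (bj v 1 0) * rotZ p
          + p (bj v 0 0) * (p (vj u 0 0) - p (bj u 0 1) / p (bj v 0 0) * rotT p))) := by
  obtain ⟨h1, h2, h3, h4, h5⟩ := hp
  have c : ∀ c, HasDD (fun c => (covS J₁ J₂ η₁ η₂).tangent.fieldX c p) p (fun q => q c)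
    ((covS J₁ J₂ η₁ η₂).tangent.fieldX c p) := fun c => .coord c
  have c1 : HasDD _ p (fun q => q (bj v 0 0)) (p (bj v 1 0)) := c (bj v 0 0)
  have c2 := (c (vs 0)).congr_val (tangent_X_zero h5)
  have e₂ := hasDD_eta₂ hJ₂ hη₂ (p := p) (d := 0)
    (ξ := fun c => (covS J₁ J₂ η₁ η₂).tangent.fieldX c p) h2 rfl
  have e₂' := hasDD_eta₂ hJ₂ (contDiffOn_deriv hJ₂ hη₂) (p := p) (d := 0)
    (ξ := fun c => (covS J₁ J₂ η₁ η₂).tangent.fieldX c p) h2 rfl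
  have hh : HasDD (fun c => (covS J₁ J₂ η₁ η₂).tangent.fieldX c p) p (fun _ => (1 / 2 : ℝ)) 0 :=
    .const _
  refine (((e₂.mul (hasDD_beta h4)).add ((hh.mul e₂').mul c2)).add
    (c1.mul hasDD_rotZ_X)).congr_val ?_
  ring

theorem Dy_Dy_roTangent_u (hp : p ∈ (covS J₁ J₂ η₁ η₂).tangent.pts) :
    (covS J₁ J₂ η₁ η₂).tangent.Dy ((covS J₁ J₂ η₁ η₂).tangent.Dy (roTangent η₁ η₂ (Sum.inr u))) p
      = (p (bj u 0 2) * p (bj v 0 0) - p (bj u 0 1) * p (bj v 0 1)) / p (bj v 0 0) ^ 2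
          * roTangent η₁ η₂ (Sum.inr v) p
        + p (bj u 0 1) / p (bj v 0 0)
          * (covS J₁ J₂ η₁ η₂).tangent.Dy (roTangent η₁ η₂ (Sum.inr v)) p
        + p (bj v 0 1) * alphaT η₁ p + p (bj v 0 0)
          * (η₁ (p (Sum.inl x)) * alphaY p + 1 / 2 * deriv η₁ (p (Sum.inl x)) * beta p
            - (p (bj u 0 1) * rotT p
              + p (bj u 0 0) * (p (vj v 0 0) - p (bj v 1 0) / p (bj u 0 0) * rotZ p))) := by
  have hE := isNormal_sysEta hJ₁ hJ₂ hη₁ hη₂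
  have hC := isCovering_tangent_covS hJ₁ hJ₂ hη₁ hη₂
  have hY := hE.tangent.isTangent_fieldY _ hC.isOpen_dom hC.smooth_Y
  have key : ∀ q ∈ (covS J₁ J₂ η₁ η₂).tangent.pts,
      HasDD (fun c => (covS J₁ J₂ η₁ η₂).tangent.fieldY c q) q
        (fun p => p (bj u 0 1) / p (bj v 0 0) * roTangent η₁ η₂ (Sum.inr v) p
          + p (bj v 0 0) * alphaT η₁ p) _ := fun q hq =>
    (((HasDD.coord (bj u 0 1)).div (.coord (bj v 0 0)) hq.1.1.2.2.2.2).mul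
      (.of_smooth (smoothAt_roTangent hJ₁ hJ₂ hη₁ hη₂ hq.1.1 (Sum.inr v)) _)).add
      ((HasDD.coord (bj v 0 0)).mul (hasDD_alphaT hJ₁ hη₁ hq.1.1))
  -- The formula for the first derivative holds on the covering space only; tangency allows a second
  -- differentiation.
  refine (hY.congr (smooth_iterate hY.smooth
    (fun q hq => smoothAt_roTangent hJ₁ hJ₂ hη₁ hη₂ hq.1.1 (Sum.inr u)) 1)
    (fun q hq => (key q hq).smooth)
    (fun q hq => Dy_roTangent_u hJ₁ hJ₂ hη₁ hη₂ hq) p hp).trans ((key p hp).eq.trans ?_)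
  simp only [Cov.Dy_eq, along, Cov.fieldY, Sum.elim_inl, jetY, Function.comp]
  ring

theorem Dx_Dx_roTangent_v (hp : p ∈ (covS J₁ J₂ η₁ η₂).tangent.pts) :
    (covS J₁ J₂ η₁ η₂).tangent.Dx ((covS J₁ J₂ η₁ η₂).tangent.Dx (roTangent η₁ η₂ (Sum.inr v))) p
      = (p (bj v 2 0) * p (bj u 0 0) - p (bj v 1 0) * p (bj u 1 0)) / p (bj u 0 0) ^ 2
          * roTangent η₁ η₂ (Sum.inr u) p
        + p (bj v 1 0) / p (bj u 0 0)
          * (covS J₁ J₂ η₁ η₂).tangent.Dx (roTangent η₁ η₂ (Sum.inr u)) p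
        - (p (bj u 1 0) * betaT η₂ p + p (bj u 0 0)
          * (η₂ (p (Sum.inl y)) * betaX p + 1 / 2 * deriv η₂ (p (Sum.inl y)) * alpha p
            + (p (bj v 1 0) * rotZ p
              + p (bj v 0 0) * (p (vj u 0 0) - p (bj u 0 1) / p (bj v 0 0) * rotT p)))) := by
  have hE := isNormal_sysEta hJ₁ hJ₂ hη₁ hη₂
  have hC := isCovering_tangent_covS hJ₁ hJ₂ hη₁ hη₂
  have hX := hE.tangent.isTangent_fieldX _ hC.isOpen_dom hC.smooth_X
  have key : ∀ q ∈ (covS J₁ J₂ η₁ η₂).tangent.pts,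
      HasDD (fun c => (covS J₁ J₂ η₁ η₂).tangent.fieldX c q) q
        (fun p => p (bj v 1 0) / p (bj u 0 0) * roTangent η₁ η₂ (Sum.inr u) p
          - p (bj u 0 0) * betaT η₂ p) _ := fun q hq =>
    (((HasDD.coord (bj v 1 0)).div (.coord (bj u 0 0)) hq.1.1.2.2.2.1).mul
      (.of_smooth (smoothAt_roTangent hJ₁ hJ₂ hη₁ hη₂ hq.1.1 (Sum.inr u)) _)).sub
      ((HasDD.coord (bj u 0 0)).mul (hasDD_betaT hJ₂ hη₂ hq.1.1))
  refine (hX.congr (smooth_iterate hX.smooth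
    (fun q hq => smoothAt_roTangent hJ₁ hJ₂ hη₁ hη₂ hq.1.1 (Sum.inr v)) 1)
    (fun q hq => (key q hq).smooth)
    (fun q hq => Dx_roTangent_v hJ₁ hJ₂ hη₁ hη₂ hq) p hp).trans ((key p hp).eq.trans ?_)
  simp only [Cov.Dx_eq, along, Cov.fieldX, Sum.elim_inl, jetX, Function.comp]

omit hJ₁ hJ₂ hη₁ hη₂ in
theorem jetBase_prol_roTangent (p : TCoord → ℝ) :
    jetBase ((covS J₁ J₂ η₁ η₂).tangent.prol (roTangent η₁ η₂) p) = jetBase (p ∘ Sum.inl) := by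
  funext c
  cases c with
  | x => rfl
  | y => rfl
  | jet a i j => exact congrFun ((covS J₁ J₂ η₁ η₂).tangent.iterate_coord (Sum.inl a) i j) p

/-- Only the two linearized equations have to be verified. Since `lin_F_u` and `lin_F_v` hold for
arbitrary values in place of the jets of (U, V), they apply to the new pair with `alphaT` and
`betaT`. -/
theorem isMorphism_roTangent : (covS J₁ J₂ η₁ η₂).tangent.IsMorphism
    (sysEta J₁ J₂ η₁ η₂).tangent (roTangent η₁ η₂) := by
  have hE := isNormal_sysEta hJ₁ hJ₂ hη₁ hη₂
  refine (isCovering_tangent_covS hJ₁ hJ₂ hη₁ hη₂).isMorphism hE.tangent hE.tangent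
    (fun a p hp => smoothAt_roTangent hJ₁ hJ₂ hη₁ hη₂ hp.1.1 a) (fun p hp => ?_) ?_
  · change jetBase ((covS J₁ J₂ η₁ η₂).tangent.prol (roTangent η₁ η₂) p)
      ∈ (sysEta J₁ J₂ η₁ η₂).dom
    rw [jetBase_prol_roTangent]
    exact hp.1.1
  rintro (a | a) p hp
  · change (sysEta J₁ J₂ η₁ η₂).F a (jetBase _) = 0
    rw [jetBase_prol_roTangent]
    exact hp.1.2 (Sum.inl a) 0 0
  have hq := mem_inf_of_mem_pts hJ₁ hJ₂ hη₁ hη₂ hp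
  obtain ⟨h1, h2, h3, h4, h5⟩ := hq.1
  have h4' : p (bj u 0 0) ≠ 0 := h4
  have h5' : p (bj v 0 0) ≠ 0 := h5
  change dirDeriv (jetVert fun a i j => ((covS J₁ J₂ η₁ η₂).tangent.Dx^[i]
    ((covS J₁ J₂ η₁ η₂).tangent.Dy^[j] (roTangent η₁ η₂ (Sum.inr a)))) p)
    ((sysEta J₁ J₂ η₁ η₂).F a) (jetBase _) = 0
  rw [jetBase_prol_roTangent]
  rcases a with _ | _
  · refine (lin_F_u hJ₁ hJ₂ hη₁ hη₂ hq _ (Dy_roTangent_u hJ₁ hJ₂ hη₁ hη₂ hp)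
      (Dx_roTangent_v hJ₁ hJ₂ hη₁ hη₂ hp) (Dy_Dy_roTangent_u hJ₁ hJ₂ hη₁ hη₂ hp)).2 ?_
    have ha := alphaY_eq hJ₁ hJ₂ hη₁ hη₂ hp
    change (η₂ (p (Sum.inl y)) - η₁ (p (Sum.inl x))) * _
      = 1 / 2 * deriv η₁ (p (Sum.inl x)) * betaT η₂ p
        - 1 / 2 * deriv η₂ (p (Sum.inl y)) * alphaT η₁ p
        - p (bj u 0 0) * roTangent η₁ η₂ (Sum.inr v) p
        - p (bj v 0 0) * roTangent η₁ η₂ (Sum.inr u) p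
    rw [roTangent_u, roTangent_v, alphaT, betaT]
    have hu : p (bj v 0 0) * (p (bj u 0 1) / p (bj v 0 0)) = p (bj u 0 1) := by field_simp
    -- The terms with S₀ cancel between `alphaT` and `betaT`; what remains is η₁ times the
    -- linearized equation for (U, V).
    linear_combination η₁ (p (Sum.inl x)) * ha
      + (η₂ (p (Sum.inl y)) - η₁ (p (Sum.inl x))) * rotT p * hu
  · refine (lin_F_v hJ₁ hJ₂ hη₁ hη₂ hq _ (Dy_roTangent_u hJ₁ hJ₂ hη₁ hη₂ hp)
      (Dx_roTangent_v hJ₁ hJ₂ hη₁ hη₂ hp) (Dx_Dx_roTangent_v hJ₁ hJ₂ hη₁ hη₂ hp)).2 ?_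
    have hb := betaX_eq hJ₁ hJ₂ hη₁ hη₂ hp
    change (η₂ (p (Sum.inl y)) - η₁ (p (Sum.inl x))) * _
      = 1 / 2 * deriv η₁ (p (Sum.inl x)) * betaT η₂ p
        - 1 / 2 * deriv η₂ (p (Sum.inl y)) * alphaT η₁ p
        - p (bj u 0 0) * roTangent η₁ η₂ (Sum.inr v) p
        - p (bj v 0 0) * roTangent η₁ η₂ (Sum.inr u) p
    rw [roTangent_u, roTangent_v, alphaT, betaT]
    have hv : p (bj u 0 0) * (p (bj v 1 0) / p (bj u 0 0)) = p (bj v 1 0) := by field_simp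
    linear_combination η₂ (p (Sum.inl y)) * hb
      - (η₂ (p (Sum.inl y)) - η₁ (p (Sum.inl x))) * rotZ p * hv

end RecursionOperator

/-! ### Leading terms under repeated differentiation -/

section Levels

variable {I : Type*} {U : Set (I → ℝ)} {lev : I → ℕ} {n : ℕ}

/-- If f = e p_c + (lower), then Z f = e p_c' + (Z e) p_c + Z(lower), and the last two terms have
level at most `n`. -/
theorem DepLT.along_sub_mul {Z : I → (I → ℝ) → ℝ} (hU : IsOpen U)
    (hZ : ∀ c, lev c < n → DepLT U lev (n + 1) (Z c)) {e f : (I → ℝ) → ℝ}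
    (he : ∀ p ∈ U, SmoothAt e p) (hf : ∀ p ∈ U, SmoothAt f p) (hen : DepLT U lev n e) {c c' : I}
    (hc : lev c < n + 1) (hcc : ∀ p, Z c p = p c') (h : DepLT U lev n fun p => f p - e p * p c) :
    DepLT U lev (n + 1) fun p => SDeform.along Z f p - e p * p c' := by
  have hs : ∀ p ∈ U, SmoothAt (fun p => f p - e p * p c) p := fun p hp =>
    (hf p hp).sub ((he p hp).mul (smoothAt_coord c p))
  have h1 := hen.along hU he hZ
  have h2 := h.along hU hs hZ
  have key : ∀ p ∈ U, SDeform.along Z f p - e p * p c'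
      = SDeform.along Z e p * p c + SDeform.along Z (fun p => f p - e p * p c) p := by
    intro p hp
    have h3 := ((HasDD.of_smooth (hf p hp) fun i => Z i p).sub
      ((HasDD.of_smooth (he p hp) fun i => Z i p).mul (.coord c))).eq
    have h4 : SDeform.along Z (fun p => f p - e p * p c) p = SDeform.along Z f p
      - (SDeform.along Z e p * p c + e p * Z c p) := h3
    rw [h4, hcc]
    ring
  intro p hp q hq hpq
  change SDeform.along Z f p - e p * p c' = SDeform.along Z f q - e q * q c'
  rw [key p hp, key q hq, h1 p hp q hq hpq, h2 p hp q hq hpq, hpq c hc]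

end Levels

/-! ### Inverting the recursion operator when η₁ and η₂ have no zeros -/

section Inverse

/-- The recursion operator is triangular with respect to these levels. -/
def tlev : TCoord → ℕ
  | Sum.inl (jet (Sum.inr _) i j) => i + j + 1
  | Sum.inl _ => 0
  | Sum.inr (Sum.inl _) => 0
  -- S₁ and S₂ enter the operator itself beside η₁U and η₂V, so they must lie below U and V. Their
  -- derivatives contain S₀, U, V, of level 1, and those of S₀ contain first-order jets, of level 2.
  -- So total derivatives raise the level by at most one.
  | Sum.inr (Sum.inr w) => if w = 0 then 1 else 0

/-- The leading coefficient of the recursion operator. -/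
def etaOf (η₁ η₂ : ℝ → ℝ) : Dep → (TCoord → ℝ) → ℝ
  | Dep.u, p => η₁ (p (Sum.inl x))
  | Dep.v, p => η₂ (p (Sum.inl y))

/-- The region of the ambient space of the tangent covering over the domain of the system. -/
def regionT (J₁ J₂ : Set ℝ) (η₁ η₂ : ℝ → ℝ) : Set (TCoord → ℝ) :=
  {p | jetBase (p ∘ Sum.inl) ∈ (sysEta J₁ J₂ η₁ η₂).dom}

variable {J₁ J₂ : Set ℝ} {η₁ η₂ : ℝ → ℝ}

theorem jetBase_congr {p q : TCoord → ℝ} (h : ∀ c, tlev c = 0 → p c = q c) :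
    jetBase (p ∘ Sum.inl) = jetBase (q ∘ Sum.inl) := by
  funext c
  cases c <;> exact h _ rfl

theorem smooth_tangent_fieldX : ∀ c, ∀ p ∈ regionT J₁ J₂ η₁ η₂,
    SmoothAt ((covS J₁ J₂ η₁ η₂).tangent.fieldX c) p := by
  rintro (c | w) p hp
  · exact Cov.smoothAt_comp_inl (smoothAt_jetX c _)
  · exact Cov.smoothAt_tangent_X (fun w => smoothAt_covS_X hp.2.2.2.2 w) w

theorem smooth_tangent_fieldY : ∀ c, ∀ p ∈ regionT J₁ J₂ η₁ η₂,
    SmoothAt ((covS J₁ J₂ η₁ η₂).tangent.fieldY c) p := by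
  rintro (c | w) p hp
  · exact Cov.smoothAt_comp_inl (smoothAt_jetY c _)
  · exact Cov.smoothAt_tangent_Y (fun w => smoothAt_covS_Y hp.2.2.2.1 w) w

theorem depLT_tangent_fieldX {n : ℕ} (c : TCoord) (hc : tlev c < n) :
    DepLT (regionT J₁ J₂ η₁ η₂) tlev (n + 1) ((covS J₁ J₂ η₁ η₂).tangent.fieldX c) := by
  have e0 : tlev (vs 0) = 1 := rfl
  have e1 : tlev (vj u 0 0) = 1 := rfl
  intro p hp q hq h
  have hb : ∀ c, tlev c = 0 → p c = q c := fun c hc => h c (by omega)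
  rcases c with (_ | _ | ⟨a | a, i, j⟩) | w | w
  · rfl
  · rfl
  · exact hb (bj a (i + 1) j) rfl
  · exact h (vj a (i + 1) j) (by simp only [tlev] at *; omega)
  · have : Cov.tangentBase p = Cov.tangentBase q := by
      funext c
      rcases c with (_ | _ | _) | _ <;> exact hb _ rfl
    exact congrArg ((covS J₁ J₂ η₁ η₂).X w) this
  · fin_cases w
    · have hn : 1 < n := hc
      refine (tangent_X_zero hp.2.2.2.2).trans (Eq.trans ?_ (tangent_X_zero hq.2.2.2.2).symm)
      rw [alpha, alpha, hb (bj v 0 0) rfl, hb (bj u 0 1) rfl,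
        h (vj u 0 1) (by simp only [tlev]; omega), h (vj v 0 0) (by simp only [tlev]; omega)]
    · refine tangent_X_one.trans (Eq.trans ?_ tangent_X_one.symm)
      rw [hb (bs 0) rfl, h (vs 0) (by omega), hb (bj u 0 0) rfl, h (vj u 0 0) (by omega)]
    · refine tangent_X_two.trans (Eq.trans ?_ tangent_X_two.symm)
      rw [hb (bs 0) rfl, h (vs 0) (by omega), hb (bj u 0 0) rfl, h (vj u 0 0) (by omega)]

theorem depLT_tangent_fieldY {n : ℕ} (c : TCoord) (hc : tlev c < n) :
    DepLT (regionT J₁ J₂ η₁ η₂) tlev (n + 1) ((covS J₁ J₂ η₁ η₂).tangent.fieldY c) := by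
  have e0 : tlev (vs 0) = 1 := rfl
  have e1 : tlev (vj v 0 0) = 1 := rfl
  intro p hp q hq h
  have hb : ∀ c, tlev c = 0 → p c = q c := fun c hc => h c (by omega)
  rcases c with (_ | _ | ⟨a | a, i, j⟩) | w | w
  · rfl
  · rfl
  · exact hb (bj a i (j + 1)) rfl
  · exact h (vj a i (j + 1)) (by simp only [tlev] at *; omega)
  · have : Cov.tangentBase p = Cov.tangentBase q := by
      funext c
      rcases c with (_ | _ | _) | _ <;> exact hb _ rfl
    exact congrArg ((covS J₁ J₂ η₁ η₂).Y w) this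
  · fin_cases w
    · have hn : 1 < n := hc
      refine (tangent_Y_zero hp.2.2.2.1).trans (Eq.trans ?_ (tangent_Y_zero hq.2.2.2.1).symm)
      rw [beta, beta, hb (bj u 0 0) rfl, hb (bj v 1 0) rfl,
        h (vj v 1 0) (by simp only [tlev]; omega), h (vj u 0 0) (by simp only [tlev]; omega)]
    · refine tangent_Y_one.trans (Eq.trans ?_ tangent_Y_one.symm)
      rw [hb (bs 0) rfl, h (vs 0) (by omega), hb (bj v 0 0) rfl, h (vj v 0 0) (by omega)]
    · refine tangent_Y_two.trans (Eq.trans ?_ tangent_Y_two.symm)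
      rw [hb (bs 0) rfl, h (vs 0) (by omega), hb (bj v 0 0) rfl, h (vj v 0 0) (by omega)]

variable (hJ₁ : IsOpen J₁) (hJ₂ : IsOpen J₂) (hη₁ : ContDiffOn ℝ ∞ η₁ J₁)
  (hη₂ : ContDiffOn ℝ ∞ η₂ J₂)

theorem depLT_etaOf (a : Dep) (n : ℕ) :
    DepLT (regionT J₁ J₂ η₁ η₂) tlev (n + 1) (etaOf η₁ η₂ a) := by
  intro p _ q _ h
  cases a
  · exact congrArg η₁ (h (Sum.inl x) n.succ_pos)
  · exact congrArg η₂ (h (Sum.inl y) n.succ_pos)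

include hJ₁ hJ₂ hη₁ hη₂

theorem isOpen_regionT : IsOpen (regionT J₁ J₂ η₁ η₂) :=
  (isNormal_sysEta hJ₁ hJ₂ hη₁ hη₂).isOpen_dom.preimage
    (continuous_pi fun c => continuous_apply (Sum.inl (c.map Sum.inl)))

theorem smooth_etaOf (a : Dep) : ∀ p ∈ regionT J₁ J₂ η₁ η₂, SmoothAt (etaOf η₁ η₂ a) p := by
  intro p hp
  cases a
  · exact (smoothAt_coord (Sum.inl x) p).scalar (eventually_contDiffAt hJ₁ hη₁ hp.1)
  · exact (smoothAt_coord (Sum.inl y) p).scalar (eventually_contDiffAt hJ₂ hη₂ hp.2.1)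

theorem smooth_prol_roTangent (a : Dep) (i j : ℕ) : ∀ p ∈ regionT J₁ J₂ η₁ η₂,
    SmoothAt (fun p => (covS J₁ J₂ η₁ η₂).tangent.prol (roTangent η₁ η₂) p (jet (Sum.inr a) i j))
      p :=
  smooth_iterate smooth_tangent_fieldX (smooth_iterate smooth_tangent_fieldY
    (fun _ hp => smoothAt_roTangent hJ₁ hJ₂ hη₁ hη₂ hp (Sum.inr a)) j) i

/-- The prolonged operator is triangular with diagonal entries η₁ and η₂, since derivatives falling
on these factors leave lower jets of U, V. This holds on the open region, off the equation too,
where `DepLT` can be differentiated. -/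
theorem depLT_prol_sub (a : Dep) (i j : ℕ) : DepLT (regionT J₁ J₂ η₁ η₂) tlev (i + j + 1) fun p =>
    (covS J₁ J₂ η₁ η₂).tangent.prol (roTangent η₁ η₂) p (jet (Sum.inr a) i j)
      - etaOf η₁ η₂ a p * p (vj a i j) := by
  have hU := isOpen_regionT hJ₁ hJ₂ hη₁ hη₂
  induction i with
  | zero =>
    induction j with
    | zero =>
      intro p hp q hq h
      have hb : ∀ c, tlev c = 0 → p c = q c := fun c hc => h c (by omega)
      cases a
      · change roTangent η₁ η₂ (Sum.inr u) p - η₁ (p (Sum.inl x)) * p (vj u 0 0)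
          = roTangent η₁ η₂ (Sum.inr u) q - η₁ (q (Sum.inl x)) * q (vj u 0 0)
        rw [roTangent_u, roTangent_u, rotT, rotZ, rotT, rotZ, hb (Sum.inl x) rfl,
          hb (Sum.inl y) rfl, hb (bs 0) rfl, hb (vs 1) rfl, hb (vs 2) rfl, hb (bj u 0 1) rfl,
          hb (bj v 0 0) rfl]
        ring
      · change roTangent η₁ η₂ (Sum.inr v) p - η₂ (p (Sum.inl y)) * p (vj v 0 0)
          = roTangent η₁ η₂ (Sum.inr v) q - η₂ (q (Sum.inl y)) * q (vj v 0 0)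
        rw [roTangent_v, roTangent_v, rotT, rotZ, rotT, rotZ, hb (Sum.inl x) rfl,
          hb (Sum.inl y) rfl, hb (bs 0) rfl, hb (vs 1) rfl, hb (vs 2) rfl, hb (bj v 1 0) rfl,
          hb (bj u 0 0) rfl]
        ring
    | succ j ih =>
      have := DepLT.along_sub_mul hU (Z := (covS J₁ J₂ η₁ η₂).tangent.fieldY)
        (fun c hc => depLT_tangent_fieldY c hc) (smooth_etaOf hJ₁ hJ₂ hη₁ hη₂ a)
        (smooth_prol_roTangent hJ₁ hJ₂ hη₁ hη₂ a 0 j) (depLT_etaOf a _)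
        (by simp only [tlev]; omega) (c' := vj a 0 (j + 1)) (fun _ => rfl) ih
      intro p hp q hq h
      have h1 := this p hp q hq fun c hc => h c (by omega)
      simp only [Cov.prol, Function.iterate_succ_apply', Function.iterate_zero, id] at h1 ⊢
      exact h1
  | succ i ih =>
    have := DepLT.along_sub_mul hU (Z := (covS J₁ J₂ η₁ η₂).tangent.fieldX)
      (fun c hc => depLT_tangent_fieldX c hc) (smooth_etaOf hJ₁ hJ₂ hη₁ hη₂ a)
      (smooth_prol_roTangent hJ₁ hJ₂ hη₁ hη₂ a i j) (depLT_etaOf a _)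
      (by simp only [tlev]; omega) (c' := vj a (i + 1) j) (fun _ => rfl) ih
    intro p hp q hq h
    have h1 := this p hp q hq fun c hc => h c (by omega)
    simp only [Cov.prol, Function.iterate_succ_apply'] at h1 ⊢
    exact h1

omit hJ₁ hJ₂ hη₁ hη₂ in
open Classical in
/-- The point `p` with recursion-operator image and nonlocal variables given by `r` is a fixed
point of this map. -/
def backT (J₁ J₂ : Set ℝ) (η₁ η₂ : ℝ → ℝ) (r p : TCoord → ℝ) : TCoord → ℝ
  | Sum.inl (jet (Sum.inr a) i j) =>
    if (leadEta a).1 ≤ i ∧ (leadEta a).2 ≤ j then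
      (sysEta J₁ J₂ η₁ η₂).tangent.solved (Sum.elim leadEta leadEta) (Sum.inr a) i j (p ∘ Sum.inl)
    -- Solves r = η p + (remainder) for the coordinate of `p`; the remainder involves `p` at lower
    -- levels only. Dividing is legitimate where η₁ and η₂ do not vanish.
    else (r (vj a i j) - ((covS J₁ J₂ η₁ η₂).tangent.prol (roTangent η₁ η₂) p (jet (Sum.inr a) i j)
      - etaOf η₁ η₂ a p * p (vj a i j))) / etaOf η₁ η₂ a p
  | c => r c

omit hJ₁ hJ₂ hη₁ hη₂ in
theorem backT_of_solved {a : Dep} {i j : ℕ} (h : (leadEta a).1 ≤ i ∧ (leadEta a).2 ≤ j)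
    (r p : TCoord → ℝ) : backT J₁ J₂ η₁ η₂ r p (vj a i j)
      = (sysEta J₁ J₂ η₁ η₂).tangent.solved (Sum.elim leadEta leadEta) (Sum.inr a) i j
        (p ∘ Sum.inl) := if_pos h

omit hJ₁ hJ₂ hη₁ hη₂ in
theorem backT_of_not_solved {a : Dep} {i j : ℕ} (h : ¬ ((leadEta a).1 ≤ i ∧ (leadEta a).2 ≤ j))
    (r p : TCoord → ℝ) : backT J₁ J₂ η₁ η₂ r p (vj a i j)
      = (r (vj a i j) - ((covS J₁ J₂ η₁ η₂).tangent.prol (roTangent η₁ η₂) p (jet (Sum.inr a) i j)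
        - etaOf η₁ η₂ a p * p (vj a i j))) / etaOf η₁ η₂ a p := if_neg h

omit hJ₁ hJ₂ hη₁ hη₂ in
theorem etaOf_ne_zero (h₁ : ∀ t ∈ J₁, η₁ t ≠ 0) (h₂ : ∀ t ∈ J₂, η₂ t ≠ 0) (a : Dep)
    {p : TCoord → ℝ} (hp : p ∈ regionT J₁ J₂ η₁ η₂) : etaOf η₁ η₂ a p ≠ 0 := by
  cases a
  · exact h₁ _ hp.1
  · exact h₂ _ hp.2.1

omit hJ₁ hJ₂ hη₁ hη₂ in
theorem jetBase_backT (r p : TCoord → ℝ) :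
    jetBase (backT J₁ J₂ η₁ η₂ r p ∘ Sum.inl) = jetBase (r ∘ Sum.inl) := by
  funext c
  cases c <;> rfl

theorem exists_inverse (h₁ : ∀ t ∈ J₁, η₁ t ≠ 0) (h₂ : ∀ t ∈ J₂, η₂ t ≠ 0) :
    ∃ Ψ : (TCoord → ℝ) → TCoord → ℝ, ∀ r ∈ regionT J₁ J₂ η₁ η₂, Ψ r ∈ regionT J₁ J₂ η₁ η₂ ∧
      backT J₁ J₂ η₁ η₂ r (Ψ r) = Ψ r ∧ (∀ c, SmoothAt (fun r => Ψ r c) r) ∧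
      ∀ p ∈ regionT J₁ J₂ η₁ η₂, backT J₁ J₂ η₁ η₂ r p = p → p = Ψ r := by
  have hE := isNormal_sysEta hJ₁ hJ₂ hη₁ hη₂
  refine exists_fixedPoint (lev := tlev) 1 (backT J₁ J₂ η₁ η₂) ?_ ?_ ?_ ?_ (fun r => r)
    (fun r hr => hr) fun r _ c => smoothAt_coord c r
  · intro p hp p' h
    change jetBase _ ∈ (sysEta J₁ J₂ η₁ η₂).dom
    rw [← jetBase_congr fun c hc => h c (by omega)]
    exact hp
  · intro r hr p _
    change jetBase _ ∈ (sysEta J₁ J₂ η₁ η₂).dom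
    rw [jetBase_backT]
    exact hr
  · intro r _ c
    rcases c with (_ | _ | ⟨a | a, i, j⟩) | w
    · exact fun _ _ _ _ _ => rfl
    · exact fun _ _ _ _ _ => rfl
    · exact fun _ _ _ _ _ => rfl
    · intro p hp q hq h
      by_cases hl : (leadEta a).1 ≤ i ∧ (leadEta a).2 ≤ j
      · refine (backT_of_solved hl r p).trans (Eq.trans ?_ (backT_of_solved hl r q).symm)
        refine hE.tangent.depLT_solved (a := Sum.inr a) hl.1 hl.2 _ hp _ hq fun c hc => h _ ?_
        change _ < i + j + 1
        rcases c with _ | _ | ⟨b | b, k, l⟩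
        · exact Nat.succ_pos _
        · exact Nat.succ_pos _
        · exact Nat.succ_pos _
        · exact Nat.succ_lt_succ hc
      · refine (backT_of_not_solved hl r p).trans (Eq.trans ?_ (backT_of_not_solved hl r q).symm)
        have h1 := depLT_prol_sub hJ₁ hJ₂ hη₁ hη₂ a i j p hp q hq h
        have h2 := depLT_etaOf a (i + j) p hp q hq h
        simp only at h1
        rw [h1, h2]
    · exact fun _ _ _ _ _ => rfl
  · intro r _ m hm hmr c
    rcases c with (_ | _ | ⟨a | a, i, j⟩) | w
    · exact smoothAt_coord _ _
    · exact smoothAt_coord _ _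
    · exact smoothAt_coord _ _
    · by_cases hl : (leadEta a).1 ≤ i ∧ (leadEta a).2 ≤ j
      · refine SmoothAt.congr ?_ (.of_forall fun r => backT_of_solved hl r (m r))
        exact SmoothAt.comp (m := fun r => m r ∘ Sum.inl)
          (hE.tangent.smooth_solved (Sum.inr a) i j _ hmr) fun c => hm (Sum.inl c)
      · refine SmoothAt.congr ?_ (.of_forall fun r => backT_of_not_solved hl r (m r))
        have he : SmoothAt (fun r => etaOf η₁ η₂ a (m r)) r :=
          (smooth_etaOf hJ₁ hJ₂ hη₁ hη₂ a _ hmr).comp hm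
        have hpr := (smooth_prol_roTangent hJ₁ hJ₂ hη₁ hη₂ a i j _ hmr).comp hm
        exact ((smoothAt_coord (vj a i j) r).sub (hpr.sub (he.mul (hm (vj a i j))))).div he
          (etaOf_ne_zero h₁ h₂ a hmr)
    · exact smoothAt_coord _ _

/-- The operator leaves `u`, `v` unchanged, and for given s_i, S_i it is invertible in the jets of
U, V. Hence s_i, S_i themselves are fibre coordinates for the new projection. -/
theorem isCoveringOver_roTangent (h₁ : ∀ t ∈ J₁, η₁ t ≠ 0) (h₂ : ∀ t ∈ J₂, η₂ t ≠ 0) :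
    (covS J₁ J₂ η₁ η₂).tangent.IsCoveringOver (sysEta J₁ J₂ η₁ η₂).tangent (roTangent η₁ η₂)
      (Fin 3 ⊕ Fin 3) := by
  have hE := isNormal_sysEta hJ₁ hJ₂ hη₁ hη₂
  have hM := isMorphism_roTangent hJ₁ hJ₂ hη₁ hη₂
  obtain ⟨Ψ, hΨ⟩ := exists_inverse hJ₁ hJ₂ hη₁ hη₂ h₁ h₂
  refine ⟨hM, fun n p => p (Sum.inr n), fun c r => Ψ r c, fun n p _ => smoothAt_coord _ _,
    fun c r hr => (hΨ r hr.1).2.2.1 c, ?_, ?_⟩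
  · intro p hp
    refine ((hΨ (Sum.elim ((covS J₁ J₂ η₁ η₂).tangent.prol (roTangent η₁ η₂) p)
      fun n => p (Sum.inr n)) (hM.mem_inf p hp).1).2.2.2 p hp.1.1 ?_).symm
    funext c
    rcases c with (_ | _ | ⟨a | a, i, j⟩) | w
    · rfl
    · rfl
    · exact congrFun ((covS J₁ J₂ η₁ η₂).tangent.iterate_coord (Sum.inl a) i j) p
    · by_cases hl : (leadEta a).1 ≤ i ∧ (leadEta a).2 ≤ j
      · exact (backT_of_solved hl _ p).trans
          (((IsNormal.mem_inf_iff (Sum.elim leadEta leadEta)).1 hp.1).2 (Sum.inr a) i j hl.1 hl.2)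
      · refine (backT_of_not_solved hl _ p).trans ?_
        rw [div_eq_iff (etaOf_ne_zero h₁ h₂ a hp.1.1)]
        simp only [Sum.elim_inl]
        ring
    · rfl
  · intro r hr
    obtain ⟨hU, hfix, -, -⟩ := hΨ r hr.1
    have hb : jetBase (Ψ r ∘ Sum.inl) = jetBase (r ∘ Sum.inl) := by
      rw [← hfix, jetBase_backT]
    have hpts : Ψ r ∈ (covS J₁ J₂ η₁ η₂).tangent.pts := by
      refine ⟨(IsNormal.mem_inf_iff (Sum.elim leadEta leadEta)).2 ⟨hU, ?_⟩, trivial⟩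
      rintro (a | a) i j hi hj
      · rw [PDESystem.solved, hE.cons_tangent_inl a _ _ _ hU, hb, sub_eq_self]
        exact (hE.jetBase_mem_inf hr).2 a _ _
      · exact (backT_of_solved ⟨hi, hj⟩ r (Ψ r)).symm.trans (congrFun hfix (vj a i j))
    refine ⟨hpts, ?_⟩
    -- Both points lie on the prolonged tangent system, so comparing parametric coordinates is
    -- enough; there the fixed-point equation gives equality.
    have hprol : (covS J₁ J₂ η₁ η₂).tangent.prol (roTangent η₁ η₂) (Ψ r) = r ∘ Sum.inl := by
      refine hE.tangent.inf_ext (hM.mem_inf _ hpts) hr (congrFun hfix (Sum.inl x)).symm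
        (congrFun hfix (Sum.inl y)).symm ?_
      rintro (a | a) i j hl
      · exact (congrFun ((covS J₁ J₂ η₁ η₂).tangent.iterate_coord (Sum.inl a) i j) (Ψ r)).trans
          (congrFun hfix (bj a i j)).symm
      · have h := (backT_of_not_solved hl r (Ψ r)).symm.trans (congrFun hfix (vj a i j))
        rw [div_eq_iff (etaOf_ne_zero h₁ h₂ a hU)] at h
        change _ = r (vj a i j)
        linarith
    funext c
    rcases c with c | w
    · exact congrFun hprol c
    · exact (congrFun hfix (Sum.inr w)).symm

theorem isBacklundAuto_roTangent (h₁ : ∀ t ∈ J₁, η₁ t ≠ 0) (h₂ : ∀ t ∈ J₂, η₂ t ≠ 0) :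
    (covS J₁ J₂ η₁ η₂).tangent.IsBacklundAuto (roTangent η₁ η₂) (Fin 3 ⊕ Fin 3) :=
  ⟨isCovering_tangent_covS hJ₁ hJ₂ hη₁ hη₂,
    (isCovering_tangent_covS hJ₁ hJ₂ hη₁ hη₂).isCoveringOver_depVar
      (isNormal_sysEta hJ₁ hJ₂ hη₁ hη₂).tangent rfl,
    isCoveringOver_roTangent hJ₁ hJ₂ hη₁ hη₂ h₁ h₂⟩

end Inverse

/-! ### Adjoined variations as a pullback of the tangent covering -/

section AdjoinVariations

variable {A W W' : Type*} {E : PDESystem A A} {lead : A → ℕ × ℕ}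

namespace Cov

theorem smoothAt_toBase (c : JetCoord A ⊕ W) (p : JetCoord A ⊕ (W ⊕ W') → ℝ) :
    SmoothAt (fun p => toBase p c) p := by
  rcases c with c | w <;> exact smoothAt_coord _ _

theorem extend_Dx (B : Cov E W) (dom : Set (JetCoord A ⊕ (W ⊕ W') → ℝ))
    (X Y : W' → (JetCoord A ⊕ (W ⊕ W') → ℝ) → ℝ) {f : (JetCoord A ⊕ W → ℝ) → ℝ}
    {p : JetCoord A ⊕ (W ⊕ W') → ℝ} (hf : SmoothAt f (toBase p)) :
    (B.extend dom X Y).Dx (fun p => f (toBase p)) p = B.Dx f (toBase p) := by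
  refine along_comp (fun c => smoothAt_toBase c p) (fun c => ?_) hf
  rcases c with c | w
  · exact (HasDD.coord (Sum.inl c)).eq
  · exact (HasDD.coord (Sum.inr (Sum.inl w))).eq

theorem extend_Dy (B : Cov E W) (dom : Set (JetCoord A ⊕ (W ⊕ W') → ℝ))
    (X Y : W' → (JetCoord A ⊕ (W ⊕ W') → ℝ) → ℝ) {f : (JetCoord A ⊕ W → ℝ) → ℝ}
    {p : JetCoord A ⊕ (W ⊕ W') → ℝ} (hf : SmoothAt f (toBase p)) :
    (B.extend dom X Y).Dy (fun p => f (toBase p)) p = B.Dy f (toBase p) := by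
  refine along_comp (fun c => smoothAt_toBase c p) (fun c => ?_) hf
  rcases c with c | w
  · exact (HasDD.coord (Sum.inl c)).eq
  · exact (HasDD.coord (Sum.inr (Sum.inl w))).eq

/-- The map from the covering with adjoined variations to the tangent covering. -/
def toTangent (C : Cov E (W ⊕ W')) (φ : A → (JetCoord A ⊕ (W ⊕ W') → ℝ) → ℝ)
    (p : JetCoord A ⊕ ((W ⊕ W') ⊕ W) → ℝ) : JetCoord (A ⊕ A) ⊕ (W ⊕ W) → ℝ :=
  Sum.elim (C.prol (Sum.elim depVar φ) (toBase p))
    (Sum.elim (fun w => p (Sum.inr (Sum.inl (Sum.inl w)))) fun w => p (Sum.inr (Sum.inr w)))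

theorem jetBase_prol (C : Cov E W) (φ : A → (JetCoord A ⊕ W → ℝ) → ℝ) (p : JetCoord A ⊕ W → ℝ) :
    jetBase (C.prol (Sum.elim depVar φ) p) = p ∘ Sum.inl := by
  funext c
  cases c with
  | x => rfl
  | y => rfl
  | jet a i j => exact congrFun (C.iterate_coord a i j) p

theorem tangentBase_toTangent (C : Cov E (W ⊕ W')) (φ : A → (JetCoord A ⊕ (W ⊕ W') → ℝ) → ℝ)
    (p : JetCoord A ⊕ ((W ⊕ W') ⊕ W) → ℝ) :
    tangentBase (toTangent C φ p) = toBase (toBase p) := by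
  funext c
  rcases c with c | w
  · exact congrFun (C.jetBase_prol φ (toBase p)) c
  · rfl

/-- The shadow condition is exactly the linearized part of the tangent system at the prolongation of
`φ`; the other equations hold on the base. -/
theorem IsShadow.isMorphism {C : Cov E W} {φ : A → (JetCoord A ⊕ W → ℝ) → ℝ}
    (hφ : C.IsShadow φ) (hC : C.IsCovering) (hE : IsNormal E lead) :
    C.IsMorphism E.tangent (Sum.elim depVar φ) := by
  refine hC.isMorphism hE hE.tangent ?_ (fun p hp => ?_) ?_
  · rintro (a | a) p hp
    · exact smoothAt_coord _ _
    · exact hφ.smooth a p hp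
  · change jetBase _ ∈ E.dom
    rw [jetBase_prol]
    exact hp.1.1
  · rintro (a | a) p hp
    · change E.F a (jetBase _) = 0
      rw [jetBase_prol]
      exact hp.1.2 a 0 0
    · change dirDeriv (jetVert _) (E.F a) (jetBase _) = 0
      rw [jetBase_prol]
      exact hφ.lin a p hp

section

variable {B : Cov E W} {dom : Set (JetCoord A ⊕ (W ⊕ W') → ℝ)}
  {X Y : W' → (JetCoord A ⊕ (W ⊕ W') → ℝ) → ℝ} {φ : A → (JetCoord A ⊕ (W ⊕ W') → ℝ) → ℝ}

theorem adjoinVariations_X (w : W) (p : JetCoord A ⊕ ((W ⊕ W') ⊕ W) → ℝ) :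
    (adjoinVariations B (B.extend dom X Y) φ).X (Sum.inr w) p
      = B.tangent.X (Sum.inr w) (toTangent (B.extend dom X Y) φ p) := by
  change _ = dirDeriv _ _ (tangentBase _)
  rw [tangentBase_toTangent]
  rfl

theorem adjoinVariations_Y (w : W) (p : JetCoord A ⊕ ((W ⊕ W') ⊕ W) → ℝ) :
    (adjoinVariations B (B.extend dom X Y) φ).Y (Sum.inr w) p
      = B.tangent.Y (Sum.inr w) (toTangent (B.extend dom X Y) φ p) := by
  change _ = dirDeriv _ _ (tangentBase _)
  rw [tangentBase_toTangent]
  rfl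

variable (hE : IsNormal E lead) (hC : (B.extend dom X Y).IsCovering)
  (hφ : (B.extend dom X Y).IsShadow φ)

theorem toBase_mem_pts {p : JetCoord A ⊕ ((W ⊕ W') ⊕ W) → ℝ}
    (hp : p ∈ (adjoinVariations B (B.extend dom X Y) φ).pts) :
    toBase p ∈ (B.extend dom X Y).pts :=
  ⟨hp.1, hp.2.1⟩

include hE hC hφ

theorem toTangent_mem_pts {p : JetCoord A ⊕ ((W ⊕ W') ⊕ W) → ℝ}
    (hp : p ∈ (adjoinVariations B (B.extend dom X Y) φ).pts) :
    toTangent (B.extend dom X Y) φ p ∈ B.tangent.pts := by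
  refine ⟨(hφ.isMorphism hC hE).mem_inf _ (toBase_mem_pts hp), ?_⟩
  change tangentBase _ ∈ B.dom
  rw [tangentBase_toTangent]
  exact hp.2.1.1

theorem smoothAt_toTangent (c : JetCoord (A ⊕ A) ⊕ (W ⊕ W))
    {p : JetCoord A ⊕ ((W ⊕ W') ⊕ W) → ℝ}
    (hp : p ∈ (adjoinVariations B (B.extend dom X Y) φ).pts) :
    SmoothAt (fun p => toTangent (B.extend dom X Y) φ p c) p := by
  have hX := hE.isTangent_fieldX _ hC.isOpen_dom hC.smooth_X
  have hY := hE.isTangent_fieldY _ hC.isOpen_dom hC.smooth_Y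
  have hs := (hφ.isMorphism hC hE).smooth
  rcases c with (_ | _ | ⟨a, i, j⟩) | w | w
  · exact smoothAt_coord _ _
  · exact smoothAt_coord _ _
  · exact (smooth_iterate hX.smooth (smooth_iterate hY.smooth (hs a) j) i _
      (toBase_mem_pts hp)).comp fun c => smoothAt_toBase c p
  · exact smoothAt_coord _ _
  · exact smoothAt_coord _ _

theorem smoothAt_prol (c : JetCoord (A ⊕ A)) {p : JetCoord A ⊕ (W ⊕ W') → ℝ}
    (hp : p ∈ (B.extend dom X Y).pts) :
    SmoothAt (fun p => (B.extend dom X Y).prol (Sum.elim depVar φ) p c) p := by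
  have hX := hE.isTangent_fieldX _ hC.isOpen_dom hC.smooth_X
  have hY := hE.isTangent_fieldY _ hC.isOpen_dom hC.smooth_Y
  have hs := (hφ.isMorphism hC hE).smooth
  rcases c with _ | _ | ⟨a, i, j⟩
  · exact smoothAt_coord _ _
  · exact smoothAt_coord _ _
  · exact smooth_iterate hX.smooth (smooth_iterate hY.smooth (hs a) j) i _ hp

/-- With its analogue for `y`, this says that `toTangent` relates the total derivatives, so
identities on the tangent covering pull back. -/
theorem along_fieldX_toTangent (c : JetCoord (A ⊕ A) ⊕ (W ⊕ W))
    {p : JetCoord A ⊕ ((W ⊕ W') ⊕ W) → ℝ}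
    (hp : p ∈ (adjoinVariations B (B.extend dom X Y) φ).pts) :
    along (adjoinVariations B (B.extend dom X Y) φ).fieldX
        (fun p => toTangent (B.extend dom X Y) φ p c) p
      = B.tangent.fieldX c (toTangent (B.extend dom X Y) φ p) := by
  rcases c with c | w | w
  · exact (extend_Dx _ _ _ _ (smoothAt_prol hE hC hφ c (toBase_mem_pts hp))).trans
      ((hφ.isMorphism hC hE).Dx_prol c _ (toBase_mem_pts hp))
  · refine (HasDD.coord (Sum.inr (Sum.inl (Sum.inl w)))).eq.trans ?_
    exact congrArg (B.X w) (tangentBase_toTangent (B.extend dom X Y) φ p).symm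
  · exact (HasDD.coord (Sum.inr (Sum.inr w))).eq.trans (adjoinVariations_X w p)

theorem along_fieldY_toTangent (c : JetCoord (A ⊕ A) ⊕ (W ⊕ W))
    {p : JetCoord A ⊕ ((W ⊕ W') ⊕ W) → ℝ}
    (hp : p ∈ (adjoinVariations B (B.extend dom X Y) φ).pts) :
    along (adjoinVariations B (B.extend dom X Y) φ).fieldY
        (fun p => toTangent (B.extend dom X Y) φ p c) p
      = B.tangent.fieldY c (toTangent (B.extend dom X Y) φ p) := by
  rcases c with c | w | w
  · exact (extend_Dy _ _ _ _ (smoothAt_prol hE hC hφ c (toBase_mem_pts hp))).trans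
      ((hφ.isMorphism hC hE).Dy_prol c _ (toBase_mem_pts hp))
  · refine (HasDD.coord (Sum.inr (Sum.inl (Sum.inl w)))).eq.trans ?_
    exact congrArg (B.Y w) (tangentBase_toTangent (B.extend dom X Y) φ p).symm
  · exact (HasDD.coord (Sum.inr (Sum.inr w))).eq.trans (adjoinVariations_Y w p)

/-- On the old fibre coordinates compatibility is that of the given covering; on the adjoined ones
it is pulled back along `toTangent` from the tangent covering of `B`. -/
theorem IsCovering.adjoinVariations (hT : B.tangent.IsCovering) :
    (adjoinVariations B (B.extend dom X Y) φ).IsCovering where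
  isOpen_dom := (hC.isOpen_dom.preimage (continuous_pi fun c => by
    rcases c with c | w <;> exact continuous_apply _)).inter isOpen_univ
  smooth_X := by
    rintro (w | w) p hp
    · exact (hC.smooth_X w _ (toBase_mem_pts hp)).comp fun c => smoothAt_toBase c p
    · refine SmoothAt.congr ?_ (.of_forall fun p => adjoinVariations_X w p)
      exact (hT.smooth_X (Sum.inr w) _ (toTangent_mem_pts hE hC hφ hp)).comp
        fun c => smoothAt_toTangent hE hC hφ c hp
  smooth_Y := by
    rintro (w | w) p hp
    · exact (hC.smooth_Y w _ (toBase_mem_pts hp)).comp fun c => smoothAt_toBase c p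
    · refine SmoothAt.congr ?_ (.of_forall fun p => adjoinVariations_Y w p)
      exact (hT.smooth_Y (Sum.inr w) _ (toTangent_mem_pts hE hC hφ hp)).comp
        fun c => smoothAt_toTangent hE hC hφ c hp
  comm := by
    rintro (w | w) p hp
    · have hb := toBase_mem_pts hp
      exact (extend_Dx _ _ _ _ (hC.smooth_Y w _ hb)).trans ((hC.comm w _ hb).trans
        (extend_Dy _ _ _ _ (hC.smooth_X w _ hb)).symm)
    · have ht := toTangent_mem_pts hE hC hφ hp
      have hXe : (Cov.adjoinVariations B (B.extend dom X Y) φ).X (Sum.inr w) = _ :=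
        funext (adjoinVariations_X w)
      have hYe : (Cov.adjoinVariations B (B.extend dom X Y) φ).Y (Sum.inr w) = _ :=
        funext (adjoinVariations_Y w)
      rw [hXe, hYe]
      exact (along_comp (fun c => smoothAt_toTangent hE hC hφ c hp)
        (fun c => along_fieldX_toTangent hE hC hφ c hp) (hT.smooth_Y (Sum.inr w) _ ht)).trans
        ((hT.comm (Sum.inr w) _ ht).trans
          (along_comp (fun c => smoothAt_toTangent hE hC hφ c hp)
            (fun c => along_fieldY_toTangent hE hC hφ c hp) (hT.smooth_X (Sum.inr w) _ ht)).symm)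

/-- A morphism from the tangent covering of `B` to the tangent system, identical on the base,
turns shadows in coverings over `B` into shadows. -/
theorem IsMorphism.isShadow_comp (hT : B.tangent.IsCovering)
    {Φ : A ⊕ A → (JetCoord (A ⊕ A) ⊕ (W ⊕ W) → ℝ) → ℝ} (hΦ : B.tangent.IsMorphism E.tangent Φ)
    (hΦl : ∀ a, Φ (Sum.inl a) = depVar (Sum.inl a)) :
    (Cov.adjoinVariations B (B.extend dom X Y) φ).IsShadow
      fun a p => Φ (Sum.inr a) (toTangent (B.extend dom X Y) φ p) := by
  have hC' := IsCovering.adjoinVariations hE hC hφ hT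
  have hX := hE.isTangent_fieldX _ hC'.isOpen_dom hC'.smooth_X
  have hY := hE.isTangent_fieldY _ hC'.isOpen_dom hC'.smooth_Y
  have hsX := smooth_fieldX hT.smooth_X
  have hsY := smooth_fieldY hT.smooth_Y
  have hs : ∀ a, ∀ p ∈ (Cov.adjoinVariations B (B.extend dom X Y) φ).pts,
      SmoothAt (fun p => Φ (Sum.inr a) (toTangent (B.extend dom X Y) φ p)) p := fun a p hp =>
    (hΦ.smooth (Sum.inr a) _ (toTangent_mem_pts hE hC hφ hp)).comp
      fun c => smoothAt_toTangent hE hC hφ c hp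
  refine ⟨hs, fun k p hp => ?_⟩
  have ht := toTangent_mem_pts hE hC hφ hp
  have hit : ∀ a i j, ((Cov.adjoinVariations B (B.extend dom X Y) φ).Dx^[i]
      ((Cov.adjoinVariations B (B.extend dom X Y) φ).Dy^[j]
        fun p => Φ (Sum.inr a) (toTangent (B.extend dom X Y) φ p))) p
      = (B.tangent.Dx^[i] (B.tangent.Dy^[j] (Φ (Sum.inr a))))
        (toTangent (B.extend dom X Y) φ p) := fun a i j =>
    hX.iterate_comp hsX (fun p hp => toTangent_mem_pts hE hC hφ hp)
      (fun c p hp => smoothAt_toTangent hE hC hφ c hp)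
      (fun c p hp => along_fieldX_toTangent hE hC hφ c hp)
      (smooth_iterate hsY (hΦ.smooth (Sum.inr a)) j) (smooth_iterate hY.smooth (hs a) j)
      (hY.iterate_comp hsY (fun p hp => toTangent_mem_pts hE hC hφ hp)
        (fun c p hp => smoothAt_toTangent hE hC hφ c hp)
        (fun c p hp => along_fieldY_toTangent hE hC hφ c hp)
        (hΦ.smooth (Sum.inr a)) (hs a) (fun _ _ => rfl) j) i p hp
  simp only [hit]
  have h0 : dirDeriv (jetVert _) (E.F k) (jetBase (B.tangent.prol Φ _)) = 0 :=
    (hΦ.mem_inf _ ht).2 (Sum.inr k) 0 0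
  -- Since `Φ` does not change the original unknowns, the linearization is taken at the given jet.
  have hb : jetBase (B.tangent.prol Φ (toTangent (B.extend dom X Y) φ p)) = p ∘ Sum.inl := by
    refine Eq.trans ?_ ((B.extend dom X Y).jetBase_prol φ (toBase p))
    funext c
    cases c with
    | x => rfl
    | y => rfl
    | jet a i j =>
      change (B.tangent.Dx^[i] (B.tangent.Dy^[j] (Φ (Sum.inl a)))) _ = _
      rw [hΦl]
      exact congrFun (B.tangent.iterate_coord (Sum.inl a) i j) _
  rw [hb] at h0
  exact h0

end

end Cov

end AdjoinVariations

theorem roShadow_eq {W : Type*} {J₁ J₂ : Set ℝ} {η₁ η₂ : ℝ → ℝ}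
    (C : Cov (sysEta J₁ J₂ η₁ η₂) (Fin 3 ⊕ W))
    (φ : Dep → (JetCoord Dep ⊕ (Fin 3 ⊕ W) → ℝ) → ℝ) :
    roShadow η₁ η₂ φ = fun a p => roTangent η₁ η₂ (Sum.inr a) (Cov.toTangent C φ p) := by
  funext a p
  have h : jetBase (Cov.toTangent C φ p ∘ Sum.inl) = p ∘ Sum.inl := C.jetBase_prol φ (Cov.toBase p)
  simp only [roTangent, h]
  rfl

end SDeform

end

theorem mainTheorem3 (J₁ J₂ : Set ℝ) (hJ₁ : IsOpen J₁) (hJ₂ : IsOpen J₂) (η₁ η₂ : ℝ → ℝ)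
    (hη₁ : ContDiffOn ℝ ∞ η₁ J₁) (hη₂ : ContDiffOn ℝ ∞ η₂ J₂) :
    (SDeform.covS J₁ J₂ η₁ η₂).IsCovering ∧
    (SDeform.covS J₁ J₂ η₁ η₂).tangent.IsCovering ∧
    (SDeform.covS J₁ J₂ η₁ η₂).tangent.IsMorphism
      (SDeform.sysEta J₁ J₂ η₁ η₂).tangent (SDeform.roTangent η₁ η₂) ∧
    ((∀ t ∈ J₁, η₁ t ≠ 0) → (∀ t ∈ J₂, η₂ t ≠ 0) →
      (SDeform.covS J₁ J₂ η₁ η₂).tangent.IsBacklundAuto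
        (SDeform.roTangent η₁ η₂) (Fin 3 ⊕ Fin 3)) ∧
    ∀ (W : Type*) (dom : Set (SDeform.JetCoord SDeform.Dep ⊕ (Fin 3 ⊕ W) → ℝ))
      (X Y : W → (SDeform.JetCoord SDeform.Dep ⊕ (Fin 3 ⊕ W) → ℝ) → ℝ),
      ((SDeform.covS J₁ J₂ η₁ η₂).extend dom X Y).IsCovering →
      ∀ φ : SDeform.Dep → (SDeform.JetCoord SDeform.Dep ⊕ (Fin 3 ⊕ W) → ℝ) → ℝ,
        ((SDeform.covS J₁ J₂ η₁ η₂).extend dom X Y).IsShadow φ →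
        (SDeform.Cov.adjoinVariations (SDeform.covS J₁ J₂ η₁ η₂)
          ((SDeform.covS J₁ J₂ η₁ η₂).extend dom X Y) φ).IsCovering ∧
        (SDeform.Cov.adjoinVariations (SDeform.covS J₁ J₂ η₁ η₂)
          ((SDeform.covS J₁ J₂ η₁ η₂).extend dom X Y) φ).IsShadow
          (SDeform.roShadow η₁ η₂ φ) := by
  have hT := SDeform.isCovering_tangent_covS hJ₁ hJ₂ hη₁ hη₂
  have hM := SDeform.isMorphism_roTangent hJ₁ hJ₂ hη₁ hη₂
  have hE := SDeform.isNormal_sysEta hJ₁ hJ₂ hη₁ hη₂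
  refine ⟨SDeform.isCovering_covS, hT, hM,
    SDeform.isBacklundAuto_roTangent hJ₁ hJ₂ hη₁ hη₂, fun W dom X Y hC φ hφ => ⟨?_, ?_⟩⟩
  · exact SDeform.Cov.IsCovering.adjoinVariations hE hC hφ hT
  · rw [SDeform.roShadow_eq ((SDeform.covS J₁ J₂ η₁ η₂).extend dom X Y) φ]
    exact SDeform.Cov.IsMorphism.isShadow_comp hE hC hφ hT hM fun a => rfl
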